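/- Let $d\ge 3$ be an integer, $\lambda>0$, $\lambda_c=\lambda_c(d)=\frac{(d-1)^{d-1}}{(d-2)^d}$, $H(x)=-x\ln x-(1-x)\ln(1-x)$ (with $0\ln 0=0$), $\mathcal T=\{(\alpha,\beta):\alpha,\beta\ge 0,\ \alpha+\beta\le 1\}$, and for $(\alpha,\beta)\in\mathcal T$ $$\Phi_1(\alpha,\beta)=(\alpha+\beta)\ln\lambda+H(\alpha)+H(\beta)+d\Big[(1-\beta)H\Big(\tfrac{\alpha}{1-\beta}\Big)-H(\alpha)\Big],$$ where $(1-\beta)H(\frac{\alpha}{1-\beta})$ is read as $0$ at $(\alpha,\beta)=(0,1)$. Let $\mathbb T^d$ be the infinite $d$-regular tree. A probability measure $\mu$ on the independent sets of $\mathbb T^d$ is a (hard-core) Gibbs measure with activity $\lambda$ if for every finite subtree $T$, conditionally on all vertices of the outer boundary of $T$ being unoccupied, the restriction to $T$ equals each independent set $S$ of $T$ with probability $\lambda^{|S|}/\sum_{S'}\lambda^{|S'|}$, the sum being over the independent sets $S'$ of $T$. It is simple if for every vertex $v$, conditionally on either of the two possible values at $v$, the configurations on the $d$ subtrees rooted at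 the neighbours of $v$ are independent. It is translation-invariant if it is invariant under all automorphisms of $\mathbb T^d$, and semi-translation-invariant if it is invariant under all automorphisms preserving the two classes of even and odd vertices (determined by the parity of the distance to a fixed vertex). Then the following hold. 1. For every $\lambda>0$ there is a unique simple translation-invariant Gibbs measure with activity $\lambda$; if $p^*=p^*(\lambda)$ denotes the probability under it that any given vertex is occupied, then $(p^*,p^*)$ is the unique maximum point of $\Phi_1$ over $\{(\alpha,\beta)\in\mathcal T:\alpha=\beta\}$. 2. If $\lambda\le\lambda_c$, then $(p^*,p^*)$ is the unique maximum point of $\Phi_1$ over $\mathcal T$; it is also the only local maximum of $\Phi_1$ relative to $\mathcal T$. 3. If $\lambda>\lambda_c$, then $(p^*,p^*)$ is a saddle point of $\Phi_1$ (a stationary point that is neither a local maximum nor a local minimum), and there are $p_1<p^*<p_2$, $p_i=p_i(\lambda)$, such that the maximum points of $\Phi_1$ over $\mathcal T$ are exactly $(p_1,p_2)$ and $(p_2,p_1)$; these are also the only local maxima of $\Phi_1$ relative to $\mathcal T$. Moreover, there are exactly two simple semi-translation-invariant Gibbs measures with activity $\lambda$ that are not translation-invariant: under one of them even vertices are occupied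 with probability $p_1$ and odd vertices with probability $p_2$, and under the other one even vertices are occupied with probability $p_2$ and odd vertices with probability $p_1$. 4. The function $p^*$ is continuous in $\lambda$ on $(0,\infty)$, the functions $p_1$ and $p_2$ are continuous on $(\lambda_c,\infty)$, and $p_1-p^*\to 0$ and $p_2-p^*\to 0$ as $\lambda\downarrow\lambda_c$. -/

import Mathlib

open Set Filter Topology MeasureTheory ProbabilityTheory

noncomputable section

/-- The critical activity `(d-1)^(d-1) / (d-2)^d`. -/
def criticalActivity (d : ℕ) : ℝ :=
  ((d : ℝ) - 1) ^ (d - 1) / ((d : ℝ) - 2) ^ d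

/-- The triangle of admissible pairs of densities. -/
def triangle : Set (ℝ × ℝ) :=
  {q | 0 ≤ q.1 ∧ 0 ≤ q.2 ∧ q.1 + q.2 ≤ 1}

/-- `Ψ₁(α, β) = (1 - β) H(α / (1 - β)) - H(α)`, with `H` the entropy in natural logarithms. -/
def Psi1 (q : ℝ × ℝ) : ℝ :=
  (1 - q.2) * Real.binEntropy (q.1 / (1 - q.2)) - Real.binEntropy q.1

/-- The first-moment exponent `Φ₁`. -/
def Phi1 (d : ℕ) (lam : ℝ) (q : ℝ × ℝ) : ℝ :=
  (q.1 + q.2) * Real.log lam + Real.binEntropy q.1 + Real.binEntropy q.2 + d * Psi1 q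

/-- A saddle point: a stationary point that is neither a local maximum nor a local minimum. -/
def IsSaddle (f : ℝ × ℝ → ℝ) (q : ℝ × ℝ) : Prop :=
  HasFDerivAt f (0 : ℝ × ℝ →L[ℝ] ℝ) q ∧ ¬ IsLocalMax f q ∧ ¬ IsLocalMin f q

/-- The points of `s` at which `f` attains its (global) maximum over `s`. -/
def maximaOn (f : ℝ × ℝ → ℝ) (s : Set (ℝ × ℝ)) : Set (ℝ × ℝ) :=
  {q | q ∈ s ∧ IsMaxOn f s q}

/-- The points of `s` that are local maxima of `f` relative to `s`. -/
def localMaximaOn (f : ℝ × ℝ → ℝ) (s : Set (ℝ × ℝ)) : Set (ℝ × ℝ) :=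
  {q | q ∈ s ∧ IsLocalMaxOn f s q}

section HardCore

variable {V : Type*} (G : SimpleGraph V)

open Classical in
/-- The partition function of the hard-core model on the finite graph induced on `T`. -/
def partitionFunction (lam : ℝ) (T : Finset V) : ℝ :=
  ∑ S ∈ T.powerset.filter (fun S : Finset V => G.IsIndepSet (S : Set V)), lam ^ S.card

/-- The outer boundary of a set of vertices. -/
def outerBoundary (T : Set V) : Set V :=
  {v | v ∉ T ∧ ∃ u ∈ T, G.Adj u v}

/-- Configurations are sets of (occupied) vertices, with the product σ-algebra.
A Gibbs measure is a probability measure on independent sets such that, for every finite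
subtree `T`, conditioning on the outer boundary of `T` being unoccupied gives the hard-core
distribution with activity `lam` on the independent sets of `T`. -/
structure IsGibbs (lam : ℝ) (μ : Measure (Set V)) : Prop where
  isProbabilityMeasure : IsProbabilityMeasure μ
  ae_isIndepSet : ∀ᵐ I ∂μ, G.IsIndepSet I
  cond_eq : ∀ T : Finset V, (G.induce (T : Set V)).IsTree →
    ∀ S : Finset V, S ⊆ T → G.IsIndepSet (S : Set V) →
      (cond μ {I | Disjoint I (outerBoundary G (T : Set V))}).real {I | I ∩ (T : Set V) = S} =
        lam ^ S.card / partitionFunction G lam T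

/-- For adjacent vertices `v`, `u` of a tree: the vertices of the subtree rooted at `u` that
is obtained by deleting `v`. -/
def branch (v u : V) : Set V :=
  {w | G.dist v w = G.dist u w + 1}

/-- Conditionally on either value at any vertex `v`, the configurations on the subtrees rooted
at the neighbours of `v` are independent. -/
def IsSimpleMeasure (μ : Measure (Set V)) : Prop :=
  ∀ v : V,
    iIndepFun (fun (u : G.neighborSet v) (I : Set V) => I ∩ branch G v u) (cond μ {I | v ∈ I}) ∧
    iIndepFun (fun (u : G.neighborSet v) (I : Set V) => I ∩ branch G v u) (cond μ {I | v ∉ I})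

/-- Invariance under all automorphisms. -/
def IsTranslationInvariant (μ : Measure (Set V)) : Prop :=
  ∀ φ : G ≃g G, μ.map (fun I : Set V => φ '' I) = μ

/-- Even vertices, that is those at even distance from the base vertex `o`; the other vertices
are odd. -/
def IsEvenVertex (o v : V) : Prop := Even (G.dist o v)

/-- Invariance under all parity-preserving automorphisms. -/
def IsSemiTranslationInvariant (o : V) (μ : Measure (Set V)) : Prop :=
  ∀ φ : G ≃g G, (∀ v, IsEvenVertex G o (φ v) ↔ IsEvenVertex G o v) →
    μ.map (fun I : Set V => φ '' I) = μ

end HardCore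

end

/-! Write `d = k + 1`. Both halves of the theorem reduce to one algebraic system, `IsDensityPair`:
`α (1 - α) ^ k = lam (1 - α - β) ^ (k + 1)` together with its mirror image. Its solutions are the
interior stationary points of `Φ₁` and also the possible (even, odd) densities of simple
semi-translation-invariant Gibbs measures.

Measures. For a simple Gibbs measure, the Gibbs condition on a single vertex, combined with
independence of the branches around that vertex, expresses its density through those of its
neighbours (`IsGibbs.density_eq`). Automorphisms of a regular tree act transitively
(`IsTree.exists_iso_apply_eq`), so invariance leaves one density, or one per parity class, and these
satisfy the system. Conversely, a solution yields a tree-indexed Markov chain (`treeMeasure`),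
broadcast from a root with independent coins. Its law does not depend on the root, so that
simplicity and the Gibbs weights can be checked with the root at the vertex in question. Finally a
simple measure on independent sets is determined by its densities (`IsSimpleMeasure.ext`), because a
tree is built leaf by leaf. This gives uniqueness and also invariance under every automorphism that
preserves the densities.

Algebra. With `x = α / (1 - α - β)` and `y = β / (1 - α - β)` the system becomes `x (1 + y) ^ k =
lam = y (1 + x) ^ k`. The left side is increasing on the diagonal, so there is exactly one symmetric
solution. For `x < y`, the parameter `t = (1 + y) / (1 + x) > 1` determines `x`, `y` and `lam` as
rational functions. An AM-GM estimate shows that `lam` increases strictly in `t`, from `λ_c` at `t =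
1` to infinity. Hence an asymmetric pair exists exactly for `lam > λ_c` and is unique up to
exchange. The continuity statements come from the continuous inverses.

Maxima. The infinite slope of the entropy at `0` keeps local maxima off the boundary, so each of
them solves the system, and compactness provides a maximum. Up to `λ_c` there is only one candidate.
Beyond `λ_c` the second derivative at the symmetric point is positive in the antisymmetric
direction, which leaves the asymmetric pair, and the symmetry of the exponent makes both of its
orderings maxima. -/

/-! ### Parents and branches in a tree -/

section TreeGeometry

open Classical in
/-- The neighbour of `w` on the path to the root `r`; the root is its own parent. -/
noncomputable def SimpleGraph.parent {V : Type*} (G : SimpleGraph V) (r w : V) : V :=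
  if h : ∃ p, G.Adj p w ∧ G.dist r w = G.dist r p + 1 then h.choose else w

namespace SimpleGraph

variable {V : Type*} {G : SimpleGraph V}

lemma parent_self (r : V) : G.parent r r = r := by
  simp [parent]

lemma Connected.exists_adj_dist_eq (hG : G.Connected) {r w : V} (h : w ≠ r) :
    ∃ p, G.Adj p w ∧ G.dist r w = G.dist r p + 1 := by
  obtain ⟨p, hp⟩ := hG.exists_walk_length_eq_dist w r
  cases p with
  | nil => exact absurd rfl h
  | @cons _ v _ hadj q =>
    refine ⟨v, hadj.symm, ?_⟩
    have h1 := dist_le q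
    have h2 : G.dist w r ≤ G.dist v r + 1 := by
      have := hG.dist_triangle (u := w) (v := v) (w := r)
      rw [dist_eq_one_iff_adj.2 hadj] at this
      omega
    rw [Walk.length_cons] at hp
    rw [dist_comm (u := r), dist_comm (u := r)]
    omega

lemma Connected.parent_spec (hG : G.Connected) {r w : V} (h : w ≠ r) :
    G.Adj (G.parent r w) w ∧ G.dist r w = G.dist r (G.parent r w) + 1 := by
  have := hG.exists_adj_dist_eq h
  rw [parent, dif_pos this]
  exact this.choose_spec

/-- A shortest path to either neighbour avoids the farther vertex `w`, so it extends by an edge to a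
path ending at `w`. Paths in a tree are unique, hence so are their penultimate vertices. -/
lemma IsTree.eq_of_adj_of_dist_eq (hG : G.IsTree) {r w p q : V} (hp : G.Adj p w) (hq : G.Adj q w)
    (hdp : G.dist r w = G.dist r p + 1) (hdq : G.dist r w = G.dist r q + 1) : p = q := by
  classical
  have key : ∀ p, G.Adj p w → G.dist r w = G.dist r p + 1 →
      ∃ P : G.Walk r w, P.IsPath ∧ P.penultimate = p := by
    intro p hp hdp
    obtain ⟨P, hP, hl⟩ := hG.connected.exists_path_of_dist r p
    refine ⟨P.concat hp, hP.concat ?_ hp, Walk.penultimate_concat _ _⟩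
    intro hw
    have h1 := dist_le (P.takeUntil w hw)
    have h2 := P.length_takeUntil_le_length hw
    omega
  obtain ⟨P, hP, rfl⟩ := key p hp hdp
  obtain ⟨Q, hQ, rfl⟩ := key q hq hdq
  rw [(hG.existsUnique_path r w).unique hP hQ]

lemma IsTree.parent_eq (hG : G.IsTree) {r w p : V} (hp : G.Adj p w)
    (hd : G.dist r w = G.dist r p + 1) : G.parent r w = p := by
  have h : w ≠ r := by rintro rfl; simp at hd
  obtain ⟨h1, h2⟩ := hG.connected.parent_spec h
  exact hG.eq_of_adj_of_dist_eq h1 hp h2 hd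

lemma IsTree.parent_of_adj (hG : G.IsTree) {r w : V} (h : G.Adj r w) : G.parent r w = r :=
  hG.parent_eq h (by simp [dist_eq_one_iff_adj.2 h])

lemma IsTree.parent_eq_or_parent_eq (hG : G.IsTree) (r : V) {x y : V} (h : G.Adj x y) :
    (x ≠ r ∧ G.parent r x = y) ∨ (y ≠ r ∧ G.parent r y = x) := by
  rcases hG.dist_eq_dist_add_one_of_adj r h with h1 | h1
  · exact Or.inl ⟨by rintro rfl; simp at h1, hG.parent_eq h.symm h1⟩
  · exact Or.inr ⟨by rintro rfl; simp at h1, hG.parent_eq h h1⟩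

lemma IsTree.mem_branch_iff (hG : G.IsTree) {v u w : V} (h : G.Adj v u) :
    w ∈ branch G v u ↔ w ≠ v ∧ G.parent w v = u := by
  have e : w ∈ branch G v u ↔ G.dist w v = G.dist w u + 1 := by
    simp [branch, dist_comm]
  rw [e]
  constructor
  · intro hd
    exact ⟨by rintro rfl; simp at hd, hG.parent_eq h.symm hd⟩
  · rintro ⟨hw, rfl⟩
    exact (hG.connected.parent_spec hw.symm).2

lemma IsTree.notMem_branch_iff (hG : G.IsTree) {v u w : V} (h : G.Adj v u) :
    w ∉ branch G v u ↔ w ∈ branch G u v := by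
  have := hG.dist_eq_dist_add_one_of_adj w h
  rw [dist_comm (v := u), dist_comm (v := v)] at this
  simp only [branch, Set.mem_ofPred_eq]
  omega

/-- The edge `v u` is the only edge that leaves the branch at `u`. -/
lemma IsTree.eq_of_adj_of_mem_branch (hG : G.IsTree) {v u x y : V} (h : G.Adj v u)
    (hxy : G.Adj x y) (hx : x ∈ branch G v u) (hy : y ∉ branch G v u) : x = u ∧ y = v := by
  rw [hG.notMem_branch_iff h] at hy
  have hx' : G.dist v x = G.dist u x + 1 := hx
  have hy' : G.dist u y = G.dist v y + 1 := hy
  have h1 := hG.dist_eq_dist_add_one_of_adj u hxy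
  have h2 := hG.dist_eq_dist_add_one_of_adj v hxy
  have h3 : G.dist u x = G.dist v y := by omega
  have hyv : y = v := by
    by_contra hne
    obtain ⟨hz, hdz⟩ := hG.connected.parent_spec hne
    set z := G.parent v y
    have h4 := hG.dist_eq_dist_add_one_of_adj u hz
    have h5 := hG.dist_eq_dist_add_one_of_adj z h
    simp only [dist_comm (u := z)] at h5
    -- Both `z` and `x` are neighbours of `y` one step nearer to `u`. But `z` is nearer to `v` than
    -- `y`, while `x` is farther.
    have : z = x := hG.eq_of_adj_of_dist_eq (r := u) hz hxy (by omega) (by omega)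
    rw [this] at hdz
    omega
  refine ⟨?_, hyv⟩
  rw [hyv, dist_self, hG.connected.dist_eq_zero_iff] at h3
  exact h3.symm

lemma self_mem_branch {v u : V} (h : G.Adj v u) : u ∈ branch G v u := by
  simp [branch, dist_eq_one_iff_adj.2 h]

lemma self_notMem_branch (v u : V) : v ∉ branch G v u := by
  simp [branch]

/-- Parents with respect to a root outside of a branch stay in the branch. -/
lemma IsTree.parent_mem_branch (hG : G.IsTree) {v u r x : V} (h : G.Adj v u)
    (hr : r ∉ branch G v u) (hx : x ∈ branch G v u) (hxu : x ≠ u) :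
    G.parent r x ∈ branch G v u := by
  by_contra hp
  have hxr : x ≠ r := by rintro rfl; exact hr hx
  exact hxu (hG.eq_of_adj_of_mem_branch h (hG.connected.parent_spec hxr).1.symm hx hp).1

lemma IsTree.disjoint_branch (hG : G.IsTree) {v u u' : V} (h : G.Adj v u) (h' : G.Adj v u')
    (hne : u ≠ u') : Disjoint (branch G v u) (branch G v u') := by
  rw [Set.disjoint_left]
  intro x hx hx'
  rw [hG.mem_branch_iff h] at hx
  rw [hG.mem_branch_iff h'] at hx'
  exact hne (hx.2.symm.trans hx'.2)

/-- Moving the root along an edge changes only the parents of the two ends of the edge. -/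
lemma IsTree.parent_eq_parent_of_adj (hG : G.IsTree) {o v x : V} (h : G.Adj o v)
    (hxo : x ≠ o) (hxv : x ≠ v) : G.parent o x = G.parent v x := by
  obtain ⟨hp, hd⟩ := hG.connected.parent_spec hxo
  refine (hG.parent_eq hp ?_).symm
  set p := G.parent o x
  -- Neither end of the edge `p x` allows it to cross the edge `o v`, so the distances to `o` and to
  -- `v` differ by the same amount at `x` and at `p`.
  have key : x ∈ branch G o v ↔ p ∈ branch G o v := by
    constructor
    · intro hx
      by_contra hpb
      exact hxv (hG.eq_of_adj_of_mem_branch h hp.symm hx hpb).1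
    · intro hpb
      by_contra hx
      exact hxo (hG.eq_of_adj_of_mem_branch h hp hpb hx).2
  have hx := hG.notMem_branch_iff (w := x) h
  have hp' := hG.notMem_branch_iff (w := p) h
  simp only [branch, Set.mem_ofPred_eq] at key hx hp'
  omega

/-- Spheres around a vertex are finite by induction on the radius. Countability is what makes a
single configuration a measurable set. -/
lemma Connected.countable_of_locallyFinite [G.LocallyFinite] (hG : G.Connected) :
    Countable V := by
  obtain ⟨o⟩ := hG.nonempty
  have hfin : ∀ n : ℕ, {v | G.dist o v = n}.Finite := by
    intro n
    induction n with
    | zero =>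
      refine (Set.finite_singleton o).subset fun v hv => ?_
      exact (hG.dist_eq_zero_iff.1 hv).symm
    | succ n ih =>
      refine (ih.biUnion fun v _ => (G.neighborFinset v).finite_toSet).subset fun w hw => ?_
      have hwo : w ≠ o := by rintro rfl; simp at hw
      obtain ⟨h1, h2⟩ := hG.parent_spec hwo
      simp only [Set.mem_iUnion]
      refine ⟨G.parent o w, ?_, by simpa using h1⟩
      have : G.dist o w = n + 1 := hw
      change G.dist o _ = n
      omega
  have : (Set.univ : Set V) = ⋃ n : ℕ, {v | G.dist o v = n} := by
    ext v; simp
  rw [← Set.countable_univ_iff, this]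
  exact Set.countable_iUnion fun n => (hfin n).countable

lemma Connected.induction_on_root {motive : V → Prop} (hG : G.Connected) (o : V)
    (root : motive o) (step : ∀ v, v ≠ o → motive (G.parent o v) → motive v) (v : V) :
    motive v := by
  induction hn : G.dist o v using Nat.strong_induction_on generalizing v with
  | _ n ih =>
    by_cases hv : v = o
    · exact hv ▸ root
    · have := (hG.parent_spec hv).2
      exact step v hv (ih _ (by omega) _ rfl)

end SimpleGraph

lemma isEvenVertex_self {V : Type*} (G : SimpleGraph V) (o : V) : IsEvenVertex G o o := by
  simp [IsEvenVertex]

lemma isEvenVertex_iff_not_of_adj {V : Type*} {G : SimpleGraph V} (hG : G.IsTree) (o : V) {v w : V}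
    (h : G.Adj v w) : IsEvenVertex G o v ↔ ¬ IsEvenVertex G o w := by
  unfold IsEvenVertex
  rcases hG.dist_eq_dist_add_one_of_adj o h with h1 | h1 <;> rw [h1] <;> grind

end TreeGeometry

/-! ### Homogeneity of regular trees -/

section Homogeneity

namespace SimpleGraph

variable {V : Type*} {G : SimpleGraph V}

/-- Between neighbourhoods of equal size there is a bijection with one prescribed value. -/
lemma IsRegularOfDegree.exists_bijOn_neighborSet [G.LocallyFinite] {d : ℕ}
    (hreg : G.IsRegularOfDegree d) (a b x y : V) :
    ∃ e : V → V, Set.BijOn e (G.neighborSet a) (G.neighborSet b) ∧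
      (G.Adj a x → G.Adj b y → e x = y) := by
  classical
  have hcard : Fintype.card (G.neighborSet a) = Fintype.card (G.neighborSet b) := by
    rw [G.card_neighborSet_eq_degree, G.card_neighborSet_eq_degree, hreg.degree_eq,
      hreg.degree_eq]
  let e₀ : G.neighborSet a ≃ G.neighborSet b := Fintype.equivOfCardEq hcard
  have extend : ∀ e : G.neighborSet a ≃ G.neighborSet b,
      Set.BijOn (fun z => if h : G.Adj a z then (e ⟨z, h⟩ : V) else z)
        (G.neighborSet a) (G.neighborSet b) := by
    intro e
    refine ⟨fun z hz => ?_, fun z hz z' hz' h => ?_, fun w hw => ?_⟩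
    · have hz' : G.Adj a z := hz
      simp [hz']
    · have h1 : G.Adj a z := hz
      have h2 : G.Adj a z' := hz'
      simp only [h1, h2, dif_pos] at h
      exact congrArg Subtype.val (e.injective (Subtype.ext h))
    · refine ⟨(e.symm ⟨w, hw⟩ : V), (e.symm ⟨w, hw⟩).2, ?_⟩
      have : G.Adj a (e.symm ⟨w, hw⟩ : V) := (e.symm ⟨w, hw⟩).2
      exact (dif_pos this).trans (congrArg Subtype.val (e.apply_symm_apply ⟨w, hw⟩))
  by_cases hx : G.Adj a x
  · by_cases hy : G.Adj b y
    -- Composing with a transposition corrects an arbitrary bijection at the one prescribed point.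
    · refine ⟨_, extend (e₀.trans (Equiv.swap (e₀ ⟨x, hx⟩) ⟨y, hy⟩)), fun _ _ => ?_⟩
      simp [hx]
    · exact ⟨_, extend e₀, fun _ h => absurd h hy⟩
  · exact ⟨_, extend e₀, fun h => absurd h hx⟩

/-! ### Extending local bijections of neighbourhoods from a root -/

section Extension

variable (G) (o o' : V) (e : V → V → V → V → V → V)

/-- The images of the parent of `w` and of `w` under the map that is extended from the root along
the local bijections `e`, for `w` at distance `n` from the root. -/
noncomputable def extendAux : ℕ → V → V × V
  | 0, _ => (o', o')
  | n + 1, w =>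
    let s := extendAux n (G.parent o w)
    (s.2, e (G.parent o w) s.2 (G.parent o (G.parent o w)) s.1 w)

/-- The map extended from the root along the local bijections `e`. -/
noncomputable def extendFromRoot (w : V) : V := (extendAux G o o' e (G.dist o w) w).2

variable {G o o' e}

lemma extendFromRoot_root : extendFromRoot G o o' e o = o' := by
  simp [extendFromRoot, extendAux]

lemma Connected.extendAux_fst (hG : G.Connected) (w : V) :
    (extendAux G o o' e (G.dist o w) w).1 = extendFromRoot G o o' e (G.parent o w) := by
  by_cases hw : w = o
  · subst hw
    rw [parent_self, extendFromRoot_root, dist_self]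
    rfl
  · rw [(hG.parent_spec hw).2]
    rfl

lemma Connected.extendFromRoot_eq (hG : G.Connected) {w : V} (hw : w ≠ o) :
    extendFromRoot G o o' e w =
      e (G.parent o w) (extendFromRoot G o o' e (G.parent o w)) (G.parent o (G.parent o w))
        (extendFromRoot G o o' e (G.parent o (G.parent o w))) w := by
  rw [← hG.extendAux_fst (G.parent o w), extendFromRoot, (hG.parent_spec hw).2]
  rfl

end Extension

/-- The automorphism group of a regular tree acts transitively on the vertices. -/
theorem IsTree.exists_iso_apply_eq [G.LocallyFinite] (hG : G.IsTree) {d : ℕ}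
    (hreg : G.IsRegularOfDegree d) (o o' : V) : ∃ φ : G ≃g G, φ o = o' := by
  choose e hbij hval using hreg.exists_bijOn_neighborSet
  set f := extendFromRoot G o o' e
  have hroot : f o = o' := extendFromRoot_root
  have hstep : ∀ w, w ≠ o → f w = e (G.parent o w) (f (G.parent o w))
      (G.parent o (G.parent o w)) (f (G.parent o (G.parent o w))) w :=
    fun w hw => hG.connected.extendFromRoot_eq hw
  have hpar : ∀ w, w ≠ o → G.Adj (f (G.parent o w)) (f w) := by
    intro w hw
    rw [hstep w hw]
    exact (hbij _ _ _ _).mapsTo (hG.connected.parent_spec hw).1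
  -- The local bijection at `p` was chosen with its value at the parent prescribed, so on all
  -- neighbours of `p`, not only on the children, it agrees with `f`.
  have hup : ∀ p, p ≠ o → e p (f p) (G.parent o p) (f (G.parent o p)) (G.parent o p) =
      f (G.parent o p) :=
    fun p hp => hval _ _ _ _ (hG.connected.parent_spec hp).1.symm (hpar p hp).symm
  have hdist : ∀ w, G.dist o' (f w) = G.dist o w := by
    -- The step uses two generations, so the claim for the parent is carried along.
    suffices ∀ w, G.dist o' (f w) = G.dist o w ∧
        G.dist o' (f (G.parent o w)) = G.dist o (G.parent o w) from fun w => (this w).1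
    refine hG.connected.induction_on_root o (by simp [hroot, parent_self]) fun w hw ih => ?_
    refine ⟨?_, ih.1⟩
    obtain ⟨hadj, hd⟩ := hG.connected.parent_spec hw
    have h1 := hpar w hw
    rcases hG.dist_eq_dist_add_one_of_adj o' h1 with h2 | h2
    -- If the image turned back towards `o'`, it would coincide with the image of the grandparent,
    -- and injectivity of the local bijection at `p` would identify `w` with its grandparent.
    · exfalso
      set p := G.parent o w with hp
      have hpo : p ≠ o := by
        intro h
        rw [h, hroot] at h2
        simp at h2
      obtain ⟨hadj', hd'⟩ := hG.connected.parent_spec hpo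
      have h5 : f w = f (G.parent o p) :=
        hG.eq_of_adj_of_dist_eq h1.symm (hpar p hpo) h2 (by omega)
      have h6 := (hbij _ _ _ _).injOn hadj hadj'.symm
        ((hstep w hw).symm.trans (h5.trans (hup p hpo).symm))
      rw [h6] at hd
      omega
    · omega
  have hparent : ∀ w, w ≠ o → G.parent o' (f w) = f (G.parent o w) := by
    intro w hw
    refine hG.parent_eq (hpar w hw) ?_
    rw [hdist, hdist]
    exact (hG.connected.parent_spec hw).2
  have hne : ∀ w, w ≠ o → f w ≠ o' := by
    intro w hw h
    have := hdist w
    rw [h, dist_self] at this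
    exact hw (hG.connected.dist_eq_zero_iff.1 this.symm).symm
  have hinj : ∀ w w', f w = f w' → w = w' := by
    refine hG.connected.induction_on_root o ?_ fun w hw ih => ?_
    · intro w' h
      by_contra hw'
      exact hne w' (Ne.symm hw') (by rw [← h, hroot])
    · intro w' h
      have hw' : w' ≠ o := by
        rintro rfl
        exact hne w hw (by rw [h, hroot])
      have h1 : G.parent o w = G.parent o w' := by
        apply ih
        rw [← hparent w hw, ← hparent w' hw', h]
      rw [hstep w hw, hstep w' hw', ← h1] at h
      refine (hbij _ _ _ _).injOn (hG.connected.parent_spec hw).1 ?_ h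
      rw [h1]
      exact (hG.connected.parent_spec hw').1
  have hsurj : ∀ y, ∃ w, f w = y := by
    refine hG.connected.induction_on_root o' ⟨o, hroot⟩ fun y hy ih => ?_
    obtain ⟨p, hp⟩ := ih
    obtain ⟨hadj, hd⟩ := hG.connected.parent_spec hy
    rw [← hp] at hadj hd
    obtain ⟨z, hz, hzy⟩ :=
      (hbij p (f p) (G.parent o p) (f (G.parent o p))).surjOn
        (show y ∈ G.neighborSet (f p) from hadj)
    have hz : G.Adj p z := hz
    refine ⟨z, ?_⟩
    -- The preimage `z` of `y` under the local bijection at `p` cannot be the parent of `p`, since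
    -- `f` preserves distances to the root and `y` is farther out than `f p`. So `z` is a child,
    -- where `f` is given by that bijection.
    rcases hG.parent_eq_or_parent_eq o hz with ⟨hpo, h1⟩ | ⟨hzo, h1⟩
    · exfalso
      have h2 := hup p hpo
      rw [h1] at h2 hzy
      rw [hzy] at h2
      have h3 := hdist z
      have h4 := (hG.connected.parent_spec hpo).2
      rw [h1] at h4
      rw [← h2, hd, hdist p] at h3
      omega
    · rw [hstep z hzo, h1, hzy]
  have hadj : ∀ x y, G.Adj (f x) (f y) ↔ G.Adj x y := by
    intro x y
    constructor
    · intro h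
      rcases hG.parent_eq_or_parent_eq o' h with ⟨hx, h1⟩ | ⟨hy, h1⟩
      · have hxo : x ≠ o := by rintro rfl; exact hx hroot
        rw [hparent x hxo] at h1
        rw [← hinj _ _ h1]
        exact (hG.connected.parent_spec hxo).1.symm
      · have hyo : y ≠ o := by rintro rfl; exact hy hroot
        rw [hparent y hyo] at h1
        rw [← hinj _ _ h1]
        exact (hG.connected.parent_spec hyo).1
    · intro h
      rcases hG.parent_eq_or_parent_eq o h with ⟨hx, h1⟩ | ⟨hy, h1⟩
      · rw [← h1]; exact (hpar x hx).symm
      · rw [← h1]; exact hpar y hy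
  exact ⟨⟨Equiv.ofBijective f ⟨fun x y h => hinj x y h, hsurj⟩, fun {x y} => hadj x y⟩, hroot⟩

end SimpleGraph

/-- An automorphism of a tree that sends one vertex to a vertex of the same parity preserves the
parity of all vertices. -/
lemma isEvenVertex_apply_iff {V : Type*} {G : SimpleGraph V} (hG : G.IsTree) (o : V) (φ : G ≃g G)
    {u : V} (hu : IsEvenVertex G o (φ u) ↔ IsEvenVertex G o u) (v : V) :
    IsEvenVertex G o (φ v) ↔ IsEvenVertex G o v := by
  refine hG.connected.induction_on_root u
    (motive := fun v => IsEvenVertex G o (φ v) ↔ IsEvenVertex G o v) hu (fun w hw ih => ?_) v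
  have h := (hG.connected.parent_spec hw).1
  have h1 := isEvenVertex_iff_not_of_adj hG o h
  have h2 := isEvenVertex_iff_not_of_adj hG o (φ.map_adj_iff.2 h)
  tauto

end Homogeneity

/-! ### Events that depend on disjoint sets of coordinates -/

section ProductMeasure

open Measure

lemma measure_ext_of_real {Ω : Type*} [MeasurableSpace Ω] {μ ν : Measure Ω} [IsFiniteMeasure μ]
    [IsFiniteMeasure ν] (h : ∀ s, MeasurableSet s → μ.real s = ν.real s) : μ = ν :=
  Measure.ext fun s hs => (measureReal_eq_measureReal_iff).1 (h s hs)

lemma iIndepFun_map {Ω Ω' κ : Type*} [MeasurableSpace Ω] [MeasurableSpace Ω'] {β : κ → Type*}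
    [∀ k, MeasurableSpace (β k)] {P : Measure Ω} {g : Ω → Ω'} (hg : Measurable g)
    {f : ∀ k, Ω' → β k} (hf : ∀ k, Measurable (f k)) (h : iIndepFun (fun k ω => f k (g ω)) P) :
    iIndepFun f (P.map g) := by
  rw [iIndepFun_iff_measure_inter_preimage_eq_mul] at h ⊢
  intro S A hA
  have h1 := h S hA
  have hm : ∀ k ∈ S, MeasurableSet (f k ⁻¹' A k) := fun k hk => hf k (hA k hk)
  rw [Measure.map_apply hg (Finset.measurableSet_biInter S hm),
    Finset.prod_congr rfl fun k hk => Measure.map_apply hg (hm k hk), preimage_iInter₂]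
  exact h1

variable {V : Type*} {X : V → Type*} [∀ i, MeasurableSpace (X i)]
  (ν : ∀ i, Measure (X i)) [∀ i, IsProbabilityMeasure (ν i)]

/-- Overwriting the coordinates outside `A` by those of a fixed reference point is a map measurable
with respect to the coordinates in `A`, and the preimage of `E` under it is `E` itself. -/
lemma measurableSet_iSup_comap_of_dependsOn {E : Set (∀ i, X i)} (hE : MeasurableSet E)
    {A : Set V} (hd : DependsOn (fun U => U ∈ E) A) :
    MeasurableSet[⨆ i ∈ A, MeasurableSpace.comap (fun U : ∀ i, X i => U i) inferInstance] E := by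
  classical
  rcases E.eq_empty_or_nonempty with rfl | ⟨c, -⟩
  · exact @MeasurableSet.empty _ (_)
  let g : (∀ i, X i) → ∀ i, X i := fun U i => if i ∈ A then U i else c i
  have hg : Measurable[⨆ i ∈ A, MeasurableSpace.comap (fun U : ∀ i, X i => U i) inferInstance]
      g := by
    refine @measurable_pi_iff _ _ _ (_) _ _ |>.2 fun i => ?_
    by_cases hi : i ∈ A
    · simp only [g, hi, if_true]
      rw [measurable_iff_comap_le]
      exact le_iSup₂_of_le i hi le_rfl
    · simp only [g, hi, if_false]
      exact measurable_const
  have : E = g ⁻¹' E := by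
    ext U
    have := hd (x := U) (y := g U) (fun i hi => by simp [g, hi])
    simpa using this
  rw [this]
  exact hg hE

lemma infinitePi_inter_of_dependsOn {E F : Set (∀ i, X i)} (hE : MeasurableSet E)
    (hF : MeasurableSet F) {A B : Set V} (hAB : Disjoint A B)
    (hEA : DependsOn (fun U => U ∈ E) A) (hFB : DependsOn (fun U => U ∈ F) B) :
    infinitePi ν (E ∩ F) = infinitePi ν E * infinitePi ν F := by
  have h1 : iIndepFun (fun (i : V) (U : ∀ i, X i) => U i) (infinitePi ν) :=
    iIndepFun_infinitePi (P := ν) (X := fun _ x => x) fun _ => measurable_id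
  have h2 := indep_iSup_of_disjoint (fun i => (measurable_pi_apply i).comap_le) h1.iIndep hAB
  exact (Indep_iff _ _ _).1 h2 E F (measurableSet_iSup_comap_of_dependsOn hE hEA)
    (measurableSet_iSup_comap_of_dependsOn hF hFB)

lemma iIndepFun_infinitePi_of_dependsOn {κ : Type*} {β : κ → Type*} [∀ k, MeasurableSpace (β k)]
    {f : ∀ k, (∀ i, X i) → β k} (hf : ∀ k, Measurable (f k)) {B : κ → Set V}
    (hB : Pairwise (Function.onFun Disjoint B)) (hd : ∀ k, DependsOn (f k) (B k)) :
    iIndepFun f (infinitePi ν) := by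
  classical
  rw [iIndepFun_iff_measure_inter_preimage_eq_mul]
  intro S A hA
  induction S using Finset.induction_on with
  | empty => simp
  | insert k S hk ih =>
    rw [Finset.set_biInter_insert, Finset.prod_insert hk,
      ← ih fun i hi => hA i (Finset.mem_insert_of_mem hi)]
    refine infinitePi_inter_of_dependsOn ν (A := B k) (B := ⋃ j ∈ S, B j) ?_ ?_ ?_ ?_ ?_
    · exact hf k (hA k (Finset.mem_insert_self _ _))
    · exact Finset.measurableSet_biInter S fun j hj => hf j (hA j (Finset.mem_insert_of_mem hj))
    · simp only [disjoint_iUnion_right]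
      intro j hj
      exact hB (by rintro rfl; exact hk hj)
    · intro U U' h
      simp only [mem_preimage, hd k h]
    · intro U U' h
      simp only [mem_iInter, mem_preimage, eq_iff_iff]
      refine forall₂_congr fun j hj => ?_
      rw [hd j fun i hi => h i (mem_biUnion hj hi)]

end ProductMeasure

/-! ### Independent Bernoulli coins at the vertices -/

section Coins

open Measure unitInterval

variable {V : Type*}

/-- Independent coins at all vertices. -/
noncomputable def coinMeasure (q : V → I) : Measure (V → Bool) :=
  infinitePi fun v => bernoulliMeasure true false (q v)

variable (q : V → I)

instance : IsProbabilityMeasure (coinMeasure q) := by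
  unfold coinMeasure; infer_instance

lemma coinMeasure_inter_of_dependsOn {E F : Set (V → Bool)} (hE : MeasurableSet E)
    (hF : MeasurableSet F) {A B : Set V} (hAB : Disjoint A B)
    (hEA : DependsOn (fun U => U ∈ E) A) (hFB : DependsOn (fun U => U ∈ F) B) :
    (coinMeasure q).real (E ∩ F) = (coinMeasure q).real E * (coinMeasure q).real F := by
  simp only [measureReal_def, ← ENNReal.toReal_mul]
  rw [coinMeasure, infinitePi_inter_of_dependsOn _ hE hF hAB hEA hFB]

lemma measurableSet_coin (v : V) (b : Bool) : MeasurableSet {U : V → Bool | U v = b} :=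
  measurableSet_eq_fun (measurable_pi_apply v) measurable_const

lemma coinMeasure_real_forall_eq_false (s : Finset V) :
    (coinMeasure q).real {U | ∀ v ∈ s, U v = false} = ∏ v ∈ s, (1 - (q v : ℝ)) := by
  have : {U : V → Bool | ∀ v ∈ s, U v = false} = Set.pi (s : Set V) fun _ => {false} := by
    ext U; simp [Set.mem_pi]
  rw [this, measureReal_def, coinMeasure, infinitePi_pi _ (fun _ _ => measurableSet_singleton _),
    ENNReal.toReal_prod]
  refine Finset.prod_congr rfl fun v _ => ?_
  rw [← measureReal_def, bernoulliMeasure_real_apply_of_notMem_of_mem _ (measurableSet_singleton _)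
    (by simp) (by simp)]

lemma coinMeasure_real_eq_true (v : V) : (coinMeasure q).real {U | U v = true} = q v := by
  have h := coinMeasure_real_forall_eq_false q {v}
  have h2 := probReal_compl_eq_one_sub (μ := coinMeasure q) (measurableSet_coin v false)
  have h3 : {U : V → Bool | U v = false}ᶜ = {U | U v = true} := by ext; simp
  simp only [Finset.mem_singleton, forall_eq, Finset.prod_singleton] at h
  rw [h3, h] at h2
  linarith

open Classical in
/-- Conditioning on one coin. -/
lemma coinMeasure_real_split (v : V) {E : Set (V → Bool)} (hE : MeasurableSet E) :
    (coinMeasure q).real E =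
      q v * (coinMeasure q).real {U | Function.update U v true ∈ E} +
      (1 - q v) * (coinMeasure q).real {U | Function.update U v false ∈ E} := by
  have hm : ∀ b : Bool, MeasurableSet {U : V → Bool | Function.update U v b ∈ E} := fun b =>
    (measurable_pi_iff.2 fun i => by
      by_cases hi : i = v
      · subst hi; simp
      · simpa [hi] using measurable_pi_apply i :
      Measurable fun U : V → Bool => Function.update U v b) hE
  have hsplit : E = ({U | U v = true} ∩ {U | Function.update U v true ∈ E}) ∪
      ({U | U v = false} ∩ {U | Function.update U v false ∈ E}) := by
    ext U
    cases h : U v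
    · have : Function.update U v false = U := by rw [← h]; simp
      simp [h, this]
    · have : Function.update U v true = U := by rw [← h]; simp
      simp [h, this]
  have hind : ∀ b : Bool, (coinMeasure q).real ({U | U v = b} ∩ {U | Function.update U v b ∈ E}) =
      (coinMeasure q).real {U | U v = b} *
        (coinMeasure q).real {U | Function.update U v b ∈ E} := by
    intro b
    refine coinMeasure_inter_of_dependsOn q (measurableSet_coin v b) (hm b)
      (A := {v}) (B := {v}ᶜ) disjoint_compl_right ?_ ?_
    · intro U U' h
      simp [h v rfl]
    · intro U U' h
      have : Function.update U v b = Function.update U' v b := by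
        ext i
        by_cases hi : i = v
        · subst hi; simp
        · simp [hi, h i hi]
      simp [this]
  have hdis : Disjoint ({U | U v = true} ∩ {U | Function.update U v true ∈ E})
      ({U | U v = false} ∩ {U | Function.update U v false ∈ E}) := by
    rw [Set.disjoint_left]
    rintro U ⟨h1, -⟩ ⟨h2, -⟩
    exact Bool.noConfusion (h1.symm.trans h2)
  have hf := coinMeasure_real_forall_eq_false q {v}
  simp only [Finset.mem_singleton, forall_eq, Finset.prod_singleton] at hf
  conv_lhs => rw [hsplit]
  rw [measureReal_union hdis ((measurableSet_coin v false).inter (hm false)), hind, hind, hf,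
    coinMeasure_real_eq_true]

end Coins

/-! ### Broadcasting an independent set from a root -/

section Broadcast

variable {V : Type*} (G : SimpleGraph V)

/-- Whether `w`, at distance `n` from the root, is occupied: the root is occupied if `b` holds, and
another vertex is occupied if its coin shows `true` and its parent is not occupied. -/
def occupiedAt (r : V) (b : Bool) (U : V → Bool) : ℕ → V → Prop
  | 0, _ => b = true
  | n + 1, w => U w = true ∧ ¬ occupiedAt r b U n (G.parent r w)

/-- The independent set that is broadcast from the root `r` with the coins `U`. -/
def broadcast (r : V) (b : Bool) (U : V → Bool) : Set V :=
  {w | occupiedAt G r b U (G.dist r w) w}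

variable {G} {r : V} {b : Bool} {U : V → Bool}

@[simp]
lemma root_mem_broadcast : r ∈ broadcast G r b U ↔ b = true := by
  simp [broadcast, occupiedAt]

lemma mem_broadcast_iff (hG : G.Connected) {w : V} (hw : w ≠ r) :
    w ∈ broadcast G r b U ↔ U w = true ∧ G.parent r w ∉ broadcast G r b U := by
  simp only [broadcast, mem_ofPred_eq]
  rw [(hG.parent_spec hw).2]
  rfl

lemma eq_broadcast (hG : G.Connected) {J : Set V} (hr : r ∈ J ↔ b = true)
    (h : ∀ w, w ≠ r → (w ∈ J ↔ U w = true ∧ G.parent r w ∉ J)) : J = broadcast G r b U := by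
  ext w
  refine hG.induction_on_root r (motive := fun w => w ∈ J ↔ w ∈ broadcast G r b U)
    (by simp [hr]) (fun w hw ih => ?_) w
  rw [h w hw, mem_broadcast_iff hG hw, ih]

lemma isIndepSet_broadcast (hG : G.IsTree) : G.IsIndepSet (broadcast G r b U) := by
  intro x hx y hy _ hadj
  rcases hG.parent_eq_or_parent_eq r hadj with ⟨h, h'⟩ | ⟨h, h'⟩
  · rw [mem_broadcast_iff hG.connected h, h'] at hx
    exact hx.2 hy
  · rw [mem_broadcast_iff hG.connected h, h'] at hy
    exact hy.2 hx

lemma measurable_broadcast (hG : G.Connected) (r : V) (b : Bool) :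
    Measurable (broadcast G r b) := by
  rw [measurable_set_iff]
  refine hG.induction_on_root r ?_ fun w hw ih => ?_
  · simp
  · simp only [mem_broadcast_iff hG hw]
    refine Measurable.and ?_ ih.not
    exact measurableSet_setOfPred.1 (measurableSet_coin w true)

/-- The recursion inside a branch meets only coins of that branch until it reaches the top vertex
`u`, whose parent is the root with its fixed state `b`. Disjoint branches thus use disjoint sets of
coins, which is the source of simplicity. -/
lemma dependsOn_broadcast_inter_branch (hG : G.IsTree) {u : V} (h : G.Adj r u) :
    DependsOn (fun U => broadcast G r b U ∩ branch G r u) (branch G r u) := by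
  intro U U' hUU'
  ext x
  refine and_congr_left fun hx => ?_
  have hr : r ∉ branch G r u := SimpleGraph.self_notMem_branch r u
  refine hG.connected.induction_on_root r (motive := fun x => x ∈ branch G r u →
    (x ∈ broadcast G r b U ↔ x ∈ broadcast G r b U')) (fun h => absurd h hr) ?_ x hx
  intro w hw ih hwb
  rw [mem_broadcast_iff hG.connected hw, mem_broadcast_iff hG.connected hw, hUU' w hwb]
  refine and_congr_right fun _ => not_congr ?_
  by_cases hwu : w = u
  · subst hwu
    rw [hG.parent_of_adj h]
    simp
  · exact ih (hG.parent_mem_branch h hr hwb hwu)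

/-- Neighbours of an occupied root are vacant whatever their coins show. -/
lemma dependsOn_broadcast_true (hG : G.IsTree) :
    DependsOn (broadcast G r true) {w | ¬ G.Adj r w} := by
  intro U U' h
  refine eq_broadcast hG.connected (by simp) fun w hw => ?_
  rw [mem_broadcast_iff hG.connected hw]
  by_cases hadj : G.Adj r w
  · simp [hG.parent_of_adj hadj]
  · rw [h w hadj]

/-- When all coins next to the root show `false`, its neighbours are vacant for either state of the
root, and nothing below them notices the difference. This compares the weights of a configuration
with and without the root. -/
lemma broadcast_true_eq_insert (hG : G.IsTree) (hU : ∀ u, G.Adj r u → U u = false) :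
    broadcast G r true U = insert r (broadcast G r false U) := by
  symm
  refine eq_broadcast hG.connected (by simp) fun w hw => ?_
  rw [mem_insert_iff, or_iff_right hw, mem_broadcast_iff hG.connected hw, mem_insert_iff, not_or]
  refine and_congr_right fun hUw => ?_
  have : G.parent r w ≠ r := by
    intro hp
    have := hU w (hp ▸ (hG.connected.parent_spec hw).1)
    simp_all
  simp [this]

/-! ### Moving the root across an edge -/

section RootChange

open Classical in
-- With `o` vacant and a `true` coin at `v`, the vertex `v` is occupied. Read from `v`, the vacancy
-- of `o` is automatic, so the coin of `o` plays no role.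
lemma broadcast_false_update_true (hG : G.IsTree) {o v : V} (h : G.Adj o v) (U : V → Bool) :
    broadcast G o false (Function.update U v true) = broadcast G v true U := by
  refine eq_broadcast hG.connected ?_ fun w hw => ?_
  · rw [mem_broadcast_iff hG.connected h.ne', hG.parent_of_adj h]
    simp
  · by_cases hwo : w = o
    · subst hwo
      rw [hG.parent_of_adj h.symm, mem_broadcast_iff hG.connected h.ne', hG.parent_of_adj h]
      simp
    · rw [mem_broadcast_iff hG.connected hwo, hG.parent_eq_parent_of_adj h hwo hw]
      simp [hw]

open Classical in
lemma broadcast_false_update_false (hG : G.IsTree) {o v : V} (h : G.Adj o v) (U : V → Bool) :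
    broadcast G o false (Function.update U v false) =
      broadcast G v false (Function.update U o false) := by
  refine eq_broadcast hG.connected ?_ fun w hw => ?_
  · rw [mem_broadcast_iff hG.connected h.ne']
    simp
  · by_cases hwo : w = o
    · subst hwo
      simp
    · rw [mem_broadcast_iff hG.connected hwo, hG.parent_eq_parent_of_adj h hwo hw]
      simp [hw, hwo]

end RootChange

end Broadcast

/-! ### The tree-indexed Markov chain with given densities -/

section TreeMeasure

variable {V : Type*}

lemma measurable_inter_const (B : Set V) : Measurable fun I : Set V => I ∩ B :=
  measurable_set_iff.2 fun x => by
    by_cases hx : x ∈ B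
    · simpa [hx] using measurable_set_mem x
    · simp [hx]

lemma measurableSet_inter_eq [Countable V] (B S : Set V) :
    MeasurableSet {I : Set V | I ∩ B = S} :=
  (measurable_inter_const B) (measurableSet_singleton S)

lemma measurableSet_isIndepSet [Countable V] (G : SimpleGraph V) :
    MeasurableSet {I : Set V | G.IsIndepSet I} := by
  have : {I : Set V | G.IsIndepSet I} = ⋂ (x : V) (y : V),
      {I | ¬ (G.Adj x y ∧ x ∈ I ∧ y ∈ I)} := by
    ext I
    simp only [mem_ofPred_eq, mem_iInter]
    constructor
    · rintro h x y ⟨hadj, hx, hy⟩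
      exact h hx hy hadj.ne hadj
    · intro h x hx y hy _ hadj
      exact h x y ⟨hadj, hx, hy⟩
  rw [this]
  refine MeasurableSet.iInter fun x => MeasurableSet.iInter fun y => MeasurableSet.compl ?_
  exact (MeasurableSet.const _).inter ((measurableSet_mem x).inter (measurableSet_mem y))

lemma cond_real_apply {Ω : Type*} [MeasurableSpace Ω] (μ : Measure Ω) {s : Set Ω}
    (hs : MeasurableSet s) (t : Set Ω) :
    (cond μ s).real t = (μ.real s)⁻¹ * μ.real (s ∩ t) := by
  simp [measureReal_def, cond_apply hs]

variable (G : SimpleGraph V)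

/-- The distribution of the independent set that is broadcast from the root `r`, where the root is
occupied with probability `a r`, and a vertex `v` with unoccupied parent with probability `q v`. -/
noncomputable def treeMeasure (a q : V → unitInterval) (r : V) : Measure (Set V) :=
  unitInterval.toNNReal (a r) • (coinMeasure q).map (broadcast G r true) +
    unitInterval.toNNReal (unitInterval.symm (a r)) • (coinMeasure q).map (broadcast G r false)

variable {G} {a q : V → unitInterval}

lemma isProbabilityMeasure_treeMeasure (hG : G.IsTree) (r : V) :
    IsProbabilityMeasure (treeMeasure G a q r) := by
  have h1 : ∀ b, IsProbabilityMeasure ((coinMeasure q).map (broadcast G r b)) := fun b =>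
    Measure.isProbabilityMeasure_map (measurable_broadcast hG.connected r b).aemeasurable
  constructor
  simp [treeMeasure]

lemma treeMeasure_real_apply (hG : G.IsTree) (r : V) {E : Set (Set V)} (hE : MeasurableSet E) :
    (treeMeasure G a q r).real E =
      a r * (coinMeasure q).real {U | broadcast G r true U ∈ E} +
      (1 - a r) * (coinMeasure q).real {U | broadcast G r false U ∈ E} := by
  have h1 : ∀ b, IsProbabilityMeasure ((coinMeasure q).map (broadcast G r b)) := fun b =>
    Measure.isProbabilityMeasure_map (measurable_broadcast hG.connected r b).aemeasurable
  rw [treeMeasure, measureReal_add_apply, measureReal_nnreal_smul_apply,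
    measureReal_nnreal_smul_apply, map_measureReal_apply (measurable_broadcast hG.connected r _) hE,
    map_measureReal_apply (measurable_broadcast hG.connected r _) hE]
  rfl

lemma treeMeasure_real_root (hG : G.IsTree) (r : V) :
    (treeMeasure G a q r).real {I | r ∈ I} = a r := by
  rw [treeMeasure_real_apply hG r (measurableSet_mem r)]
  simp

/-- Splitting by the states of the two ends of the edge gives three cases: only `o` occupied, only
`v` occupied, both vacant. By `hq` their weights are `a o`, `a v` and `1 - a o - a v`, and the
root-change lemmas show that exchanging the ends just permutes the cases. -/
lemma treeMeasure_eq_of_adj (hG : G.IsTree) (hq : ∀ v w, G.Adj v w → (q w : ℝ) * (1 - a v) = a w)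
    {o v : V} (h : G.Adj o v) : treeMeasure G a q o = treeMeasure G a q v := by
  classical
  have := isProbabilityMeasure_treeMeasure hG (a := a) (q := q)
  refine measure_ext_of_real fun E hE => ?_
  have key : ∀ o v, G.Adj o v → (treeMeasure G a q o).real E =
      a o * (coinMeasure q).real {U | broadcast G o true U ∈ E} +
      a v * (coinMeasure q).real {U | broadcast G v true U ∈ E} +
      (1 - a o - a v) * (coinMeasure q).real
        {U | broadcast G o false (Function.update U v false) ∈ E} := by
    intro o v h
    rw [treeMeasure_real_apply hG o hE, coinMeasure_real_split q v
      (E := {U | broadcast G o false U ∈ E}) ((measurable_broadcast hG.connected o false) hE)]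
    simp only [mem_ofPred_eq, broadcast_false_update_true hG h]
    rw [← hq o v h]
    ring
  rw [key o v h, key v o h.symm]
  simp only [broadcast_false_update_false hG h]
  ring

lemma treeMeasure_eq (hG : G.IsTree)
    (hq : ∀ v w, G.Adj v w → (q w : ℝ) * (1 - a v) = a w) (o v : V) :
    treeMeasure G a q v = treeMeasure G a q o := by
  refine hG.connected.induction_on_root o
    (motive := fun v => treeMeasure G a q v = treeMeasure G a q o) rfl (fun w hw ih => ?_) v
  rw [← ih, treeMeasure_eq_of_adj hG hq (hG.connected.parent_spec hw).1]

lemma treeMeasure_real_mem (hG : G.IsTree)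
    (hq : ∀ v w, G.Adj v w → (q w : ℝ) * (1 - a v) = a w) (o v : V) :
    (treeMeasure G a q o).real {I | v ∈ I} = a v := by
  rw [← treeMeasure_eq hG hq o v, treeMeasure_real_root hG]

lemma ae_isIndepSet_treeMeasure (hG : G.IsTree) [Countable V] (o : V) :
    ∀ᵐ I ∂(treeMeasure G a q o), G.IsIndepSet I := by
  have := isProbabilityMeasure_treeMeasure hG (a := a) (q := q) o
  rw [ae_iff]
  refine (measureReal_eq_zero_iff).1 ?_
  change (treeMeasure G a q o).real {I : Set V | G.IsIndepSet I}ᶜ = 0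
  rw [treeMeasure_real_apply hG o (measurableSet_isIndepSet G).compl]
  simp [isIndepSet_broadcast hG]

lemma cond_treeMeasure_mem (hG : G.IsTree) {r : V} (ha : 0 < a r) :
    cond (treeMeasure G a q r) {I | r ∈ I} = (coinMeasure q).map (broadcast G r true) := by
  have := isProbabilityMeasure_treeMeasure hG (a := a) (q := q) r
  have := Measure.isProbabilityMeasure_map (μ := coinMeasure q)
    (measurable_broadcast hG.connected r true).aemeasurable
  refine measure_ext_of_real fun E hE => ?_
  have h0 : (a r : ℝ) ≠ 0 := ne_of_gt ha
  rw [cond_real_apply _ (measurableSet_mem r), treeMeasure_real_root hG,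
    treeMeasure_real_apply hG r ((measurableSet_mem r).inter hE),
    map_measureReal_apply (measurable_broadcast hG.connected r _) hE]
  simp [h0]
  rfl

lemma cond_treeMeasure_notMem (hG : G.IsTree) {r : V} (ha : a r < 1) :
    cond (treeMeasure G a q r) {I | r ∉ I} = (coinMeasure q).map (broadcast G r false) := by
  have := isProbabilityMeasure_treeMeasure hG (a := a) (q := q) r
  have := Measure.isProbabilityMeasure_map (μ := coinMeasure q)
    (measurable_broadcast hG.connected r false).aemeasurable
  refine measure_ext_of_real fun E hE => ?_
  have h0 : 1 - (a r : ℝ) ≠ 0 := by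
    have : (a r : ℝ) < 1 := ha
    linarith
  have h1 : (treeMeasure G a q r).real {I | r ∉ I} = 1 - a r := by
    have h := probReal_compl_eq_one_sub (μ := treeMeasure G a q r) (measurableSet_mem r)
    rwa [treeMeasure_real_root hG] at h
  rw [cond_real_apply _ (measurableSet_notMem r), h1,
    treeMeasure_real_apply hG r ((measurableSet_notMem r).inter hE),
    map_measureReal_apply (measurable_broadcast hG.connected r _) hE]
  simp [h0]
  rfl

/-- With the root moved to `v`, conditioning on the state of `v` leaves a broadcast with a
deterministic root, and the restrictions to the branches are functions of disjoint families of
coins. -/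
lemma isSimpleMeasure_treeMeasure (hG : G.IsTree)
    (hq : ∀ v w, G.Adj v w → (q w : ℝ) * (1 - a v) = a w)
    (ha : ∀ v, 0 < a v) (ha' : ∀ v, a v < 1) (o : V) : IsSimpleMeasure G (treeMeasure G a q o) := by
  intro v
  rw [← treeMeasure_eq hG hq o v, cond_treeMeasure_mem hG (ha v),
    cond_treeMeasure_notMem hG (ha' v)]
  have key : ∀ b, iIndepFun (fun (u : G.neighborSet v) (I : Set V) => I ∩ branch G v u)
      ((coinMeasure q).map (broadcast G v b)) := by
    intro b
    refine iIndepFun_map (measurable_broadcast hG.connected v b)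
      (fun u => measurable_inter_const _) ?_
    refine iIndepFun_infinitePi_of_dependsOn _ (B := fun u : G.neighborSet v => branch G v u)
      (fun u => (measurable_inter_const _).comp (measurable_broadcast hG.connected v b)) ?_
      fun u => dependsOn_broadcast_inter_branch hG u.2
    intro u u' h
    exact hG.disjoint_branch u.2 u'.2 fun h' => h (Subtype.ext h')
  exact ⟨key true, key false⟩

/-- Removing an occupied vertex changes the weight by the factor `lam`. -/
lemma treeMeasure_real_inter_eq (hG : G.IsTree) [G.LocallyFinite] [Countable V]
    (hq : ∀ v w, G.Adj v w → (q w : ℝ) * (1 - a v) = a w) {lam : ℝ} {s : V}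
    (hlam : (a s : ℝ) = lam * (1 - a s) * ∏ u ∈ G.neighborFinset s, (1 - (q u : ℝ)))
    (o : V) {W S : Set V} (hsS : s ∉ S) (hsW : s ∈ W) (hW : ∀ u, G.Adj s u → u ∈ W)
    (hS : ∀ u, G.Adj s u → u ∉ S) :
    (treeMeasure G a q o).real {I | I ∩ W = insert s S} =
      lam * (treeMeasure G a q o).real {I | I ∩ W = S} := by
  rw [← treeMeasure_eq hG hq o s, treeMeasure_real_apply hG s (measurableSet_inter_eq _ _),
    treeMeasure_real_apply hG s (measurableSet_inter_eq _ _)]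
  have h1 : {U | broadcast G s false U ∈ {I : Set V | I ∩ W = insert s S}} = ∅ := by
    ext U
    simp only [mem_ofPred_eq, mem_empty_iff_false, iff_false]
    intro h
    have : s ∈ broadcast G s false U ∩ W := h ▸ mem_insert s S
    simpa using this.1
  have h2 : {U | broadcast G s true U ∈ {I : Set V | I ∩ W = S}} = ∅ := by
    ext U
    simp only [mem_ofPred_eq, mem_empty_iff_false, iff_false]
    intro h
    exact hsS (h ▸ ⟨by simp, hsW⟩)
  -- Since `W` contains the neighbours of `s` and `S` does not, the vacant root produces `S` exactly
  -- when all coins next to `s` show `false` and the occupied root produces `insert s S`. The second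
  -- event ignores the coins next to `s`, so the two are independent.
  have h3 : {U | broadcast G s false U ∈ {I : Set V | I ∩ W = S}} =
      {U | ∀ u ∈ G.neighborFinset s, U u = false} ∩
        {U | broadcast G s true U ∈ {I : Set V | I ∩ W = insert s S}} := by
    ext U
    simp only [mem_ofPred_eq, mem_inter_iff, SimpleGraph.mem_neighborFinset]
    have hne : s ∉ broadcast G s false U := by simp
    constructor
    · intro h
      have hU : ∀ u, G.Adj s u → U u = false := by
        intro u hu
        have : u ∉ broadcast G s false U := fun hmem => hS u hu (h ▸ ⟨hmem, hW u hu⟩)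
        rw [mem_broadcast_iff hG.connected hu.ne', hG.parent_of_adj hu] at this
        simpa using this
      refine ⟨hU, ?_⟩
      rw [broadcast_true_eq_insert hG hU, insert_inter_of_mem hsW, h]
    · rintro ⟨hU, h⟩
      rw [broadcast_true_eq_insert hG hU, insert_inter_of_mem hsW] at h
      have hne' : s ∉ broadcast G s false U ∩ W := fun h' => hne h'.1
      rw [← insert_sdiff_self_of_notMem hne', h, insert_sdiff_self_of_notMem hsS]
  have hm : MeasurableSet {U : V → Bool | ∀ u ∈ G.neighborFinset s, U u = false} := by
    have : {U : V → Bool | ∀ u ∈ G.neighborFinset s, U u = false} =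
        ⋂ u ∈ G.neighborFinset s, {U | U u = false} := by ext; simp
    rw [this]
    exact Finset.measurableSet_biInter _ fun u _ => measurableSet_coin u false
  rw [h1, h2, h3, coinMeasure_inter_of_dependsOn q hm
    (F := {U | broadcast G s true U ∈ {I : Set V | I ∩ W = insert s S}})
    ((measurable_broadcast hG.connected s true) (measurableSet_inter_eq _ _))
    (A := {w | G.Adj s w}) (B := {w | ¬ G.Adj s w}) ?_ ?_ ?_, coinMeasure_real_forall_eq_false,
    measureReal_empty]
  · linear_combination (coinMeasure q).real
      {U | broadcast G s true U ∈ {I : Set V | I ∩ W = insert s S}} * hlam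
  · rw [Set.disjoint_left]
    intro w h h'
    exact h' h
  · intro U U' h
    simp only [mem_ofPred_eq, SimpleGraph.mem_neighborFinset, eq_iff_iff]
    exact forall₂_congr fun u hu => by rw [h u hu]
  · intro U U' h
    simp only [mem_ofPred_eq, dependsOn_broadcast_true hG h]

/-- A vacant root together with `false` coins throughout `W` leaves `W` empty, and this has positive
probability. It allows division by the weight of the empty configuration. -/
lemma treeMeasure_real_inter_eq_empty_pos (hG : G.IsTree) [Countable V] (ha' : ∀ v, a v < 1)
    (hq' : ∀ v, q v < 1) (o : V) (W : Finset V) :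
    0 < (treeMeasure G a q o).real {I | I ∩ (W : Set V) = ∅} := by
  rw [treeMeasure_real_apply hG o (measurableSet_inter_eq _ _)]
  have h0 : 0 < 1 - (a o : ℝ) := sub_pos.2 (ha' o)
  have h1 : 0 < ∏ v ∈ W, (1 - (q v : ℝ)) := Finset.prod_pos fun v _ => sub_pos.2 (hq' v)
  have h2 : (coinMeasure q).real {U | ∀ v ∈ W, U v = false} ≤
      (coinMeasure q).real {U | broadcast G o false U ∈ {I | I ∩ (W : Set V) = ∅}} := by
    refine measureReal_mono fun U hU => ?_
    simp only [mem_ofPred_eq] at hU ⊢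
    ext w
    simp only [mem_inter_iff, Finset.mem_coe, mem_empty_iff_false, iff_false, not_and]
    intro hw hwW
    by_cases hwo : w = o
    · subst hwo; simp at hw
    · rw [mem_broadcast_iff hG.connected hwo, hU w hwW] at hw
      simp at hw
  rw [coinMeasure_real_forall_eq_false] at h2
  have h3 : 0 ≤ (a o : ℝ) * (coinMeasure q).real
      {U | broadcast G o true U ∈ {I | I ∩ (W : Set V) = ∅}} :=
    mul_nonneg (a o).2.1 measureReal_nonneg
  nlinarith [mul_pos h0 (h1.trans_le h2)]

/-- Relative to the empty configuration, each occupied vertex contributes a factor `lam` to the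
probability of a configuration with vacant outer boundary, and sets that are not independent have
probability zero. Summing shows that the normalisation is the partition function. -/
lemma isGibbs_treeMeasure (hG : G.IsTree) [G.LocallyFinite] [Countable V]
    (hq : ∀ v w, G.Adj v w → (q w : ℝ) * (1 - a v) = a w)
    (ha' : ∀ v, a v < 1) (hq' : ∀ v, q v < 1) {lam : ℝ}
    (hlam : ∀ v, (a v : ℝ) = lam * (1 - a v) * ∏ u ∈ G.neighborFinset v, (1 - (q u : ℝ))) (o : V) :
    IsGibbs G lam (treeMeasure G a q o) := by
  classical
  have hprob := isProbabilityMeasure_treeMeasure hG (a := a) (q := q) o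
  have hindep := ae_isIndepSet_treeMeasure hG (a := a) (q := q) o
  refine ⟨hprob, hindep, fun T _ S hST hS => ?_⟩
  set μ := treeMeasure G a q o
  -- `T` with all neighbours of its vertices, that is, `T` with its outer boundary: a vacant
  -- boundary and the trace `S` on `T` together mean the trace `S` on `W`.
  set W : Finset V := T ∪ T.biUnion fun v => G.neighborFinset v with hWdef
  have hTW : T ⊆ W := Finset.subset_union_left
  have hmemW : ∀ x, x ∈ W ↔ x ∈ T ∨ x ∈ outerBoundary G (T : Set V) := by
    intro x
    simp only [hWdef, Finset.mem_union, Finset.mem_biUnion, SimpleGraph.mem_neighborFinset,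
      outerBoundary, mem_ofPred_eq, Finset.mem_coe]
    tauto
  have hev : ∀ S : Finset V, S ⊆ T →
      {I | Disjoint I (outerBoundary G (T : Set V))} ∩ {I | I ∩ (T : Set V) = S} =
      {I : Set V | I ∩ (W : Set V) = S} := by
    intro S hS
    ext I
    simp only [mem_inter_iff, mem_ofPred_eq, Set.disjoint_left, Set.ext_iff, Finset.mem_coe, hmemW]
    constructor
    · rintro ⟨h1, h2⟩ x
      rw [← h2 x]
      have := @h1 x
      tauto
    · intro h
      have hb : ∀ x, x ∈ outerBoundary G (T : Set V) → x ∉ S := fun x hx hxS => hx.1 (hS hxS)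
      refine ⟨fun x hx hxb => hb x hxb ((h x).1 ⟨hx, Or.inr hxb⟩), fun x => ?_⟩
      rw [← h x]
      refine and_congr_right fun hxI => ⟨Or.inl, ?_⟩
      rintro (h' | h')
      · exact h'
      · exact absurd ((h x).1 ⟨hxI, Or.inr h'⟩) (hb x h')
  have hweight : ∀ S : Finset V, S ⊆ T → G.IsIndepSet (S : Set V) →
      μ.real {I | I ∩ (W : Set V) = S} = lam ^ S.card * μ.real {I | I ∩ (W : Set V) = ∅} := by
    intro S
    induction S using Finset.induction_on with
    | empty => intro _ _; simp
    | insert s S hs ih =>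
      intro hST hS
      have hsT : s ∈ T := hST (Finset.mem_insert_self _ _)
      rw [Finset.coe_insert] at hS ⊢
      rw [treeMeasure_real_inter_eq hG hq (hlam s) o (by simpa using hs) (hTW hsT) ?_ ?_,
        ih ((Finset.subset_insert _ _).trans hST) (hS.mono (subset_insert _ _)),
        Finset.card_insert_of_notMem hs]
      · ring
      · intro u hu
        exact Finset.mem_union_right _ (Finset.mem_biUnion.2 ⟨s, hsT, by simpa using hu⟩)
      · intro u hu huS
        exact hS (mem_insert _ _) (mem_insert_of_mem _ huS) hu.ne hu
  have hnull : ∀ S : Finset V, S ⊆ T → ¬ G.IsIndepSet (S : Set V) →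
      μ.real {I | I ∩ (W : Set V) = S} = 0 := by
    intro S _ hS
    refine (measureReal_eq_zero_iff).2 (measure_mono_null ?_ (ae_iff.1 hindep))
    intro I hI hI'
    refine hS (hI'.mono ?_)
    have hI : I ∩ (W : Set V) = S := hI
    rw [← hI]
    exact inter_subset_left
  have hD : MeasurableSet {I : Set V | Disjoint I (outerBoundary G (T : Set V))} := by
    simp only [Set.disjoint_iff_inter_eq_empty]
    exact measurableSet_inter_eq _ _
  have htotal : μ.real {I | Disjoint I (outerBoundary G (T : Set V))} =
      partitionFunction G lam T * μ.real {I | I ∩ (W : Set V) = ∅} := by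
    have hunion : {I | Disjoint I (outerBoundary G (T : Set V))} =
        ⋃ S ∈ T.powerset, {I : Set V | I ∩ (W : Set V) = (S : Finset V)} := by
      ext I
      simp only [mem_iUnion, Finset.mem_powerset, exists_prop]
      constructor
      · intro hI
        refine ⟨T.filter (· ∈ I), Finset.filter_subset _ _, ?_⟩
        rw [← hev _ (Finset.filter_subset _ _)]
        refine ⟨hI, ?_⟩
        ext x
        simp [and_comm]
      · rintro ⟨S, hS, hI⟩
        rw [← hev S hS] at hI
        exact hI.1
    rw [hunion, measureReal_biUnion_finset ?_ fun S _ => measurableSet_inter_eq _ _,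
      partitionFunction, Finset.sum_filter, Finset.sum_mul]
    · refine Finset.sum_congr rfl fun S hS => ?_
      rw [Finset.mem_powerset] at hS
      split_ifs with h
      · exact hweight S hS h
      · rw [hnull S hS h, zero_mul]
    · intro S _ S' _ hne
      refine Set.disjoint_left.2 fun I hI hI' => hne ?_
      exact Finset.coe_injective (hI.symm.trans hI')
  rw [cond_real_apply _ hD, hev S hST, hweight S hST hS, htotal]
  have hc : μ.real {I | I ∩ (W : Set V) = ∅} ≠ 0 :=
    (treeMeasure_real_inter_eq_empty_pos hG ha' hq' o W).ne'
  rw [← div_eq_inv_mul, mul_div_mul_right _ _ hc]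

end TreeMeasure

/-! ### A simple measure on independent sets is determined by its densities -/

section Uniqueness

variable {V : Type*} {G : SimpleGraph V}

lemma measureReal_notMem (μ : Measure (Set V)) [IsProbabilityMeasure μ] (v : V) :
    μ.real {I | v ∉ I} = 1 - μ.real {I | v ∈ I} :=
  probReal_compl_eq_one_sub (measurableSet_mem v)

lemma measureReal_adj_mem {μ : Measure (Set V)} (hi : ∀ᵐ I ∂μ, G.IsIndepSet I) {v w : V}
    (h : G.Adj v w) {E : Set (Set V)} (hE : ∀ I ∈ E, v ∈ I ∧ w ∈ I) : μ.real E = 0 := by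
  have : μ E = 0 := by
    refine measure_mono_null (fun I hI => ?_) (ae_iff.1 hi)
    intro hI'
    exact hI' (hE I hI).1 (hE I hI).2 h.ne h
  simp [measureReal_def, this]

lemma measureReal_notMem_inter_mem {μ : Measure (Set V)} [IsProbabilityMeasure μ]
    (hi : ∀ᵐ I ∂μ, G.IsIndepSet I) {v w : V} (h : G.Adj v w) :
    μ.real ({I | v ∉ I} ∩ {I | w ∈ I}) = μ.real {I | w ∈ I} := by
  have h1 := measureReal_inter_add_sdiff (μ := μ) (s := {I : Set V | w ∈ I}) (measurableSet_mem v)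
  have h2 : μ.real ({I | w ∈ I} ∩ {I | v ∈ I}) = 0 :=
    measureReal_adj_mem hi h fun I hI => ⟨hI.2, hI.1⟩
  have h3 : {I : Set V | v ∉ I} ∩ {I | w ∈ I} = {I | w ∈ I} \ {I | v ∈ I} := by
    ext I; simp [and_comm]
  rw [h3]
  linarith

/-- The effect of adding a leaf `w` to a set of observed vertices. -/
lemma IsSimpleMeasure.real_inter_leaf [G.LocallyFinite] [Countable V] (hG : G.IsTree)
    {μ : Measure (Set V)} [IsProbabilityMeasure μ] (hi : ∀ᵐ I ∂μ, G.IsIndepSet I)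
    (hs : IsSimpleMeasure G μ) {v w : V} (h : G.Adj v w) (hv : μ.real {I | v ∈ I} < 1)
    {W S : Set V} (hvW : v ∈ W) (hW : Disjoint W (branch G v w)) (hvS : v ∉ S) :
    μ.real ({I | I ∩ W = S} ∩ {I | w ∈ I}) * (1 - μ.real {I | v ∈ I}) =
      μ.real {I | I ∩ W = S} * μ.real {I | w ∈ I} := by
  classical
  -- When `v` is vacant this is the same as having trace `S` on `W`, and it can be read off from the
  -- branches at `v` other than that of `w`. Simplicity therefore makes it conditionally independent
  -- of the state of `w`.
  set E' : Set (Set V) := {I | I ∩ (W \ {v}) = S}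
  have hind := (hs v).2.indepFun_finset {⟨w, h⟩} (Finset.univ \ {⟨w, h⟩})
    Finset.disjoint_sdiff (fun u => measurable_inter_const _)
  have hA : MeasurableSet {g : ({⟨w, h⟩} : Finset (G.neighborSet v)) → Set V |
      w ∈ g ⟨⟨w, h⟩, by simp⟩} :=
    measurableSet_setOfPred.2 ((measurable_set_mem w).comp (measurable_pi_apply _))
  have hB : MeasurableSet {g : (Finset.univ \ {⟨w, h⟩} : Finset (G.neighborSet v)) → Set V |
      (⋃ i, g i) ∩ (W \ {v}) = S} := by
    have : Measurable fun g : (Finset.univ \ {⟨w, h⟩} : Finset (G.neighborSet v)) → Set V =>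
        (⋃ i, g i) := by
      rw [measurable_set_iff]
      intro x
      simp only [mem_iUnion]
      exact Measurable.exists fun i => (measurable_set_mem x).comp (measurable_pi_apply i)
    exact this (measurableSet_inter_eq _ _)
  have hAB := hind.measure_inter_preimage_eq_mul _ _ hA hB
  have eA : (fun (I : Set V) (i : ({⟨w, h⟩} : Finset (G.neighborSet v))) => I ∩ branch G v i) ⁻¹'
      {g | w ∈ g ⟨⟨w, h⟩, by simp⟩} = {I | w ∈ I} := by
    ext I
    simp [SimpleGraph.self_mem_branch h]
  have eB : (fun (I : Set V) (i : (Finset.univ \ {⟨w, h⟩} : Finset (G.neighborSet v))) =>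
      I ∩ branch G v i) ⁻¹' {g | (⋃ i, g i) ∩ (W \ {v}) = S} = E' := by
    ext I
    simp only [mem_preimage, mem_ofPred_eq, E']
    suffices (⋃ i : (Finset.univ \ {⟨w, h⟩} : Finset (G.neighborSet v)), I ∩ branch G v i) ∩
        (W \ {v}) = I ∩ (W \ {v}) by rw [this]
    ext x
    simp only [mem_inter_iff, mem_iUnion]
    refine and_congr_left fun hx => ⟨fun ⟨i, hi⟩ => hi.1, fun hxI => ?_⟩
    have hxv : v ≠ x := fun e => hx.2 e.symm
    have hadj := (hG.connected.parent_spec hxv).1.symm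
    have hxb : x ∈ branch G v (G.parent x v) := (hG.mem_branch_iff hadj).2 ⟨hxv.symm, rfl⟩
    refine ⟨⟨⟨G.parent x v, hadj⟩, ?_⟩, hxI, hxb⟩
    simp only [Finset.mem_sdiff, Finset.mem_univ, Finset.mem_singleton, true_and]
    intro he
    have he : G.parent x v = w := congrArg Subtype.val he
    rw [he] at hxb
    exact Set.disjoint_left.1 hW hx.1 hxb
  rw [eA, eB] at hAB
  have hAB' := congrArg ENNReal.toReal hAB
  simp only [ENNReal.toReal_mul, ← measureReal_def] at hAB'
  rw [cond_real_apply _ (measurableSet_notMem v), cond_real_apply _ (measurableSet_notMem v),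
    cond_real_apply _ (measurableSet_notMem v), measureReal_notMem_inter_mem hi h,
    measureReal_notMem] at hAB'
  have e1 : {I | v ∉ I} ∩ E' = {I : Set V | I ∩ W = S} := by
    ext I
    simp only [mem_inter_iff, mem_ofPred_eq, E']
    constructor
    · rintro ⟨hvI, h1⟩
      rw [← h1]
      ext x
      simp only [mem_inter_iff, Set.mem_sdiff, mem_singleton_iff]
      refine and_congr_right fun hx => ⟨fun hxW => ⟨hxW, ?_⟩, fun h => h.1⟩
      rintro rfl
      exact hvI hx
    · intro h1
      have hvI : v ∉ I := fun hvI => hvS (h1 ▸ ⟨hvI, hvW⟩)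
      refine ⟨hvI, ?_⟩
      rw [← h1]
      ext x
      simp only [mem_inter_iff, Set.mem_sdiff, mem_singleton_iff]
      refine and_congr_right fun hx => ⟨fun h => h.1, fun hxW => ⟨hxW, ?_⟩⟩
      rintro rfl
      exact hvI hx
  have e2 : {I | v ∉ I} ∩ ({I | w ∈ I} ∩ E') = {I : Set V | I ∩ W = S} ∩ {I | w ∈ I} := by
    rw [← e1]
    ext I
    simp only [mem_inter_iff]
    tauto
  rw [e1, e2] at hAB'
  have h0 : 1 - μ.real {I | v ∈ I} ≠ 0 := by linarith
  field_simp at hAB'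
  linarith

lemma SimpleGraph.Connected.exists_parent_closed (hG : G.Connected) (o v : V) :
    ∃ W : Finset V, v ∈ W ∧ ∀ x ∈ W, x ≠ o → G.parent o x ∈ W := by
  classical
  refine hG.induction_on_root o (motive := fun v =>
    ∃ W : Finset V, v ∈ W ∧ ∀ x ∈ W, x ≠ o → G.parent o x ∈ W) ?_ (fun w hw ih => ?_) v
  · exact ⟨{o}, by simp, by simp⟩
  · obtain ⟨W, hpW, hW⟩ := ih
    refine ⟨insert w W, Finset.mem_insert_self _ _, fun x hx hxo => ?_⟩
    rcases Finset.mem_insert.1 hx with rfl | hx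
    · exact Finset.mem_insert_of_mem hpW
    · exact Finset.mem_insert_of_mem (hW x hx hxo)

/-- A parent-closed finite set grows by adding vertices in order of distance, each a new leaf `w`
below some `v` already present. If `v` is occupied, `w` is almost surely vacant; if `v` is vacant,
`IsSimpleMeasure.real_inter_leaf` gives the probability in terms of densities alone. -/
lemma IsSimpleMeasure.real_inter_eq [G.LocallyFinite] [Countable V] (hG : G.IsTree)
    {μ ν : Measure (Set V)} [IsProbabilityMeasure μ] [IsProbabilityMeasure ν]
    (hμi : ∀ᵐ I ∂μ, G.IsIndepSet I) (hνi : ∀ᵐ I ∂ν, G.IsIndepSet I)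
    (hμs : IsSimpleMeasure G μ) (hνs : IsSimpleMeasure G ν)
    (heq : ∀ v, μ.real {I | v ∈ I} = ν.real {I | v ∈ I})
    (hlt : ∀ v, μ.real {I | v ∈ I} < 1) (o : V) (W : Finset V) :
    (∀ x ∈ W, x ≠ o → G.parent o x ∈ W) → ∀ S : Set V,
      μ.real {I | I ∩ (W : Set V) = S} = ν.real {I | I ∩ (W : Set V) = S} := by
  classical
  induction W using Finset.induction_on_max_value (fun x => G.dist o x) with
  | empty =>
    intro _ S
    rcases eq_or_ne ∅ S with rfl | hS <;> simp [*]
  | insert w W hw hmax ih =>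
    intro hcl
    have hclW : ∀ x ∈ W, x ≠ o → G.parent o x ∈ W := by
      intro x hx hxo
      rcases Finset.mem_insert.1 (hcl x (Finset.mem_insert_of_mem hx) hxo) with h1 | h1
      · have := (hG.connected.parent_spec hxo).2
        rw [h1] at this
        have := hmax x hx
        omega
      · exact h1
    have ih := ih hclW
    have key : ∀ S : Set V, μ.real ({I | I ∩ (W : Set V) = S} ∩ {I | w ∈ I}) =
        ν.real ({I | I ∩ (W : Set V) = S} ∩ {I | w ∈ I}) := by
      intro S
      by_cases hwo : w = o
      -- The root has distance `0`, so it can be the farthest vertex only as the first one added.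
      · have hWe : W = ∅ := by
          refine Finset.eq_empty_of_forall_notMem fun x hx => ?_
          have h1 := hmax x hx
          rw [hwo, SimpleGraph.dist_self, Nat.le_zero, hG.connected.dist_eq_zero_iff] at h1
          exact hw (by rw [hwo, h1]; exact hx)
        subst hWe
        rcases eq_or_ne ∅ S with rfl | hS <;> simp [*]
      · obtain ⟨hadj, hd⟩ := hG.connected.parent_spec hwo
        set v := G.parent o w
        have hvW : v ∈ W := by
          rcases Finset.mem_insert.1 (hcl w (Finset.mem_insert_self _ _) hwo) with h1 | h1
          · exact absurd h1 hadj.ne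
          · exact h1
        by_cases hvS : v ∈ S
        · have : ∀ I ∈ {I : Set V | I ∩ (W : Set V) = S} ∩ {I | w ∈ I}, v ∈ I ∧ w ∈ I := by
            rintro I ⟨h1, h2⟩
            refine ⟨?_, h2⟩
            have h1 : I ∩ (W : Set V) = S := h1
            rw [← h1] at hvS
            exact hvS.1
          rw [measureReal_adj_mem hμi hadj this, measureReal_adj_mem hνi hadj this]
        · have hdis : Disjoint (W : Set V) (branch G v w) := by
            have ho : o ∉ branch G v w := by
              intro ho
              have ho : G.dist v o = G.dist w o + 1 := ho
              rw [SimpleGraph.dist_comm, SimpleGraph.dist_comm (u := w)] at ho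
              omega
            rw [Set.disjoint_left]
            refine hG.connected.induction_on_root o (fun _ => ho) fun x hxo ih hxW hxb => ?_
            refine ih (hclW x hxW hxo) (hG.parent_mem_branch hadj ho hxb ?_)
            rintro rfl
            exact hw hxW
          have h1 := hμs.real_inter_leaf hG hμi hadj (hlt v) (W := W) hvW hdis hvS
          have h2 := hνs.real_inter_leaf hG hνi hadj (heq v ▸ hlt v) (W := W) hvW hdis hvS
          rw [ih S, heq, heq, ← h2] at h1
          have h0 : 1 - ν.real {I | v ∈ I} ≠ 0 := by
            have := hlt v
            rw [heq v] at this
            linarith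
          exact mul_right_cancel₀ h0 h1
    intro S
    by_cases hwS : w ∈ S
    · have : {I : Set V | I ∩ ((insert w W : Finset V) : Set V) = S} =
          {I | I ∩ (W : Set V) = S \ {w}} ∩ {I | w ∈ I} := by
        ext I
        simp only [Finset.coe_insert, mem_ofPred_eq, mem_inter_iff]
        have hw' : w ∉ I ∩ (W : Set V) := fun h => hw h.2
        constructor
        · intro h
          have hwI : w ∈ I := by
            rw [← h] at hwS
            exact hwS.1
          rw [inter_insert_of_mem hwI] at h
          refine ⟨?_, hwI⟩
          rw [← h, insert_sdiff_self_of_notMem hw']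
        · rintro ⟨h, hwI⟩
          rw [inter_insert_of_mem hwI, h, insert_sdiff_singleton, insert_eq_of_mem hwS]
      rw [this, key]
    · have : {I : Set V | I ∩ ((insert w W : Finset V) : Set V) = S} =
          {I | I ∩ (W : Set V) = S} \ {I | w ∈ I} := by
        ext I
        simp only [Finset.coe_insert, mem_ofPred_eq, Set.mem_sdiff]
        constructor
        · intro h
          have hwI : w ∉ I := fun hwI => hwS (h ▸ ⟨hwI, mem_insert _ _⟩)
          rw [inter_insert_of_notMem hwI] at h
          exact ⟨h, hwI⟩
        · rintro ⟨h, hwI⟩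
          rw [inter_insert_of_notMem hwI, h]
      rw [this]
      have h1 := measureReal_inter_add_sdiff (μ := μ) (s := {I : Set V | I ∩ (W : Set V) = S})
        (measurableSet_mem w)
      have h2 := measureReal_inter_add_sdiff (μ := ν) (s := {I : Set V | I ∩ (W : Set V) = S})
        (measurableSet_mem w)
      have := key S
      have := ih S
      linarith

/-- Events observed on finite parent-closed sets form a π-system, as unions of such sets are again
parent-closed, and they generate the σ-algebra because every vertex lies in one. Agreement on single
traces extends to it. -/
theorem IsSimpleMeasure.ext [G.LocallyFinite] (hG : G.IsTree)
    {μ ν : Measure (Set V)} [IsProbabilityMeasure μ] [IsProbabilityMeasure ν]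
    (hμi : ∀ᵐ I ∂μ, G.IsIndepSet I) (hνi : ∀ᵐ I ∂ν, G.IsIndepSet I)
    (hμs : IsSimpleMeasure G μ) (hνs : IsSimpleMeasure G ν)
    (heq : ∀ v, μ.real {I | v ∈ I} = ν.real {I | v ∈ I})
    (hlt : ∀ v, μ.real {I | v ∈ I} < 1) : μ = ν := by
  classical
  have := hG.connected.countable_of_locallyFinite
  obtain ⟨o⟩ := hG.connected.nonempty
  let C : Set (Set (Set V)) := {E | ∃ W : Finset V, (∀ x ∈ W, x ≠ o → G.parent o x ∈ W) ∧
    ∃ 𝒮 : Set (Set V), E = {I | I ∩ (W : Set V) ∈ 𝒮}}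
  have hdecomp : ∀ (W : Finset V) (𝒮 : Set (Set V)), {I : Set V | I ∩ (W : Set V) ∈ 𝒮} =
      ⋃ S ∈ W.powerset.filter (fun S : Finset V => (S : Set V) ∈ 𝒮),
        {I : Set V | I ∩ (W : Set V) = (S : Finset V)} := by
    intro W 𝒮
    ext I
    simp only [mem_ofPred_eq, mem_iUnion, Finset.mem_filter, Finset.mem_powerset, exists_prop]
    constructor
    · intro h
      have e : I ∩ (W : Set V) = (W.filter (· ∈ I) : Finset V) := by
        ext x; simp [and_comm]
      exact ⟨W.filter (· ∈ I), ⟨Finset.filter_subset _ _, e ▸ h⟩, e⟩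
    · rintro ⟨S, ⟨_, hS⟩, h⟩
      rwa [h]
  have hdisj : ∀ (W : Finset V) (𝒮 : Set (Set V)), Set.PairwiseDisjoint
      ((W.powerset.filter (fun S : Finset V => (S : Set V) ∈ 𝒮) : Finset (Finset V)) :
        Set (Finset V)) fun S : Finset V => {I : Set V | I ∩ (W : Set V) = S} := by
    intro W 𝒮 S _ S' _ hne
    exact Set.disjoint_left.2 fun I hI hI' => hne (Finset.coe_injective (hI.symm.trans hI'))
  have hmeas : ∀ E ∈ C, MeasurableSet E := by
    rintro E ⟨W, -, 𝒮, rfl⟩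
    rw [hdecomp]
    exact Finset.measurableSet_biUnion _ fun S _ => measurableSet_inter_eq _ _
  have hgen : (inferInstance : MeasurableSpace (Set V)) = MeasurableSpace.generateFrom C := by
    refine le_antisymm ?_ (MeasurableSpace.generateFrom_le hmeas)
    have : @Measurable _ _ (MeasurableSpace.generateFrom C) _ (fun I : Set V => I) := by
      refine (@measurable_set_iff _ _ (MeasurableSpace.generateFrom C) _).2 fun v => ?_
      refine (@measurableSet_setOfPred _ (MeasurableSpace.generateFrom C) _).1 ?_
      refine MeasurableSpace.measurableSet_generateFrom ?_
      obtain ⟨W, hvW, hW⟩ := hG.connected.exists_parent_closed o v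
      refine ⟨W, hW, {S | v ∈ S}, ?_⟩
      ext I
      simp [hvW]
    intro E hE
    exact this hE
  have hpi : IsPiSystem C := by
    rintro _ ⟨W, hW, 𝒮, rfl⟩ _ ⟨W', hW', 𝒮', rfl⟩ -
    refine ⟨W ∪ W', ?_, {S | S ∩ (W : Set V) ∈ 𝒮 ∧ S ∩ (W' : Set V) ∈ 𝒮'}, ?_⟩
    · intro x hx hxo
      rcases Finset.mem_union.1 hx with h | h
      · exact Finset.mem_union_left _ (hW x h hxo)
      · exact Finset.mem_union_right _ (hW' x h hxo)
    · ext I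
      have h1 : I ∩ ((W ∪ W' : Finset V) : Set V) ∩ (W : Set V) = I ∩ (W : Set V) := by
        ext x; simp; tauto
      have h2 : I ∩ ((W ∪ W' : Finset V) : Set V) ∩ (W' : Set V) = I ∩ (W' : Set V) := by
        ext x; simp; tauto
      simp only [mem_inter_iff, mem_ofPred_eq, h1, h2]
  refine ext_of_generate_finite C hgen hpi ?_ (by simp)
  rintro E ⟨W, hW, 𝒮, rfl⟩
  rw [← measureReal_eq_measureReal_iff, hdecomp,
    measureReal_biUnion_finset (hdisj W 𝒮) fun S _ => measurableSet_inter_eq _ _,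
    measureReal_biUnion_finset (hdisj W 𝒮) fun S _ => measurableSet_inter_eq _ _]
  exact Finset.sum_congr rfl fun S _ =>
    IsSimpleMeasure.real_inter_eq hG hμi hνi hμs hνs heq hlt o W hW S

end Uniqueness

/-! ### Invariance under automorphisms -/

section Invariance

variable {V : Type*} {G : SimpleGraph V}

lemma SimpleGraph.Connected.dist_iso_apply (hG : G.Connected) (φ : G ≃g G) (u v : V) :
    G.dist (φ u) (φ v) = G.dist u v := by
  have key : ∀ (ψ : G ≃g G) (u v : V), G.dist (ψ u) (ψ v) ≤ G.dist u v := by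
    intro ψ u v
    obtain ⟨p, hp⟩ := hG.exists_walk_length_eq_dist u v
    rw [← hp, ← p.length_map ψ.toHom]
    exact SimpleGraph.dist_le (p.map ψ.toHom)
  refine le_antisymm (key φ u v) ?_
  simpa using key φ.symm (φ u) (φ v)

lemma mem_image_iso (φ : G ≃g G) (I : Set V) (v : V) : v ∈ φ '' I ↔ φ.symm v ∈ I := by
  constructor
  · rintro ⟨x, hx, rfl⟩; simpa using hx
  · intro h; exact ⟨_, h, by simp⟩

lemma measurable_image_iso (φ : G ≃g G) : Measurable fun I : Set V => φ '' I := by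
  rw [measurable_set_iff]
  intro v
  simp only [mem_image_iso]
  exact measurable_set_mem _

lemma map_image_iso_real (φ : G ≃g G) (μ : Measure (Set V)) (v : V) :
    (μ.map fun I => φ '' I).real {I | v ∈ I} = μ.real {I | φ.symm v ∈ I} := by
  rw [map_measureReal_apply (measurable_image_iso φ) (measurableSet_mem v)]
  congr 1
  ext I
  exact mem_image_iso φ I v

lemma cond_map {Ω Ω' : Type*} [MeasurableSpace Ω] [MeasurableSpace Ω'] (μ : Measure Ω)
    {g : Ω → Ω'} (hg : Measurable g) {E : Set Ω'} (hE : MeasurableSet E) :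
    cond (μ.map g) E = (cond μ (g ⁻¹' E)).map g := by
  ext A hA
  rw [cond_apply hE, Measure.map_apply hg hE, Measure.map_apply hg (hE.inter hA),
    Measure.map_apply hg hA, cond_apply (hg hE), preimage_inter]

lemma IsSimpleMeasure.map_iso (hG : G.Connected) {μ : Measure (Set V)} (hs : IsSimpleMeasure G μ)
    (φ : G ≃g G) : IsSimpleMeasure G (μ.map fun I => φ '' I) := by
  intro v
  have hg := measurable_image_iso φ
  have himage : ∀ (u : V) (I : Set V), φ '' I ∩ branch G v u =
      φ '' (I ∩ branch G (φ.symm v) (φ.symm u)) := by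
    intro u I
    ext x
    rw [mem_inter_iff, mem_image_iso, mem_image_iso]
    refine and_congr_right fun _ => ?_
    simp only [branch, mem_ofPred_eq, hG.dist_iso_apply φ.symm]
  have key : ∀ ρ : Measure (Set V), iIndepFun
      (fun (u : G.neighborSet (φ.symm v)) (I : Set V) => I ∩ branch G (φ.symm v) u) ρ →
      iIndepFun (fun (u : G.neighborSet v) (I : Set V) => I ∩ branch G v u)
        (ρ.map fun I => φ '' I) := by
    intro ρ h
    refine iIndepFun_map hg (fun u => measurable_inter_const _) ?_
    have hinj : Function.Injective (fun u : G.neighborSet v =>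
        (⟨φ.symm u, φ.symm.map_adj_iff.2 u.2⟩ : G.neighborSet (φ.symm v))) := by
      intro u u' h
      exact Subtype.ext (φ.symm.injective (congrArg Subtype.val h))
    have h1 := (h.precomp hinj).comp (fun _ J => φ '' J) fun _ => hg
    convert h1 using 2 with u
    ext1 I
    exact himage u I
  rw [cond_map _ hg (measurableSet_mem v), cond_map _ hg (measurableSet_notMem v)]
  have e1 : (fun I : Set V => φ '' I) ⁻¹' {I | v ∈ I} = {I | φ.symm v ∈ I} := by
    ext I; exact mem_image_iso φ I v
  have e2 : (fun I : Set V => φ '' I) ⁻¹' {I | v ∉ I} = {I | φ.symm v ∉ I} := by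
    ext I; exact not_congr (mem_image_iso φ I v)
  rw [e1, e2]
  exact ⟨key _ (hs (φ.symm v)).1, key _ (hs (φ.symm v)).2⟩

lemma ae_isIndepSet_map_iso {μ : Measure (Set V)} [IsProbabilityMeasure μ] [Countable V]
    (hi : ∀ᵐ I ∂μ, G.IsIndepSet I) (φ : G ≃g G) :
    ∀ᵐ I ∂(μ.map fun I => φ '' I), G.IsIndepSet I := by
  rw [ae_map_iff (measurable_image_iso φ).aemeasurable (measurableSet_isIndepSet G)]
  filter_upwards [hi] with I hI
  rintro _ ⟨x, hx, rfl⟩ _ ⟨y, hy, rfl⟩ hne hadj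
  exact hI hx hy (fun h => hne (by rw [h])) (φ.map_adj_iff.1 hadj)

/-- A simple measure is invariant under every automorphism that preserves its densities. -/
lemma IsSimpleMeasure.map_iso_eq [G.LocallyFinite] (hG : G.IsTree) {μ : Measure (Set V)}
    [IsProbabilityMeasure μ] (hi : ∀ᵐ I ∂μ, G.IsIndepSet I) (hs : IsSimpleMeasure G μ)
    (hlt : ∀ v, μ.real {I | v ∈ I} < 1) (φ : G ≃g G)
    (hφ : ∀ v, μ.real {I | φ v ∈ I} = μ.real {I | v ∈ I}) : μ.map (fun I => φ '' I) = μ := by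
  have := hG.connected.countable_of_locallyFinite
  have := Measure.isProbabilityMeasure_map (μ := μ) (measurable_image_iso φ).aemeasurable
  have heq : ∀ v, (μ.map fun I => φ '' I).real {I | v ∈ I} = μ.real {I | v ∈ I} := by
    intro v
    rw [map_image_iso_real, ← hφ (φ.symm v)]
    simp
  exact IsSimpleMeasure.ext hG (ae_isIndepSet_map_iso hi φ) hi (hs.map_iso hG.connected φ) hs heq
    fun v => heq v ▸ hlt v

lemma measureReal_mem_iso {μ : Measure (Set V)} (φ : G ≃g G) (h : μ.map (fun I => φ '' I) = μ)
    (v : V) : μ.real {I | φ v ∈ I} = μ.real {I | v ∈ I} := by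
  conv_lhs => rw [← h]
  rw [map_image_iso_real]
  simp

lemma IsTranslationInvariant.measureReal_eq [G.LocallyFinite] (hG : G.IsTree) {d : ℕ}
    (hreg : G.IsRegularOfDegree d) {μ : Measure (Set V)} (h : IsTranslationInvariant G μ)
    (v w : V) : μ.real {I | v ∈ I} = μ.real {I | w ∈ I} := by
  obtain ⟨φ, rfl⟩ := hG.exists_iso_apply_eq hreg w v
  exact measureReal_mem_iso φ (h φ) w

lemma IsSemiTranslationInvariant.measureReal_eq [G.LocallyFinite] (hG : G.IsTree) {d : ℕ}
    (hreg : G.IsRegularOfDegree d) {o : V} {μ : Measure (Set V)}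
    (h : IsSemiTranslationInvariant G o μ) {v w : V}
    (hvw : IsEvenVertex G o v ↔ IsEvenVertex G o w) :
    μ.real {I | v ∈ I} = μ.real {I | w ∈ I} := by
  obtain ⟨φ, rfl⟩ := hG.exists_iso_apply_eq hreg w v
  exact measureReal_mem_iso φ (h φ (isEvenVertex_apply_iff hG o φ hvw)) w

end Invariance

/-! ### The equations for the densities of a simple Gibbs measure -/

section GibbsEquations

variable {V : Type*} {G : SimpleGraph V}

lemma partitionFunction_singleton (G : SimpleGraph V) (lam : ℝ) (v : V) :
    partitionFunction G lam {v} = 1 + lam := by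
  classical
  rw [partitionFunction, Finset.filter_true_of_mem,
    show ({v} : Finset V).powerset = {∅, {v}} by ext; simp [Finset.subset_singleton_iff]]
  · rw [Finset.sum_insert (by simp)]
    simp
  · intro S hS
    rw [Finset.mem_powerset, Finset.subset_singleton_iff] at hS
    rcases hS with rfl | rfl <;> simp [SimpleGraph.IsIndepSet]

/-- The state of each neighbour is visible in its own branch, so given a vacant `v` these states are
independent. An occupied neighbour forces `v` to be vacant, so its conditional density is a plain
quotient of densities. -/
lemma IsSimpleMeasure.real_notMem_inter_neighbors [G.LocallyFinite]
    {μ : Measure (Set V)} [IsProbabilityMeasure μ] (hi : ∀ᵐ I ∂μ, G.IsIndepSet I)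
    (hs : IsSimpleMeasure G μ) {v : V} (hv : μ.real {I | v ∈ I} < 1) :
    μ.real ({I | v ∉ I} ∩ {I | ∀ u, G.Adj v u → u ∉ I}) = (1 - μ.real {I | v ∈ I}) *
      ∏ u ∈ G.neighborFinset v, (1 - μ.real {I | u ∈ I} / (1 - μ.real {I | v ∈ I})) := by
  have h0 : 1 - μ.real {I | v ∈ I} ≠ 0 := by linarith
  have h1 := (hs v).2.meas_iInter (s := fun u : G.neighborSet v => {I : Set V | (u : V) ∉ I}) (by
    intro u
    refine ⟨{J | (u : V) ∉ J}, measurableSet_notMem _, ?_⟩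
    ext I
    simp [SimpleGraph.self_mem_branch u.2])
  have e : (⋂ u : G.neighborSet v, {I : Set V | (u : V) ∉ I}) =
      {I : Set V | ∀ u, G.Adj v u → u ∉ I} := by
    ext I; simp
  rw [e] at h1
  have h2 := congrArg ENNReal.toReal h1
  simp only [ENNReal.toReal_prod, ← measureReal_def] at h2
  have h3 : ∀ u : G.neighborSet v, (cond μ {I | v ∉ I}).real {I | (u : V) ∉ I} =
      1 - μ.real {I | (u : V) ∈ I} / (1 - μ.real {I | v ∈ I}) := by
    intro u
    have := (hs v).2.isProbabilityMeasure
    rw [measureReal_notMem, cond_real_apply _ (measurableSet_notMem v),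
      measureReal_notMem_inter_mem hi u.2, measureReal_notMem]
    ring
  rw [Finset.prod_congr rfl fun u _ => h3 u, cond_real_apply _ (measurableSet_notMem v),
    measureReal_notMem, inv_mul_eq_iff_eq_mul₀ h0] at h2
  rw [h2]
  congr 1
  exact (Finset.prod_subtype (G.neighborFinset v) (by simp)
    (fun u => 1 - μ.real {I | u ∈ I} / (1 - μ.real {I | v ∈ I}))).symm

/-- The density of a simple Gibbs measure at a vertex in terms of the densities at its
neighbours. -/
theorem IsGibbs.density_eq [G.LocallyFinite] [Countable V] {lam : ℝ} (hlam : 0 < lam)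
    {μ : Measure (Set V)} (hμ : IsGibbs G lam μ) (hs : IsSimpleMeasure G μ) (v : V) :
    0 < μ.real {I | v ∈ I} ∧ μ.real {I | v ∈ I} < 1 ∧
    (∀ u, G.Adj v u → μ.real {I | u ∈ I} + μ.real {I | v ∈ I} < 1) ∧
    μ.real {I | v ∈ I} = lam * (1 - μ.real {I | v ∈ I}) *
      ∏ u ∈ G.neighborFinset v, (1 - μ.real {I | u ∈ I} / (1 - μ.real {I | v ∈ I})) := by
  have hprob := hμ.isProbabilityMeasure
  have hi := hμ.ae_isIndepSet
  have htree : (G.induce (({v} : Finset V) : Set V)).IsTree := by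
    have : Subsingleton (({v} : Finset V) : Set V) := by simp
    have : Nonempty (({v} : Finset V) : Set V) := by simp
    exact SimpleGraph.IsTree.of_subsingleton
  set D : Set (Set V) := {I | ∀ u, G.Adj v u → u ∉ I} with hDdef
  have hD : {I : Set V | Disjoint I (outerBoundary G (({v} : Finset V) : Set V))} = D := by
    ext I
    simp only [hDdef, mem_ofPred_eq, Set.disjoint_right, outerBoundary, Finset.coe_singleton,
      mem_singleton_iff, exists_eq_left]
    exact ⟨fun h u hu => h ⟨hu.ne', hu⟩, fun h u hu => h u hu.2⟩
  have hDm : MeasurableSet D := by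
    rw [← hD]
    simp only [Set.disjoint_iff_inter_eq_empty]
    exact measurableSet_inter_eq _ _
  have h1 := hμ.cond_eq {v} htree {v} (by simp) (by simp [SimpleGraph.IsIndepSet])
  have h2 := hμ.cond_eq {v} htree ∅ (by simp) (by simp [SimpleGraph.IsIndepSet])
  rw [hD, cond_real_apply _ hDm, partitionFunction_singleton] at h1 h2
  have e1 : D ∩ {I : Set V | I ∩ (({v} : Finset V) : Set V) = (({v} : Finset V) : Set V)} =
      {I | v ∈ I} ∩ D := by
    ext I
    simp [and_comm]
  have e2 : D ∩ {I : Set V | I ∩ (({v} : Finset V) : Set V) = ((∅ : Finset V) : Set V)} =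
      {I | v ∉ I} ∩ D := by
    ext I
    simp [and_comm]
  rw [e1] at h1
  rw [e2] at h2
  have h3 : μ.real ({I | v ∈ I} ∩ D) = μ.real {I | v ∈ I} := by
    refine measureReal_congr ?_
    filter_upwards [hi] with I hI
    refine propext ⟨fun h => h.1, fun h => ⟨h, fun u hu hu' => ?_⟩⟩
    exact hI h hu' hu.ne hu
  rw [h3] at h1
  -- Otherwise the conditional measure would be zero by the convention for inverses, whereas `h2`
  -- gives the empty configuration mass `1 / (1 + lam)`.
  have hDpos : 0 < μ.real D := by
    refine lt_of_le_of_ne measureReal_nonneg fun h => ?_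
    rw [← h] at h2
    simp at h2
    linarith
  have hpos : 0 < 1 + lam := by linarith
  simp only [Finset.card_singleton, pow_one, Finset.card_empty, pow_zero] at h1 h2
  rw [inv_mul_eq_iff_eq_mul₀ hDpos.ne'] at h1 h2
  have hb : 0 < μ.real ({I | v ∉ I} ∩ D) := by rw [h2]; positivity
  have hrel : μ.real {I | v ∈ I} = lam * μ.real ({I | v ∉ I} ∩ D) := by
    rw [h1, h2]; ring
  have ha : 0 < μ.real {I | v ∈ I} := by rw [hrel]; positivity
  have ha' : μ.real {I | v ∈ I} < 1 := by
    have h4 := measureReal_notMem μ v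
    have h5 : μ.real ({I | v ∉ I} ∩ D) ≤ μ.real {I | v ∉ I} := measureReal_mono inter_subset_left
    linarith
  have hprod := hs.real_notMem_inter_neighbors hi ha'
  have h1a : 0 < 1 - μ.real {I | v ∈ I} := by linarith
  refine ⟨ha, ha', fun u hu => ?_, ?_⟩
  · have h4 := measureReal_notMem_inter_mem hi hu
    have h5 : μ.real {I | u ∈ I} ≤ 1 - μ.real {I | v ∈ I} := by
      rw [← h4, ← measureReal_notMem]
      exact measureReal_mono inter_subset_left
    -- Equality would mean that `u` is almost surely occupied whenever `v` is vacant; one factor of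
    -- the product would vanish, against `hb`.
    refine lt_of_le_of_ne (by linarith) fun h => ?_
    rw [hprod, Finset.prod_eq_zero ((G.mem_neighborFinset v u).2 hu), mul_zero] at hb
    · exact lt_irrefl _ hb
    · rw [show μ.real {I | u ∈ I} = 1 - μ.real {I | v ∈ I} by linarith, div_self h1a.ne', sub_self]
  · rw [mul_assoc, ← hprod]
    exact hrel

end GibbsEquations

/-! ### The density equations -/

section DensityEquations

/-- A strictly increasing continuous function on a half-line that tends to infinity has a
continuous inverse. -/
lemma exists_continuousOn_inverse {f : ℝ → ℝ} {c : ℝ} (hf : ContinuousOn f (Ici c))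
    (hmono : StrictMonoOn f (Ici c)) (hlim : Tendsto f atTop atTop) :
    ∃ g : ℝ → ℝ, ContinuousOn g (Ici (f c)) ∧ ∀ y ∈ Ici (f c), g y ∈ Ici c ∧ f (g y) = y := by
  classical
  have himage : f '' Ici c = Ici (f c) := by
    apply Subset.antisymm
    · rintro _ ⟨x, hx, rfl⟩
      exact hmono.monotoneOn self_mem_Ici hx hx
    · intro y hy
      obtain ⟨b, hyb, hcb⟩ := (hlim.eventually_ge_atTop y |>.and (eventually_ge_atTop c)).exists
      obtain ⟨x, hx, rfl⟩ := intermediate_value_Icc hcb (hf.mono Icc_subset_Ici_self) ⟨hy, hyb⟩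
      exact ⟨x, hx.1, rfl⟩
  -- An order isomorphism between the two half-lines is automatically a homeomorphism.
  let e : Ici c ≃o Ici (f c) := (hmono.orderIso f (Ici c)).trans (OrderIso.setCongr _ _ himage)
  refine ⟨fun y => if h : y ∈ Ici (f c) then e.symm ⟨y, h⟩ else c, ?_, fun y hy => ?_⟩
  · rw [continuousOn_iff_continuous_domRestrict]
    have : (Ici (f c)).domRestrict (fun y => if h : y ∈ Ici (f c) then (e.symm ⟨y, h⟩ : ℝ) else c) =
        fun y => (e.symm y : ℝ) := by
      ext y
      simp only [domRestrict_apply]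
      exact dif_pos y.2
    rw [this]
    exact continuous_subtype_val.comp e.symm.continuous
  · simp only [dif_pos hy]
    refine ⟨(e.symm ⟨y, hy⟩).2, ?_⟩
    have h1 : ∀ x : Ici c, ((e x : Ici (f c)) : ℝ) = f x := fun x => rfl
    rw [← h1, e.apply_symm_apply]

/-- Interior stationary points of the exponent for degree `k + 1`, which are also the possible
pairs of densities of simple Gibbs measures. -/
structure IsDensityPair (k : ℕ) (lam α β : ℝ) : Prop where
  pos_left : 0 < α
  pos_right : 0 < β
  add_lt_one : α + β < 1
  eq_left : α * (1 - α) ^ k = lam * (1 - α - β) ^ (k + 1)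
  eq_right : β * (1 - β) ^ k = lam * (1 - α - β) ^ (k + 1)

variable {k : ℕ} {lam α β : ℝ}

lemma IsDensityPair.symm (h : IsDensityPair k lam α β) : IsDensityPair k lam β α where
  pos_left := h.pos_right
  pos_right := h.pos_left
  add_lt_one := by linarith [h.add_lt_one]
  eq_left := by rw [h.eq_right]; ring
  eq_right := by rw [h.eq_left]; ring

/-- In terms of the ratios `x` and `y` of the densities to the vacant edge density, the density
equations decouple. -/
lemma IsDensityPair.exists_ratio (h : IsDensityPair k lam α β) :
    ∃ x y : ℝ, 0 < x ∧ 0 < y ∧ x * (1 + y) ^ k = lam ∧ y * (1 + x) ^ k = lam ∧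
      α = x / (1 + x + y) ∧ β = y / (1 + x + y) := by
  have hα := h.pos_left
  have hβ := h.pos_right
  have h1 := h.eq_left
  have h2 := h.eq_right
  have hz : 0 < 1 - α - β := by linarith [h.add_lt_one]
  set z := 1 - α - β with hzdef
  have e1 : 1 + β / z = (1 - α) / z := by field_simp; rw [hzdef]; ring
  have e2 : 1 + α / z = (1 - β) / z := by field_simp; rw [hzdef]; ring
  have e3 : 1 + α / z + β / z = 1 / z := by field_simp; rw [hzdef]; ring
  refine ⟨α / z, β / z, div_pos hα hz, div_pos hβ hz, ?_, ?_, ?_, ?_⟩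
  · rw [e1, div_pow, div_mul_div_comm, h1, ← pow_succ', mul_div_cancel_right₀]
    positivity
  · rw [e2, div_pow, div_mul_div_comm, h2, ← pow_succ', mul_div_cancel_right₀]
    positivity
  · rw [e3]; field_simp
  · rw [e3]; field_simp

lemma isDensityPair_of_ratio {x y : ℝ} (hx : 0 < x) (hy : 0 < y) (h1 : x * (1 + y) ^ k = lam)
    (h2 : y * (1 + x) ^ k = lam) :
    IsDensityPair k lam (x / (1 + x + y)) (y / (1 + x + y)) := by
  have hs : 0 < 1 + x + y := by positivity
  have e0 : 1 - x / (1 + x + y) - y / (1 + x + y) = 1 / (1 + x + y) := by field_simp; ring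
  have e1 : 1 - x / (1 + x + y) = (1 + y) / (1 + x + y) := by field_simp; ring
  have e2 : 1 - y / (1 + x + y) = (1 + x) / (1 + x + y) := by field_simp; ring
  refine ⟨by positivity, by positivity, ?_, ?_, ?_⟩
  · rw [← add_div, div_lt_one hs]; linarith
  · rw [e0, e1, ← h1, div_pow, div_pow, div_mul_div_comm, ← pow_succ', one_pow, mul_one_div]
  · rw [e0, e2, ← h2, div_pow, div_pow, div_mul_div_comm, ← pow_succ', one_pow, mul_one_div]

end DensityEquations

/-! ### The symmetric solution -/

section SymmetricSolution

lemma strictMonoOn_mul_one_add_pow (k : ℕ) :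
    StrictMonoOn (fun x : ℝ => x * (1 + x) ^ k) (Ici 0) := by
  intro x hx y hy hxy
  have hx : 0 ≤ x := hx
  have h1 : (1 + x) ^ k ≤ (1 + y) ^ k := pow_le_pow_left₀ (by linarith) (by linarith) k
  have h2 : 0 < (1 + y) ^ k := pow_pos (by linarith) k
  exact (mul_le_mul_of_nonneg_left h1 hx).trans_lt (mul_lt_mul_of_pos_right hxy h2)

lemma exists_symmetricRatio (k : ℕ) : ∃ g : ℝ → ℝ, ContinuousOn g (Ici 0) ∧
    ∀ lam, 0 ≤ lam → 0 ≤ g lam ∧ g lam * (1 + g lam) ^ k = lam := by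
  have h := exists_continuousOn_inverse (f := fun x : ℝ => x * (1 + x) ^ k) (c := 0)
    (by fun_prop) (strictMonoOn_mul_one_add_pow k) ?_
  · simpa using h
  · refine tendsto_atTop_mono' _ ?_ tendsto_id
    filter_upwards [eventually_ge_atTop 0] with x hx
    exact le_mul_of_one_le_right hx (one_le_pow₀ (by linarith))

/-- The ratio of occupied to vacant edge density of the symmetric solution. -/
noncomputable def symmetricRatio (k : ℕ) : ℝ → ℝ := (exists_symmetricRatio k).choose

lemma continuousOn_symmetricRatio (k : ℕ) : ContinuousOn (symmetricRatio k) (Ici 0) :=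
  (exists_symmetricRatio k).choose_spec.1

lemma symmetricRatio_nonneg (k : ℕ) {lam : ℝ} (h : 0 ≤ lam) : 0 ≤ symmetricRatio k lam :=
  ((exists_symmetricRatio k).choose_spec.2 lam h).1

lemma symmetricRatio_mul_pow (k : ℕ) {lam : ℝ} (h : 0 ≤ lam) :
    symmetricRatio k lam * (1 + symmetricRatio k lam) ^ k = lam :=
  ((exists_symmetricRatio k).choose_spec.2 lam h).2

lemma symmetricRatio_pos (k : ℕ) {lam : ℝ} (h : 0 < lam) : 0 < symmetricRatio k lam := by
  refine lt_of_le_of_ne (symmetricRatio_nonneg k h.le) fun h0 => ?_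
  have := symmetricRatio_mul_pow k h.le
  rw [← h0, zero_mul] at this
  exact h.ne this

lemma symmetricRatio_eq {k : ℕ} {x lam : ℝ} (hx : 0 < x) (h : x * (1 + x) ^ k = lam) :
    symmetricRatio k lam = x := by
  have hlam : 0 < lam := by rw [← h]; positivity
  refine (strictMonoOn_mul_one_add_pow k).injOn (symmetricRatio_nonneg k hlam.le) hx.le ?_
  simp only [symmetricRatio_mul_pow k hlam.le, h]

/-- The density of the translation-invariant simple Gibbs measure. -/
noncomputable def symmetricDensity (k : ℕ) (lam : ℝ) : ℝ :=
  symmetricRatio k lam / (1 + symmetricRatio k lam + symmetricRatio k lam)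

lemma isDensityPair_symmetricDensity (k : ℕ) {lam : ℝ} (h : 0 < lam) :
    IsDensityPair k lam (symmetricDensity k lam) (symmetricDensity k lam) :=
  isDensityPair_of_ratio (symmetricRatio_pos k h) (symmetricRatio_pos k h)
    (symmetricRatio_mul_pow k h.le) (symmetricRatio_mul_pow k h.le)

lemma IsDensityPair.eq_symmetricDensity {k : ℕ} {lam α : ℝ} (h : IsDensityPair k lam α α) :
    α = symmetricDensity k lam := by
  obtain ⟨x, y, hx, hy, h1, h2, h3, h4⟩ := h.exists_ratio
  have hxy : x = y := by
    rw [h3] at h4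
    field_simp at h4
    exact h4
  subst hxy
  rw [symmetricDensity, symmetricRatio_eq hx h1]
  exact h3

lemma continuousOn_symmetricDensity (k : ℕ) : ContinuousOn (symmetricDensity k) (Ici 0) := by
  refine (continuousOn_symmetricRatio k).div (by
    have := continuousOn_symmetricRatio k
    fun_prop) fun lam hlam => ?_
  have := symmetricRatio_nonneg k hlam
  positivity

end SymmetricSolution

/-! ### The asymmetric solutions -/

section AsymmetricSolution

/-- The geometric sum `1 + t + ⋯ + t ^ m`. -/
def geomSum (m : ℕ) (t : ℝ) : ℝ := ∑ i ∈ Finset.range (m + 1), t ^ i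

lemma geomSum_pos (m : ℕ) {t : ℝ} (ht : 0 < t) : 0 < geomSum m t :=
  Finset.sum_pos (fun i _ => pow_pos ht i) (by simp)

lemma continuous_geomSum (m : ℕ) : Continuous (geomSum m) := by
  unfold geomSum; fun_prop

lemma geomSum_one (m : ℕ) : geomSum m 1 = m + 1 := by simp [geomSum]

lemma geomSum_succ (m : ℕ) (t : ℝ) : geomSum (m + 1) t = geomSum m t + t ^ (m + 1) :=
  Finset.sum_range_succ _ _

lemma geomSum_succ' (m : ℕ) (t : ℝ) : geomSum (m + 1) t = t * geomSum m t + 1 := by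
  rw [geomSum, geomSum, Finset.sum_range_succ', Finset.mul_sum]
  simp [pow_succ']

lemma geomSum_mul (m : ℕ) (t : ℝ) : geomSum m t * (t - 1) = t ^ (m + 1) - 1 :=
  geom_sum_mul t (m + 1)

/-- The activity at which the asymmetric ratios `x < y` satisfy `1 + y = t (1 + x)`, for
degree `m + 3`. -/
noncomputable def asymmetricActivity (m : ℕ) (t : ℝ) : ℝ :=
  geomSum (m + 1) t ^ (m + 2) / (t * geomSum m t ^ (m + 3))

/-- The smaller asymmetric ratio. -/
noncomputable def smallRatio (m : ℕ) (t : ℝ) : ℝ := 1 / (t * geomSum m t)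

/-- The larger asymmetric ratio. -/
noncomputable def largeRatio (m : ℕ) (t : ℝ) : ℝ := t ^ (m + 1) / geomSum m t

lemma smallRatio_pos (m : ℕ) {t : ℝ} (ht : 0 < t) : 0 < smallRatio m t := by
  have := geomSum_pos m ht
  unfold smallRatio; positivity

lemma largeRatio_pos (m : ℕ) {t : ℝ} (ht : 0 < t) : 0 < largeRatio m t := by
  have := geomSum_pos m ht
  unfold largeRatio; positivity

lemma smallRatio_lt_largeRatio (m : ℕ) {t : ℝ} (ht : 1 < t) : smallRatio m t < largeRatio m t := by
  have h0 : 0 < t := by linarith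
  have h := geomSum_pos m h0
  rw [smallRatio, largeRatio, div_lt_div_iff₀ (by positivity) h]
  have h1 : 1 < t ^ (m + 1) := one_lt_pow₀ ht (by simp)
  have h2 : geomSum m t < t * geomSum m t := by nlinarith
  nlinarith [mul_pos h0 h]

lemma asymmetricActivity_eq_small (m : ℕ) {t : ℝ} (ht : 0 < t) :
    smallRatio m t * (1 + largeRatio m t) ^ (m + 2) = asymmetricActivity m t := by
  have h := geomSum_pos m ht
  have h1 : 1 + largeRatio m t = geomSum (m + 1) t / geomSum m t := by
    rw [largeRatio, geomSum_succ]; field_simp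
  rw [h1, smallRatio, asymmetricActivity, div_pow, div_mul_div_comm, one_mul, mul_assoc,
    ← pow_succ']

lemma asymmetricActivity_eq_large (m : ℕ) {t : ℝ} (ht : 0 < t) :
    largeRatio m t * (1 + smallRatio m t) ^ (m + 2) = asymmetricActivity m t := by
  have h := geomSum_pos m ht
  have h1 : 1 + smallRatio m t = geomSum (m + 1) t / (t * geomSum m t) := by
    rw [smallRatio, geomSum_succ']; field_simp
  rw [h1, largeRatio, asymmetricActivity, div_pow, div_mul_div_comm,
    div_eq_div_iff (by positivity) (by positivity)]
  ring

lemma asymmetricActivity_one (m : ℕ) : asymmetricActivity m 1 = criticalActivity (m + 3) := by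
  rw [asymmetricActivity, geomSum_one, geomSum_one, criticalActivity]
  push_cast
  rw [one_mul, show (m : ℝ) + 3 - 1 = m + 1 + 1 by ring, show (m : ℝ) + 3 - 2 = m + 1 by ring]

/-- AM-GM for the `n + 2` distinct numbers `1, r ^ 2, …, r ^ (2 (n + 1))`, whose geometric mean is
`r ^ (n + 1)`. The square of the base avoids half-integral exponents. -/
lemma pow_succ_lt_geomSum_sq {r : ℝ} (hr : 1 < r) (n : ℕ) :
    (n + 2) * r ^ (n + 1) < geomSum (n + 1) (r ^ 2) := by
  induction n with
  | zero =>
    simp only [geomSum, Finset.sum_range_succ, Finset.sum_range_zero]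
    norm_num
    nlinarith [sq_pos_of_pos (sub_pos.2 hr)]
  | succ n ih =>
    rw [geomSum_succ']
    have hr0 : 0 < r := by linarith
    -- AM-GM for `j` copies of `r ^ (j + 1)` and a single `1`; with `j = n + 2` it is exactly what
    -- the induction step lacks.
    have hb : ∀ j : ℕ, (j + 1 : ℝ) * r ^ j ≤ j * r ^ (j + 1) + 1 := by
      intro j
      induction j with
      | zero => simp
      | succ j ihj =>
        have h1 : 1 ≤ r ^ (j + 1) := one_le_pow₀ hr.le
        have h2 := mul_le_mul_of_nonneg_left ihj hr0.le
        push_cast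
        have h3 : 0 ≤ (r ^ (j + 1) - 1) * (r - 1) := mul_nonneg (by linarith) (by linarith)
        ring_nf at h2 h3 ⊢
        nlinarith
    have h1 := hb (n + 2)
    have h2 := mul_lt_mul_of_pos_left ih (by positivity : 0 < r ^ 2)
    push_cast at h1 ⊢
    ring_nf at h1 h2 ⊢
    linarith

lemma sq_mul_lt_geomSum_sq {t : ℝ} (ht : 1 < t) (n : ℕ) :
    (n + 2 : ℝ) ^ 2 * t ^ (n + 1) < geomSum (n + 1) t ^ 2 := by
  have h0 : 0 ≤ t := by linarith
  have h := pow_succ_lt_geomSum_sq (r := √t) (by simpa using Real.lt_sqrt_of_sq_lt (by simpa)) n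
  rw [Real.sq_sqrt h0] at h
  have h1 := pow_lt_pow_left₀ h (by positivity) two_ne_zero
  rwa [mul_pow, ← pow_mul, mul_comm (n + 1) 2, pow_mul, Real.sq_sqrt h0] at h1

lemma log_asymmetricActivity (m : ℕ) {t : ℝ} (ht : 1 < t) :
    Real.log (asymmetricActivity m t) = (m + 2) * Real.log (t ^ (m + 2) - 1) -
      (m + 3) * Real.log (t ^ (m + 1) - 1) + Real.log (t - 1) - Real.log t := by
  have h0 : 0 < t := by linarith
  have h1 : 0 < t - 1 := by linarith
  have hp : ∀ n : ℕ, 0 < t ^ (n + 1) - 1 := fun n => sub_pos.2 (one_lt_pow₀ ht (by simp))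
  have hs : ∀ n, Real.log (geomSum n t) = Real.log (t ^ (n + 1) - 1) - Real.log (t - 1) := by
    intro n
    rw [← Real.log_div (hp n).ne' h1.ne', ← geomSum_mul, mul_div_cancel_right₀ _ h1.ne']
  have hg := fun n => geomSum_pos n h0
  rw [asymmetricActivity, Real.log_div (pow_pos (hg _) _).ne'
    (mul_pos h0 (pow_pos (hg _) _)).ne', Real.log_mul h0.ne' (pow_pos (hg _) _).ne', Real.log_pow,
    Real.log_pow, hs, hs]
  push_cast
  ring

lemma continuousOn_asymmetricActivity (m : ℕ) :
    ContinuousOn (asymmetricActivity m) (Ici 1) := by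
  have h1 := continuous_geomSum m
  have h2 := continuous_geomSum (m + 1)
  refine ContinuousOn.div (by fun_prop) (by fun_prop) fun t ht => ?_
  have h0 : 0 < t := zero_lt_one.trans_le ht
  have h1 := geomSum_pos m h0
  positivity

/-- Over a positive denominator, the logarithmic derivative for `t > 1` has numerator `(t - 1) ^ 2 *
(geomSum (m + 1) t ^ 2 - (m + 2) ^ 2 * t ^ (m + 1))`, positive by AM-GM. The closed form is singular
at `t = 1`, where continuity of the geometric sums takes over. -/
lemma strictMonoOn_asymmetricActivity (m : ℕ) :
    StrictMonoOn (asymmetricActivity m) (Ici 1) := by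
  have hpos : ∀ t ∈ Ici (1 : ℝ), 0 < asymmetricActivity m t := by
    intro t ht
    have h0 : 0 < t := zero_lt_one.trans_le ht
    have h1 := geomSum_pos m h0
    have h2 := geomSum_pos (m + 1) h0
    unfold asymmetricActivity; positivity
  have hcont := continuousOn_asymmetricActivity m
  have key : StrictMonoOn (fun t => Real.log (asymmetricActivity m t)) (Ici 1) := by
    refine strictMonoOn_of_deriv_pos (convex_Ici 1) (hcont.log fun t ht => (hpos t ht).ne') ?_
    intro t ht
    rw [interior_Ici] at ht
    have ht : 1 < t := ht
    have h0 : 0 < t := by linarith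
    have h1 : 0 < t - 1 := by linarith
    have hp : ∀ n : ℕ, 0 < t ^ (n + 1) - 1 := fun n => sub_pos.2 (one_lt_pow₀ ht (by simp))
    have hd : ∀ n : ℕ, HasDerivAt (fun s : ℝ => Real.log (s ^ (n + 1) - 1))
        ((n + 1) * t ^ n / (t ^ (n + 1) - 1)) t := by
      intro n
      have := ((hasDerivAt_pow (n + 1) t).sub_const 1).log (hp n).ne'
      simpa using this
    have hderiv := (((hd (m + 1)).const_mul (m + 2 : ℝ)).sub
      ((hd m).const_mul (m + 3 : ℝ))).add
      (((hasDerivAt_id t).sub_const 1).log h1.ne') |>.sub (Real.hasDerivAt_log h0.ne')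
    have heq : (fun t => Real.log (asymmetricActivity m t)) =ᶠ[𝓝 t] fun t =>
        (m + 2) * Real.log (t ^ (m + 2) - 1) -
          (m + 3) * Real.log (t ^ (m + 1) - 1) + Real.log (t - 1) - Real.log t := by
      filter_upwards [lt_mem_nhds ht] with s hs using log_asymmetricActivity m hs
    rw [heq.deriv_eq]
    have hval := HasDerivAt.deriv hderiv
    refine lt_of_lt_of_eq ?_ hval.symm
    push_cast
    have hA := sq_mul_lt_geomSum_sq ht m
    have hB : 0 < t ^ (m + 2) - 1 := hp (m + 1)
    have hC : 0 < t ^ (m + 1) - 1 := hp m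
    have hnum : 0 < (t ^ (m + 2) - 1) ^ 2 - (m + 2 : ℝ) ^ 2 * (t - 1) ^ 2 * t ^ (m + 1) := by
      rw [← geomSum_mul (m + 1) t]
      nlinarith [mul_pos (sub_pos.2 hA) (pow_pos h1 2)]
    have : (m + 2 : ℝ) * ((m + 1 + 1) * t ^ (m + 1) / (t ^ (m + 1 + 1) - 1)) -
        (m + 3) * ((m + 1) * t ^ m / (t ^ (m + 1) - 1)) + 1 / (id t - 1) - t⁻¹ =
        ((t ^ (m + 2) - 1) ^ 2 - (m + 2 : ℝ) ^ 2 * (t - 1) ^ 2 * t ^ (m + 1)) /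
          (t * (t ^ (m + 2) - 1) * (t ^ (m + 1) - 1) * (t - 1)) := by
      simp only [id]
      field_simp
      ring
    rw [this]
    positivity
  intro t ht s hs hts
  exact (Real.log_lt_log_iff (hpos t ht) (hpos s hs)).1 (key ht hs hts)

lemma tendsto_asymmetricActivity (m : ℕ) : Tendsto (asymmetricActivity m) atTop atTop := by
  -- A lower bound for the activity: `geomSum (m + 1) t ≥ t * geomSum m t` bounds it below by `t ^
  -- (m + 1) / geomSum m t`, and `geomSum m t ≤ (m + 1) * t ^ m` for `t ≥ 1`.
  have h : Tendsto (fun t : ℝ => t / (m + 1)) atTop atTop :=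
    tendsto_id.atTop_div_const (by positivity)
  refine tendsto_atTop_mono' _ ?_ h
  filter_upwards [eventually_ge_atTop 1] with t ht
  have h0 : 0 < t := zero_lt_one.trans_le ht
  have hg := geomSum_pos m h0
  have h1 : geomSum m t ≤ (m + 1) * t ^ m := by
    have : geomSum m t ≤ ∑ _i ∈ Finset.range (m + 1), t ^ m :=
      Finset.sum_le_sum fun i hi => pow_le_pow_right₀ ht (by simp at hi; omega)
    simpa using this
  have h2 : (t * geomSum m t) ^ (m + 2) ≤ geomSum (m + 1) t ^ (m + 2) :=
    pow_le_pow_left₀ (by positivity) (by rw [geomSum_succ']; linarith) _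
  rw [asymmetricActivity, div_le_div_iff₀ (by positivity) (by positivity)]
  have h3 := mul_le_mul_of_nonneg_right h2 (by positivity : (0 : ℝ) ≤ m + 1)
  refine le_trans ?_ h3
  have h4 := mul_le_mul_of_nonneg_right h1 (by positivity : 0 ≤ t ^ 2 * geomSum m t ^ (m + 2))
  calc t * (t * geomSum m t ^ (m + 3)) = geomSum m t * (t ^ 2 * geomSum m t ^ (m + 2)) := by ring
    _ ≤ (m + 1) * t ^ m * (t ^ 2 * geomSum m t ^ (m + 2)) := h4
    _ = (t * geomSum m t) ^ (m + 2) * (m + 1) := by ring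

/-- Every asymmetric solution of the density equations belongs to the one-parameter family. -/
lemma exists_eq_asymmetricActivity (m : ℕ) {x y lam : ℝ} (hx : 0 < x) (hxy : x < y)
    (h1 : x * (1 + y) ^ (m + 2) = lam) (h2 : y * (1 + x) ^ (m + 2) = lam) :
    ∃ t, 1 < t ∧ x = smallRatio m t ∧ y = largeRatio m t ∧ lam = asymmetricActivity m t := by
  have hx1 : 0 < 1 + x := by linarith
  set t := (1 + y) / (1 + x) with htdef
  have ht : 1 < t := by rw [htdef, one_lt_div hx1]; linarith
  have h0 : 0 < t := by linarith
  have hg := geomSum_pos m h0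
  have hy1 : 1 + y = t * (1 + x) := by rw [htdef]; field_simp
  have hy : y = x * t ^ (m + 2) := by
    have : y * (1 + x) ^ (m + 2) = x * t ^ (m + 2) * (1 + x) ^ (m + 2) := by
      rw [h2, ← h1, hy1, mul_pow]; ring
    exact mul_right_cancel₀ (pow_pos hx1 _).ne' this
  have hxt : x * (t * geomSum m t) = 1 := by
    -- Inserting `y = x t ^ (m + 2)` into `1 + y = t (1 + x)` gives `x t (t ^ (m + 1) - 1) = t - 1`,
    -- from which the factor `t - 1` cancels.
    have h3 : x * (t * geomSum m t) * (t - 1) = 1 * (t - 1) := by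
      rw [mul_assoc, mul_assoc, geomSum_mul]
      rw [hy] at hy1
      ring_nf at hy1 ⊢
      linarith
    exact mul_right_cancel₀ (by linarith : t - 1 ≠ 0) h3
  have hxs : x = smallRatio m t := by
    rw [smallRatio, eq_div_iff (by positivity)]; exact hxt
  have hyl : y = largeRatio m t := by
    rw [hy, hxs, smallRatio, largeRatio]
    field_simp
    ring
  exact ⟨t, ht, hxs, hyl, by rw [← h1, hxs, hyl, asymmetricActivity_eq_small m h0]⟩

lemma exists_asymmetryParameter (m : ℕ) : ∃ g : ℝ → ℝ,
    ContinuousOn g (Ici (criticalActivity (m + 3))) ∧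
    ∀ lam ∈ Ici (criticalActivity (m + 3)), g lam ∈ Ici 1 ∧ asymmetricActivity m (g lam) = lam := by
  have := exists_continuousOn_inverse (continuousOn_asymmetricActivity m)
    (strictMonoOn_asymmetricActivity m) (tendsto_asymmetricActivity m)
  rwa [asymmetricActivity_one] at this

/-- The parameter `t = (1 + y) / (1 + x)` of the asymmetric solution at a given activity. -/
noncomputable def asymmetryParameter (m : ℕ) : ℝ → ℝ := (exists_asymmetryParameter m).choose

lemma continuousOn_asymmetryParameter (m : ℕ) :
    ContinuousOn (asymmetryParameter m) (Ici (criticalActivity (m + 3))) :=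
  (exists_asymmetryParameter m).choose_spec.1

lemma one_le_asymmetryParameter (m : ℕ) {lam : ℝ} (h : criticalActivity (m + 3) ≤ lam) :
    1 ≤ asymmetryParameter m lam :=
  ((exists_asymmetryParameter m).choose_spec.2 lam h).1

lemma asymmetricActivity_asymmetryParameter (m : ℕ) {lam : ℝ}
    (h : criticalActivity (m + 3) ≤ lam) :
    asymmetricActivity m (asymmetryParameter m lam) = lam :=
  ((exists_asymmetryParameter m).choose_spec.2 lam h).2

lemma asymmetryParameter_eq (m : ℕ) {t : ℝ} (ht : 1 ≤ t) :
    asymmetryParameter m (asymmetricActivity m t) = t := by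
  have h : criticalActivity (m + 3) ≤ asymmetricActivity m t := by
    rw [← asymmetricActivity_one]
    exact (strictMonoOn_asymmetricActivity m).monotoneOn self_mem_Ici ht ht
  exact (strictMonoOn_asymmetricActivity m).injOn (one_le_asymmetryParameter m h) ht
    (asymmetricActivity_asymmetryParameter m h)

lemma one_lt_asymmetryParameter (m : ℕ) {lam : ℝ} (h : criticalActivity (m + 3) < lam) :
    1 < asymmetryParameter m lam := by
  refine lt_of_le_of_ne (one_le_asymmetryParameter m h.le) fun h1 => ?_
  have := asymmetricActivity_asymmetryParameter m h.le
  rw [← h1, asymmetricActivity_one] at this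
  exact h.ne this

/-- The smaller density of the asymmetric solution. -/
noncomputable def smallDensity (m : ℕ) (lam : ℝ) : ℝ :=
  smallRatio m (asymmetryParameter m lam) /
    (1 + smallRatio m (asymmetryParameter m lam) + largeRatio m (asymmetryParameter m lam))

/-- The larger density of the asymmetric solution. -/
noncomputable def largeDensity (m : ℕ) (lam : ℝ) : ℝ :=
  largeRatio m (asymmetryParameter m lam) /
    (1 + smallRatio m (asymmetryParameter m lam) + largeRatio m (asymmetryParameter m lam))

lemma continuousOn_smallRatio (m : ℕ) : ContinuousOn (smallRatio m) (Ici 1) := by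
  have := continuous_geomSum m
  refine ContinuousOn.div (by fun_prop) (by fun_prop) fun t ht => ?_
  have h0 : 0 < t := zero_lt_one.trans_le ht
  exact (mul_pos h0 (geomSum_pos m h0)).ne'

lemma continuousOn_largeRatio (m : ℕ) : ContinuousOn (largeRatio m) (Ici 1) := by
  have := continuous_geomSum m
  refine ContinuousOn.div (by fun_prop) (by fun_prop) fun t ht => ?_
  exact (geomSum_pos m (zero_lt_one.trans_le ht)).ne'

lemma continuousOn_smallDensity (m : ℕ) :
    ContinuousOn (smallDensity m) (Ici (criticalActivity (m + 3))) := by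
  have hp := continuousOn_asymmetryParameter m
  have hm : MapsTo (asymmetryParameter m) (Ici (criticalActivity (m + 3))) (Ici 1) :=
    fun lam h => one_le_asymmetryParameter m h
  have h1 := (continuousOn_smallRatio m).comp hp hm
  have h2 := (continuousOn_largeRatio m).comp hp hm
  refine h1.div ((continuousOn_const.add h1).add h2) fun lam h => ?_
  have h0 : 0 < asymmetryParameter m lam := zero_lt_one.trans_le (hm h)
  have := smallRatio_pos m h0
  have := largeRatio_pos m h0
  change 1 + smallRatio m (asymmetryParameter m lam) + largeRatio m (asymmetryParameter m lam) ≠ 0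
  positivity

lemma continuousOn_largeDensity (m : ℕ) :
    ContinuousOn (largeDensity m) (Ici (criticalActivity (m + 3))) := by
  have hp := continuousOn_asymmetryParameter m
  have hm : MapsTo (asymmetryParameter m) (Ici (criticalActivity (m + 3))) (Ici 1) :=
    fun lam h => one_le_asymmetryParameter m h
  have h1 := (continuousOn_smallRatio m).comp hp hm
  have h2 := (continuousOn_largeRatio m).comp hp hm
  refine h2.div ((continuousOn_const.add h1).add h2) fun lam h => ?_
  have h0 : 0 < asymmetryParameter m lam := zero_lt_one.trans_le (hm h)
  have := smallRatio_pos m h0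
  have := largeRatio_pos m h0
  change 1 + smallRatio m (asymmetryParameter m lam) + largeRatio m (asymmetryParameter m lam) ≠ 0
  positivity

lemma isDensityPair_small_large (m : ℕ) {lam : ℝ} (h : criticalActivity (m + 3) < lam) :
    IsDensityPair (m + 2) lam (smallDensity m lam) (largeDensity m lam) := by
  have h0 : 0 < asymmetryParameter m lam := zero_lt_one.trans (one_lt_asymmetryParameter m h)
  refine isDensityPair_of_ratio (smallRatio_pos m h0) (largeRatio_pos m h0) ?_ ?_
  · rw [asymmetricActivity_eq_small m h0, asymmetricActivity_asymmetryParameter m h.le]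
  · rw [asymmetricActivity_eq_large m h0, asymmetricActivity_asymmetryParameter m h.le]

lemma criticalActivity_pos (m : ℕ) : 0 < criticalActivity (m + 3) := by
  rw [← asymmetricActivity_one, asymmetricActivity, geomSum_one, geomSum_one]
  positivity

/-- At `t = 1` both asymmetric ratios equal `1 / (m + 1)`, so there the family meets the symmetric
solution. -/
lemma symmetricRatio_criticalActivity (m : ℕ) :
    symmetricRatio (m + 2) (criticalActivity (m + 3)) = 1 / (m + 1) := by
  refine symmetricRatio_eq (by positivity) ?_
  rw [← asymmetricActivity_one, ← asymmetricActivity_eq_small m one_pos, smallRatio, largeRatio,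
    geomSum_one]
  simp

lemma inv_lt_symmetricRatio (m : ℕ) {lam : ℝ} (h : criticalActivity (m + 3) < lam) :
    1 / (m + 1) < symmetricRatio (m + 2) lam := by
  have h0 := criticalActivity_pos m
  rw [← symmetricRatio_criticalActivity]
  by_contra! hle
  have := (strictMonoOn_mul_one_add_pow (m + 2)).monotoneOn
    (symmetricRatio_nonneg (m + 2) (h0.trans h).le) (symmetricRatio_nonneg (m + 2) h0.le) hle
  simp only [symmetricRatio_mul_pow _ h0.le, symmetricRatio_mul_pow _ (h0.trans h).le] at this
  linarith

/-- If the symmetric ratio `s` were not strictly between `x` and `y`, monotonicity would separate `s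
(1 + s) ^ (m + 2)` from one of the two asymmetric expressions, yet all three equal `lam`. -/
lemma smallDensity_lt_and_lt_largeDensity (m : ℕ) {lam : ℝ} (h : criticalActivity (m + 3) < lam) :
    smallDensity m lam < symmetricDensity (m + 2) lam ∧
      symmetricDensity (m + 2) lam < largeDensity m lam := by
  have hlam := (criticalActivity_pos m).trans h
  have ht := one_lt_asymmetryParameter m h
  have h0 : 0 < asymmetryParameter m lam := zero_lt_one.trans ht
  have hs := symmetricRatio_pos (m + 2) hlam
  have e := symmetricRatio_mul_pow (m + 2) hlam.le
  have e1 := asymmetricActivity_eq_small m h0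
  have e2 := asymmetricActivity_eq_large m h0
  rw [asymmetricActivity_asymmetryParameter m h.le] at e1 e2
  have hlt := smallRatio_lt_largeRatio m ht
  have hx := smallRatio_pos m h0
  have hy := largeRatio_pos m h0
  unfold smallDensity largeDensity symmetricDensity
  set s := symmetricRatio (m + 2) lam
  set x := smallRatio m (asymmetryParameter m lam)
  set y := largeRatio m (asymmetryParameter m lam)
  have hxs : x < s := by
    by_contra! hle
    have : s * (1 + s) ^ (m + 2) < x * (1 + y) ^ (m + 2) :=
      mul_lt_mul' hle (pow_lt_pow_left₀ (by linarith) (by linarith) (by simp)) (by positivity) hx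
    linarith
  have hsy : s < y := by
    by_contra! hle
    have : y * (1 + x) ^ (m + 2) < s * (1 + s) ^ (m + 2) :=
      mul_lt_mul' hle (pow_lt_pow_left₀ (by linarith) (by linarith) (by simp)) (by positivity) hs
    linarith
  constructor
  · rw [div_lt_div_iff₀ (by positivity) (by positivity)]
    nlinarith [mul_lt_mul_of_pos_left hlt hs]
  · rw [div_lt_div_iff₀ (by positivity) (by positivity)]
    nlinarith [mul_lt_mul_of_pos_left hlt hs]

lemma IsDensityPair.of_lt {m : ℕ} {lam α β : ℝ} (h : IsDensityPair (m + 2) lam α β) (hlt : α < β) :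
    criticalActivity (m + 3) < lam ∧ α = smallDensity m lam ∧ β = largeDensity m lam := by
  obtain ⟨x, y, hx, hy, h1, h2, rfl, rfl⟩ := h.exists_ratio
  have hxy : x < y := by
    rwa [div_lt_div_iff_of_pos_right (by positivity)] at hlt
  obtain ⟨t, ht, rfl, rfl, rfl⟩ := exists_eq_asymmetricActivity m hx hxy h1 h2
  refine ⟨?_, ?_, ?_⟩
  · rw [← asymmetricActivity_one]
    exact strictMonoOn_asymmetricActivity m self_mem_Ici ht.le ht
  · rw [smallDensity, asymmetryParameter_eq m ht.le]
  · rw [largeDensity, asymmetryParameter_eq m ht.le]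

lemma IsDensityPair.eq_of_le {m : ℕ} {lam α β : ℝ} (h : IsDensityPair (m + 2) lam α β)
    (hlam : lam ≤ criticalActivity (m + 3)) :
    α = symmetricDensity (m + 2) lam ∧ β = symmetricDensity (m + 2) lam := by
  rcases lt_trichotomy α β with hlt | rfl | hlt
  · exact absurd (h.of_lt hlt).1 hlam.not_gt
  · exact ⟨h.eq_symmetricDensity, h.eq_symmetricDensity⟩
  · exact absurd (h.symm.of_lt hlt).1 hlam.not_gt

lemma IsDensityPair.eq_or {m : ℕ} {lam α β : ℝ} (h : IsDensityPair (m + 2) lam α β) :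
    (α = β ∧ α = symmetricDensity (m + 2) lam) ∨
      (α = smallDensity m lam ∧ β = largeDensity m lam) ∨
      (α = largeDensity m lam ∧ β = smallDensity m lam) := by
  rcases lt_trichotomy α β with hlt | rfl | hlt
  · exact Or.inr (Or.inl (h.of_lt hlt).2)
  · exact Or.inl ⟨rfl, h.eq_symmetricDensity⟩
  · exact Or.inr (Or.inr (h.symm.of_lt hlt).2.symm)

lemma smallDensity_largeDensity_criticalActivity (m : ℕ) :
    smallDensity m (criticalActivity (m + 3)) =
      symmetricDensity (m + 2) (criticalActivity (m + 3)) ∧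
    largeDensity m (criticalActivity (m + 3)) =
      symmetricDensity (m + 2) (criticalActivity (m + 3)) := by
  have h1 : asymmetryParameter m (criticalActivity (m + 3)) = 1 := by
    rw [← asymmetricActivity_one, asymmetryParameter_eq m le_rfl]
  have h2 : smallRatio m 1 = 1 / (m + 1) := by simp [smallRatio, geomSum_one]
  have h3 : largeRatio m 1 = 1 / (m + 1) := by simp [largeRatio, geomSum_one]
  rw [smallDensity, largeDensity, symmetricDensity, symmetricRatio_criticalActivity, h1, h2, h3]
  exact ⟨rfl, rfl⟩

lemma tendsto_smallDensity_sub (m : ℕ) :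
    Tendsto (fun lam => smallDensity m lam - symmetricDensity (m + 2) lam)
      (𝓝[>] criticalActivity (m + 3)) (𝓝 0) := by
  have hc := criticalActivity_pos m
  have h1 := ((continuousOn_smallDensity m) _ self_mem_Ici).mono Ioi_subset_Ici_self
  have h2 := ((continuousOn_symmetricDensity (m + 2)) _ hc.le).mono
    ((Ioi_subset_Ioi hc.le).trans Ioi_subset_Ici_self)
  have := h1.tendsto.sub h2.tendsto
  rwa [(smallDensity_largeDensity_criticalActivity m).1, sub_self] at this

lemma tendsto_largeDensity_sub (m : ℕ) :
    Tendsto (fun lam => largeDensity m lam - symmetricDensity (m + 2) lam)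
      (𝓝[>] criticalActivity (m + 3)) (𝓝 0) := by
  have hc := criticalActivity_pos m
  have h1 := ((continuousOn_largeDensity m) _ self_mem_Ici).mono Ioi_subset_Ici_self
  have h2 := ((continuousOn_symmetricDensity (m + 2)) _ hc.le).mono
    ((Ioi_subset_Ioi hc.le).trans Ioi_subset_Ici_self)
  have := h1.tendsto.sub h2.tendsto
  rwa [(smallDensity_largeDensity_criticalActivity m).2, sub_self] at this

end AsymmetricSolution

/-! ### The exponent and its local maxima -/

section Exponent

open Real (negMulLog binEntropy)

/-- The exponent for degree `k + 1` in symmetric form. -/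
noncomputable def symmetricExponent (k : ℕ) (lam : ℝ) (q : ℝ × ℝ) : ℝ :=
  (q.1 + q.2) * Real.log lam + negMulLog q.1 + negMulLog q.2 -
    k * (negMulLog (1 - q.1) + negMulLog (1 - q.2)) + (k + 1) * negMulLog (1 - q.1 - q.2)

variable {k : ℕ} {lam : ℝ}

lemma symmetricExponent_swap (q : ℝ × ℝ) :
    symmetricExponent k lam q.swap = symmetricExponent k lam q := by
  simp only [symmetricExponent, Prod.fst_swap, Prod.snd_swap]
  rw [show 1 - q.2 - q.1 = 1 - q.1 - q.2 by ring]
  ring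

lemma continuous_symmetricExponent : Continuous (symmetricExponent k lam) := by
  unfold symmetricExponent; fun_prop

/-- The chain rule for entropy: multiplying the entropy of `α / (1 - β)` by `1 - β` yields the terms
at `α` and `1 - α - β` minus the one at `1 - β`. This exposes the symmetry in `α` and `β`. -/
lemma Phi1_eq_of_ne {q : ℝ × ℝ} (hq : q.2 ≠ 1) :
    Phi1 (k + 1) lam q = symmetricExponent k lam q := by
  obtain ⟨α, β⟩ := q
  have hβ : 1 - β ≠ 0 := sub_ne_zero.2 (Ne.symm hq)
  have h1 := Real.negMulLog_mul (α / (1 - β)) (1 - β)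
  have h2 := Real.negMulLog_mul (1 - α / (1 - β)) (1 - β)
  rw [div_mul_cancel₀ _ hβ] at h1
  rw [sub_mul, div_mul_cancel₀ _ hβ, one_mul, show 1 - β - α = 1 - α - β by ring] at h2
  simp only [Phi1, Psi1, symmetricExponent, Real.binEntropy_eq_negMulLog_add_negMulLog_one_sub]
  push_cast
  linear_combination (-(k : ℝ) - 1) * h1 + (-(k : ℝ) - 1) * h2

lemma Phi1_eq_of_mem {q : ℝ × ℝ} (hq : q ∈ triangle) :
    Phi1 (k + 1) lam q = symmetricExponent k lam q := by
  by_cases h : q.2 = 1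
  · obtain ⟨α, β⟩ := q
    obtain ⟨h1, h2, h3⟩ := hq
    simp only at h h1 h2 h3
    obtain rfl : α = 0 := by linarith
    subst h
    -- At the corner `(0, 1)` the factor `1 - q.2` is zero, so the value given to `0 / 0` is
    -- immaterial and the stated convention holds.
    simp [Phi1, Psi1, symmetricExponent, Real.binEntropy]
  · exact Phi1_eq_of_ne h

lemma isCompact_triangle : IsCompact triangle := by
  refine (isCompact_Icc (a := ((0 : ℝ), (0 : ℝ))) (b := ((1 : ℝ), (1 : ℝ))))
    |>.of_isClosed_subset ?_ ?_
  · exact (isClosed_le continuous_const continuous_fst).inter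
      ((isClosed_le continuous_const continuous_snd).inter
        (isClosed_le (continuous_fst.add continuous_snd) continuous_const))
  · rintro ⟨α, β⟩ ⟨h1, h2, h3⟩
    simp only at h1 h2 h3
    exact ⟨⟨h1, h2⟩, ⟨by simp only; linarith, by simp only; linarith⟩⟩

lemma swap_mem_triangle {q : ℝ × ℝ} (hq : q ∈ triangle) : q.swap ∈ triangle :=
  ⟨hq.2.1, hq.1, by simpa [add_comm] using hq.2.2⟩

/-- The infinite slope of `negMulLog` at `0` dominates differentiable perturbations. -/
lemma eventually_lt_of_negMulLog {c : ℝ} (hc : 0 < c) {r : ℝ → ℝ} (hr : DifferentiableAt ℝ r 0) :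
    ∀ᶠ t in 𝓝[>] (0 : ℝ), r 0 < c * negMulLog t + r t := by
  have h1 : Tendsto (fun t => t⁻¹ * (r t - r 0)) (𝓝[>] 0) (𝓝 (deriv r 0)) := by
    have := hr.hasDerivAt.tendsto_slope_zero_right
    simpa using this
  have h2 : Tendsto (fun t => -c * Real.log t) (𝓝[>] 0) atTop :=
    Real.tendsto_log_nhdsGT_zero.const_mul_atBot_of_neg (by linarith)
  have h3 := h2.atTop_add h1
  filter_upwards [h3.eventually_gt_atTop 0, self_mem_nhdsWithin] with t ht ht0
  have ht0 : 0 < t := ht0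
  have h4 : 0 < t * (-c * Real.log t + t⁻¹ * (r t - r 0)) := mul_pos ht0 ht
  rw [mul_add, mul_inv_cancel_left₀ ht0.ne'] at h4
  rw [negMulLog]
  linarith

/-- A point is not a maximum along a curve on which the exponent has infinite slope. -/
lemma not_isLocalMaxOn_of_curve {s : Set (ℝ × ℝ)} {q : ℝ × ℝ} {γ : ℝ → ℝ × ℝ}
    (hγ : ContinuousAt γ 0) (hγ0 : γ 0 = q) (hs : ∀ᶠ t in 𝓝[>] (0 : ℝ), γ t ∈ s)
    {c : ℝ} (hc : 0 < c) {r : ℝ → ℝ} (hr : DifferentiableAt ℝ r 0)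
    (heq : ∀ t, symmetricExponent k lam (γ t) = c * negMulLog t + r t) :
    ¬ IsLocalMaxOn (symmetricExponent k lam) s q := by
  intro hmax
  have h0 : symmetricExponent k lam q = r 0 := by rw [← hγ0, heq]; simp
  have htend : Tendsto γ (𝓝[>] 0) (𝓝[s] q) := by
    rw [tendsto_nhdsWithin_iff]
    exact ⟨hγ0 ▸ hγ.tendsto.mono_left nhdsWithin_le_nhds, hs⟩
  have h1 := htend.eventually hmax
  obtain ⟨t, ht1, ht2⟩ := (h1.and (eventually_lt_of_negMulLog hc hr)).exists
  rw [heq, h0] at ht1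
  linarith

/-- Moving inwards in the first coordinate meets a single singular term, `negMulLog t`; all others
are smooth there because `β < 1`. -/
lemma not_isLocalMaxOn_fst_zero {β : ℝ} (hβ : 0 ≤ β) (hβ1 : β < 1) :
    ¬ IsLocalMaxOn (symmetricExponent k lam) triangle (0, β) := by
  refine not_isLocalMaxOn_of_curve (γ := fun t => (t, β)) (by fun_prop) rfl ?_ (c := 1) one_pos
    (r := fun t => (t + β) * Real.log lam + negMulLog β -
      k * (negMulLog (1 - t) + negMulLog (1 - β)) + (k + 1) * negMulLog (1 - t - β)) ?_ ?_
  · filter_upwards [Ioo_mem_nhdsGT (sub_pos.2 hβ1)] with t ht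
    exact ⟨ht.1.le, hβ, by linarith [ht.2]⟩
  · have h1 : DifferentiableAt ℝ (fun t : ℝ => negMulLog (1 - t)) 0 :=
      DifferentiableAt.comp (g := negMulLog) (0 : ℝ)
        (Real.differentiableAt_negMulLog_iff.2 (by simp)) (by fun_prop)
    have h2 : DifferentiableAt ℝ (fun t : ℝ => negMulLog (1 - t - β)) 0 :=
      DifferentiableAt.comp (g := negMulLog) (0 : ℝ)
        (Real.differentiableAt_negMulLog_iff.2 (by simp; linarith)) (by fun_prop)
    fun_prop
  · intro t
    simp only [symmetricExponent]
    ring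

/-- Moving away from the hypotenuse makes the vacant density `1 - α - β` equal to `t`, and its
entropy has coefficient `k + 1`. -/
lemma not_isLocalMaxOn_hypotenuse {α β : ℝ} (hα : 0 < α) (hβ : 0 < β) (h : α + β = 1) :
    ¬ IsLocalMaxOn (symmetricExponent k lam) triangle (α, β) := by
  refine not_isLocalMaxOn_of_curve (γ := fun t => (α - t, β)) (by fun_prop) (by simp) ?_
    (c := k + 1) (by positivity)
    (r := fun t => (α - t + β) * Real.log lam + negMulLog (α - t) + negMulLog β -
      k * (negMulLog (1 - (α - t)) + negMulLog (1 - β))) ?_ ?_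
  · filter_upwards [Ioo_mem_nhdsGT hα] with t ht
    exact ⟨by simp only; linarith [ht.2], hβ.le, by simp only; linarith [ht.1]⟩
  · have h1 : DifferentiableAt ℝ (fun t : ℝ => negMulLog (α - t)) 0 :=
      DifferentiableAt.comp (g := negMulLog) (0 : ℝ)
        (Real.differentiableAt_negMulLog_iff.2 (by simp [hα.ne'])) (by fun_prop)
    have h2 : DifferentiableAt ℝ (fun t : ℝ => negMulLog (1 - (α - t))) 0 :=
      DifferentiableAt.comp (g := negMulLog) (0 : ℝ)
        (Real.differentiableAt_negMulLog_iff.2 (by simp; linarith)) (by fun_prop)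
    fun_prop
  · intro t
    simp only [symmetricExponent]
    rw [show 1 - (α - t) - β = t by linarith]
    ring

/-- Along the edge `α = 0` two singular terms occur, with coefficients `-k` from `1 - β` and `k + 1`
from `1 - α - β`. They leave `+1`. -/
lemma not_isLocalMaxOn_corner :
    ¬ IsLocalMaxOn (symmetricExponent k lam) triangle (0, 1) := by
  refine not_isLocalMaxOn_of_curve (γ := fun t => (0, 1 - t)) (by fun_prop) (by simp) ?_
    (c := 1) one_pos (r := fun t => (1 - t) * Real.log lam + negMulLog (1 - t)) ?_ ?_
  · filter_upwards [Ioo_mem_nhdsGT (zero_lt_one' ℝ)] with t ht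
    exact ⟨le_rfl, by simp only; linarith [ht.2], by simp only; linarith [ht.1]⟩
  · have h1 : DifferentiableAt ℝ (fun t : ℝ => negMulLog (1 - t)) 0 :=
      DifferentiableAt.comp (g := negMulLog) (0 : ℝ)
        (Real.differentiableAt_negMulLog_iff.2 (by simp)) (by fun_prop)
    fun_prop
  · intro t
    simp only [symmetricExponent]
    rw [show 1 - 0 - (1 - t) = t by ring, show 1 - (1 - t) = t by ring]
    simp
    ring

lemma isLocalMaxOn_swap {q : ℝ × ℝ} (h : IsLocalMaxOn (symmetricExponent k lam) triangle q) :
    IsLocalMaxOn (symmetricExponent k lam) triangle q.swap := by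
  have htend : Tendsto Prod.swap (𝓝[triangle] q.swap) (𝓝[triangle] q) := by
    rw [tendsto_nhdsWithin_iff]
    refine ⟨?_, ?_⟩
    · have := (continuous_swap (X := ℝ) (Y := ℝ)).tendsto q.swap
      rw [Prod.swap_swap] at this
      exact this.mono_left nhdsWithin_le_nhds
    · filter_upwards [self_mem_nhdsWithin] with z hz using swap_mem_triangle hz
  have h1 := htend.eventually h
  filter_upwards [h1] with z hz
  rwa [symmetricExponent_swap, ← symmetricExponent_swap q] at hz

/-- Relative local maxima lie in the interior of the triangle. -/
lemma interior_of_isLocalMaxOn {q : ℝ × ℝ} (hq : q ∈ triangle)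
    (h : IsLocalMaxOn (symmetricExponent k lam) triangle q) :
    0 < q.1 ∧ 0 < q.2 ∧ q.1 + q.2 < 1 := by
  have key : ∀ q : ℝ × ℝ, q ∈ triangle → IsLocalMaxOn (symmetricExponent k lam) triangle q →
      0 < q.1 := by
    rintro ⟨α, β⟩ ⟨h1, h2, h3⟩ h
    simp only at h1 h2 h3 ⊢
    refine lt_of_le_of_ne h1 ?_
    rintro rfl
    rcases lt_or_eq_of_le (by linarith : β ≤ 1) with hβ | rfl
    · exact not_isLocalMaxOn_fst_zero h2 hβ h
    · exact not_isLocalMaxOn_corner h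
  have h1 := key q hq h
  have h2 : 0 < q.2 := key q.swap (swap_mem_triangle hq) (isLocalMaxOn_swap h)
  refine ⟨h1, h2, lt_of_le_of_ne hq.2.2 fun h3 => ?_⟩
  exact not_isLocalMaxOn_hypotenuse h1 h2 h3 h

lemma triangle_mem_nhds {q : ℝ × ℝ} (h1 : 0 < q.1) (h2 : 0 < q.2) (h3 : q.1 + q.2 < 1) :
    triangle ∈ 𝓝 q := by
  have e1 : ∀ᶠ z : ℝ × ℝ in 𝓝 q, 0 < z.1 := continuous_fst.continuousAt.eventually (lt_mem_nhds h1)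
  have e2 : ∀ᶠ z : ℝ × ℝ in 𝓝 q, 0 < z.2 := continuous_snd.continuousAt.eventually (lt_mem_nhds h2)
  have e3 : ∀ᶠ z : ℝ × ℝ in 𝓝 q, z.1 + z.2 < 1 :=
    (continuous_fst.add continuous_snd).continuousAt.eventually (gt_mem_nhds h3)
  filter_upwards [e1, e2, e3] with z hz1 hz2 hz3 using ⟨hz1.le, hz2.le, hz3.le⟩

/-- The partial derivative of the exponent with respect to its first variable. -/
noncomputable def exponentSlope (k : ℕ) (lam α β : ℝ) : ℝ :=
  Real.log lam - Real.log α - k * Real.log (1 - α) + (k + 1) * Real.log (1 - α - β)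

lemma exponentSlope_eq_zero_iff (hlam : 0 < lam) {α β : ℝ} (hα : 0 < α) (hβ : 0 < β)
    (h : α + β < 1) :
    exponentSlope k lam α β = 0 ↔ α * (1 - α) ^ k = lam * (1 - α - β) ^ (k + 1) := by
  have h1 : 0 < 1 - α := by linarith
  have h2 : 0 < 1 - α - β := by linarith
  rw [← Real.log_injOn_pos.eq_iff
    (show α * (1 - α) ^ k ∈ Ioi 0 from by simp only [mem_Ioi]; positivity)
    (show lam * (1 - α - β) ^ (k + 1) ∈ Ioi 0 from by simp only [mem_Ioi]; positivity),
    Real.log_mul hα.ne' (by positivity), Real.log_mul hlam.ne' (by positivity), Real.log_pow,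
    Real.log_pow, exponentSlope]
  push_cast
  constructor <;> intro h <;> linarith

/-- The derivative of the exponent along a line. -/
lemma hasDerivAt_symmetricExponent_line {α β a b s : ℝ} (h1 : 0 < α + s * a) (h2 : 0 < β + s * b)
    (h3 : α + s * a + (β + s * b) < 1) :
    HasDerivAt (fun s => symmetricExponent k lam (α + s * a, β + s * b))
      (a * exponentSlope k lam (α + s * a) (β + s * b) +
        b * exponentSlope k lam (β + s * b) (α + s * a)) s := by
  have hA : HasDerivAt (fun s : ℝ => α + s * a) a s := by
    simpa using ((hasDerivAt_id s).mul_const a).const_add α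
  have hB : HasDerivAt (fun s : ℝ => β + s * b) b s := by
    simpa using ((hasDerivAt_id s).mul_const b).const_add β
  have d1 := (Real.hasDerivAt_negMulLog h1.ne').comp s hA
  have d2 := (Real.hasDerivAt_negMulLog h2.ne').comp s hB
  have d3 := (Real.hasDerivAt_negMulLog (by linarith : 1 - (α + s * a) ≠ 0)).comp s
    (hA.const_sub 1)
  have d4 := (Real.hasDerivAt_negMulLog (by linarith : 1 - (β + s * b) ≠ 0)).comp s
    (hB.const_sub 1)
  have d5 := (Real.hasDerivAt_negMulLog
    (by linarith : 1 - (α + s * a) - (β + s * b) ≠ 0)).comp s ((hA.const_sub 1).sub hB)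
  have := (((((hA.add hB).mul_const (Real.log lam)).add d1).add d2).sub
    ((d3.add d4).const_mul (k : ℝ))).add (d5.const_mul (k + 1 : ℝ))
  refine HasDerivAt.congr_deriv this ?_
  rw [exponentSlope, exponentSlope, show 1 - (β + s * b) - (α + s * a) =
    1 - (α + s * a) - (β + s * b) by ring]
  ring

/-- Relative local maxima solve the density equations. -/
lemma isDensityPair_of_isLocalMaxOn (hlam : 0 < lam) {q : ℝ × ℝ} (hq : q ∈ triangle)
    (h : IsLocalMaxOn (symmetricExponent k lam) triangle q) : IsDensityPair k lam q.1 q.2 := by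
  have key : ∀ q : ℝ × ℝ, q ∈ triangle → IsLocalMaxOn (symmetricExponent k lam) triangle q →
      q.1 * (1 - q.1) ^ k = lam * (1 - q.1 - q.2) ^ (k + 1) := by
    rintro ⟨α, β⟩ hq h
    obtain ⟨h1, h2, h3⟩ := interior_of_isLocalMaxOn hq h
    have hmax : IsLocalMax (symmetricExponent k lam) (α, β) :=
      h.isLocalMax (triangle_mem_nhds h1 h2 h3)
    have hline : IsLocalMax (fun s : ℝ => symmetricExponent k lam (α + s * 1, β + s * 0)) 0 := by
      have hc : Tendsto (fun s : ℝ => (α + s * 1, β + s * 0)) (𝓝 0) (𝓝 (α, β)) := by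
        have : Continuous fun s : ℝ => (α + s * 1, β + s * 0) := by fun_prop
        simpa using this.tendsto 0
      filter_upwards [hc.eventually hmax] with s hs
      simpa using hs
    have hd := hasDerivAt_symmetricExponent_line (k := k) (lam := lam) (α := α) (β := β) (a := 1)
      (b := 0) (s := 0) (by simpa using h1) (by simpa using h2) (by simpa using h3)
    have := hline.hasDerivAt_eq_zero hd
    simp only [zero_mul, add_zero, one_mul] at this
    exact (exponentSlope_eq_zero_iff hlam h1 h2 h3).1 this
  obtain ⟨h1, h2, h3⟩ := interior_of_isLocalMaxOn hq h
  refine ⟨h1, h2, h3, key q hq h, ?_⟩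
  have := key q.swap (swap_mem_triangle hq) (isLocalMaxOn_swap h)
  rw [Prod.fst_swap, Prod.snd_swap] at this
  rw [this]
  ring

/-- The maximum over the diagonal is attained at a symmetric solution of the density equations. -/
lemma isDensityPair_of_isMaxOn_diagonal (hlam : 0 < lam) {q : ℝ × ℝ}
    (hq : q ∈ triangle ∩ {q | q.1 = q.2})
    (h : IsMaxOn (symmetricExponent k lam) (triangle ∩ {q | q.1 = q.2}) q) :
    IsDensityPair k lam q.1 q.1 ∧ q = (q.1, q.1) := by
  obtain ⟨α, β⟩ := q
  obtain ⟨⟨h1, h2, h3⟩, h4⟩ := hq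
  simp only [mem_ofPred_eq] at h1 h2 h3 h4
  subst h4
  simp only [and_true]
  have hloc := h.localize
  have hpos : 0 < α := by
    refine lt_of_le_of_ne h1 ?_
    rintro rfl
    refine not_isLocalMaxOn_of_curve (γ := fun t => (t, t)) (by fun_prop) rfl ?_ (c := 2) two_pos
      (r := fun t => (t + t) * Real.log lam - k * (negMulLog (1 - t) + negMulLog (1 - t)) +
        (k + 1) * negMulLog (1 - t - t)) ?_ ?_ hloc
    · filter_upwards [Ioo_mem_nhdsGT (show (0 : ℝ) < 1 / 2 by norm_num)] with t ht
      exact ⟨⟨ht.1.le, ht.1.le, by simp only; linarith [ht.2]⟩, rfl⟩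
    · have h1 : DifferentiableAt ℝ (fun t : ℝ => negMulLog (1 - t)) 0 :=
        DifferentiableAt.comp (g := negMulLog) (0 : ℝ)
          (Real.differentiableAt_negMulLog_iff.2 (by simp)) (by fun_prop)
      have h2 : DifferentiableAt ℝ (fun t : ℝ => negMulLog (1 - t - t)) 0 :=
        DifferentiableAt.comp (g := negMulLog) (0 : ℝ)
          (Real.differentiableAt_negMulLog_iff.2 (by simp)) (by fun_prop)
      fun_prop
    · intro t
      simp only [symmetricExponent]
      ring
  have hlt : α + α < 1 := by
    refine lt_of_le_of_ne h3 fun he => ?_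
    obtain rfl : α = 1 / 2 := by linarith
    -- The halves are chosen so that the vacant density along the curve is exactly `t`.
    refine not_isLocalMaxOn_of_curve (γ := fun t => (1 / 2 - t / 2, 1 / 2 - t / 2)) (by fun_prop)
      (by simp) ?_ (c := k + 1) (by positivity)
      (r := fun t => (1 / 2 - t / 2 + (1 / 2 - t / 2)) * Real.log lam +
        negMulLog (1 / 2 - t / 2) + negMulLog (1 / 2 - t / 2) -
        k * (negMulLog (1 - (1 / 2 - t / 2)) + negMulLog (1 - (1 / 2 - t / 2)))) ?_ ?_ hloc
    · filter_upwards [Ioo_mem_nhdsGT (zero_lt_one' ℝ)] with t ht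
      exact ⟨⟨by simp only; linarith [ht.2], by simp only; linarith [ht.2],
        by simp only; linarith [ht.1]⟩, rfl⟩
    · have h1 : DifferentiableAt ℝ (fun t : ℝ => negMulLog (1 / 2 - t / 2)) 0 :=
        DifferentiableAt.comp (g := negMulLog) (0 : ℝ)
          (Real.differentiableAt_negMulLog_iff.2 (by norm_num)) (by fun_prop)
      have h2 : DifferentiableAt ℝ (fun t : ℝ => negMulLog (1 - (1 / 2 - t / 2))) 0 :=
        DifferentiableAt.comp (g := negMulLog) (0 : ℝ)
          (Real.differentiableAt_negMulLog_iff.2 (by norm_num)) (by fun_prop)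
      fun_prop
    · intro t
      simp only [symmetricExponent]
      rw [show 1 - (1 / 2 - t / 2) - (1 / 2 - t / 2) = t by ring]
      ring
  have hline : IsLocalMax (fun s : ℝ => symmetricExponent k lam (α + s * 1, α + s * 1)) 0 := by
    have hc : Tendsto (fun s : ℝ => (α + s * 1, α + s * 1)) (𝓝 0) (𝓝 (α, α)) := by
      have : Continuous fun s : ℝ => (α + s * 1, α + s * 1) := by fun_prop
      simpa using this.tendsto 0
    filter_upwards [hc.eventually (triangle_mem_nhds (q := (α, α)) hpos hpos hlt)] with s hs
    have : symmetricExponent k lam (α + s * 1, α + s * 1) ≤ symmetricExponent k lam (α, α) :=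
      isMaxOn_iff.1 h _ ⟨hs, rfl⟩
    simpa using this
  have hd := hasDerivAt_symmetricExponent_line (k := k) (lam := lam) (α := α) (β := α) (a := 1)
    (b := 1) (s := 0) (by simpa using hpos) (by simpa using hpos) (by simpa using hlt)
  have h0 := hline.hasDerivAt_eq_zero hd
  simp only [zero_mul, add_zero, one_mul] at h0
  have h5 := (exponentSlope_eq_zero_iff (k := k) hlam hpos hpos hlt).1 (by linarith)
  exact ⟨hpos, hpos, hlt, h5, h5⟩

/-- Solutions of the density equations are stationary points. -/
lemma IsDensityPair.hasFDerivAt (hlam : 0 < lam) {α β : ℝ} (h : IsDensityPair k lam α β) :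
    HasFDerivAt (symmetricExponent k lam) (0 : ℝ × ℝ →L[ℝ] ℝ) (α, β) := by
  have h1 := h.pos_left
  have h2 := h.pos_right
  have h3 := h.add_lt_one
  have hdiff : DifferentiableAt ℝ (symmetricExponent k lam) (α, β) := by
    have d1 : DifferentiableAt ℝ (fun q : ℝ × ℝ => negMulLog q.1) (α, β) :=
      DifferentiableAt.comp (g := negMulLog) (α, β)
        (Real.differentiableAt_negMulLog_iff.2 h1.ne') (by fun_prop)
    have d2 : DifferentiableAt ℝ (fun q : ℝ × ℝ => negMulLog q.2) (α, β) :=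
      DifferentiableAt.comp (g := negMulLog) (α, β)
        (Real.differentiableAt_negMulLog_iff.2 h2.ne') (by fun_prop)
    have d3 : DifferentiableAt ℝ (fun q : ℝ × ℝ => negMulLog (1 - q.1)) (α, β) :=
      DifferentiableAt.comp (g := negMulLog) (α, β)
        (Real.differentiableAt_negMulLog_iff.2 (by simp only; linarith)) (by fun_prop)
    have d4 : DifferentiableAt ℝ (fun q : ℝ × ℝ => negMulLog (1 - q.2)) (α, β) :=
      DifferentiableAt.comp (g := negMulLog) (α, β)
        (Real.differentiableAt_negMulLog_iff.2 (by simp only; linarith)) (by fun_prop)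
    have d5 : DifferentiableAt ℝ (fun q : ℝ × ℝ => negMulLog (1 - q.1 - q.2)) (α, β) :=
      DifferentiableAt.comp (g := negMulLog) (α, β)
        (Real.differentiableAt_negMulLog_iff.2 (by simp only; linarith)) (by fun_prop)
    unfold symmetricExponent
    fun_prop
  have hzero : fderiv ℝ (symmetricExponent k lam) (α, β) = 0 := by
    refine ContinuousLinearMap.ext fun ⟨a, b⟩ => ?_
    have hline : HasDerivAt (fun s : ℝ => (α + s * a, β + s * b)) (a, b) 0 := by
      refine HasDerivAt.prodMk ?_ ?_
      · simpa using ((hasDerivAt_id (0 : ℝ)).mul_const a).const_add α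
      · simpa using ((hasDerivAt_id (0 : ℝ)).mul_const b).const_add β
    have e0 : (α, β) = (α + 0 * a, β + 0 * b) := by simp
    have hd1 := HasFDerivAt.comp_hasDerivAt (0 : ℝ) (e0 ▸ hdiff.hasFDerivAt) hline
    have hd2 := hasDerivAt_symmetricExponent_line (k := k) (lam := lam) (α := α) (β := β) (a := a)
      (b := b) (s := 0) (by simpa using h1) (by simpa using h2) (by simpa using h3)
    have hu := hd1.unique hd2
    simp only [zero_mul, add_zero] at hu
    rw [hu, (exponentSlope_eq_zero_iff hlam h1 h2 h3).2 h.eq_left,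
      (exponentSlope_eq_zero_iff hlam h2 h1 (by linarith)).2 h.symm.eq_left]
    simp
  rw [← hzero]
  exact hdiff.hasFDerivAt

/-- A symmetric stationary point of large density is not a local maximum: the exponent is convex
in the antisymmetric direction. -/
lemma IsDensityPair.not_isLocalMax {p : ℝ} (h : IsDensityPair k lam p p)
    (hp : 1 - p < k * p) : ¬ IsLocalMax (symmetricExponent k lam) (p, p) := by
  intro hmax
  have h1 := h.pos_left
  have h3 := h.add_lt_one
  set ψ : ℝ → ℝ := fun s => symmetricExponent k lam (p + s * 1, p + s * (-1)) with hψ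
  have hcont : Continuous fun s : ℝ => (p + s * 1, p + s * (-1)) := by fun_prop
  have htend : Tendsto (fun s : ℝ => (p + s * 1, p + s * (-1))) (𝓝 0) (𝓝 (p, p)) := by
    simpa using hcont.tendsto 0
  have hmaxψ : IsLocalMax ψ 0 := by
    filter_upwards [htend.eventually hmax] with s hs
    simpa [hψ] using hs
  have hder : deriv ψ =ᶠ[𝓝 0] fun s => -Real.log (p + s) - k * Real.log (1 - p - s) +
      Real.log (p - s) + k * Real.log (1 - p + s) := by
    filter_upwards [Ioo_mem_nhds (neg_lt_zero.2 h1) h1] with s hs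
    have hd := hasDerivAt_symmetricExponent_line (k := k) (lam := lam) (α := p) (β := p) (a := 1)
      (b := -1) (s := s) (by linarith [hs.1]) (by linarith [hs.2]) (by linarith)
    rw [hd.deriv, exponentSlope, exponentSlope]
    ring_nf
  have hdd : HasDerivAt (fun s => -Real.log (p + s) - k * Real.log (1 - p - s) +
      Real.log (p - s) + k * Real.log (1 - p + s)) (2 * (k / (1 - p) - 1 / p)) 0 := by
    have hid := hasDerivAt_id (0 : ℝ)
    have d1 := (hid.const_add p).log (by simp; linarith)
    have d2 := (hid.const_sub (1 - p)).log (by simp; linarith)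
    have d3 := (hid.const_sub p).log (by simp; linarith)
    have d4 := (hid.const_add (1 - p)).log (by simp; linarith)
    refine HasDerivAt.congr_deriv
      (((d1.neg.sub (d2.const_mul (k : ℝ))).add d3).add (d4.const_mul (k : ℝ))) ?_
    simp only [id, add_zero, sub_zero]
    ring
  have hval : deriv (deriv ψ) 0 = 2 * (k / (1 - p) - 1 / p) := by
    rw [hder.deriv_eq, hdd.deriv]
  have hpos : 0 < deriv (deriv ψ) 0 := by
    rw [hval]
    have : 1 / p < k / (1 - p) := by
      rw [div_lt_div_iff₀ h1 (by linarith)]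
      linarith
    linarith
  -- The second derivative test makes `0` a local minimum as well, so `ψ` would be locally constant,
  -- contradicting its positive second derivative.
  have hmin : IsLocalMin ψ 0 := by
    refine isLocalMin_of_deriv_deriv_pos hpos ?_ ?_
    · rw [hder.self_of_nhds]; simp only [add_zero, sub_zero]; ring
    · exact (continuous_symmetricExponent.comp hcont).continuousAt
  have hconst : ψ =ᶠ[𝓝 0] fun _ => ψ 0 := by
    filter_upwards [hmin, hmaxψ] with s hs1 hs2 using le_antisymm hs2 hs1
  have : deriv (deriv ψ) 0 = 0 := by
    rw [hconst.deriv.deriv_eq]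
    simp
  linarith

end Exponent

/-! ### Identification of the maximum points -/

section Maxima

variable {k : ℕ} {lam : ℝ}

lemma isMaxOn_Phi1_iff {s : Set (ℝ × ℝ)} (hs : s ⊆ triangle) {q : ℝ × ℝ} (hq : q ∈ s) :
    IsMaxOn (Phi1 (k + 1) lam) s q ↔ IsMaxOn (symmetricExponent k lam) s q := by
  simp only [isMaxOn_iff]
  refine forall₂_congr fun z hz => ?_
  rw [Phi1_eq_of_mem (hs hz), Phi1_eq_of_mem (hs hq)]

lemma maximaOn_Phi1 {s : Set (ℝ × ℝ)} (hs : s ⊆ triangle) :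
    maximaOn (Phi1 (k + 1) lam) s = maximaOn (symmetricExponent k lam) s := by
  ext q
  exact and_congr_right fun hq => isMaxOn_Phi1_iff hs hq

lemma localMaximaOn_Phi1 :
    localMaximaOn (Phi1 (k + 1) lam) triangle =
      localMaximaOn (symmetricExponent k lam) triangle := by
  ext q
  refine and_congr_right fun hq => eventually_congr ?_
  filter_upwards [self_mem_nhdsWithin] with z hz
  rw [Phi1_eq_of_mem hz, Phi1_eq_of_mem hq]

lemma maximaOn_subset_localMaximaOn (f : ℝ × ℝ → ℝ) (s : Set (ℝ × ℝ)) :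
    maximaOn f s ⊆ localMaximaOn f s :=
  fun _ hq => ⟨hq.1, hq.2.localize⟩

lemma maximaOn_nonempty {s : Set (ℝ × ℝ)} (hs : IsCompact s) (hne : s.Nonempty) :
    (maximaOn (symmetricExponent k lam) s).Nonempty := by
  obtain ⟨q, hq, hmax⟩ := hs.exists_isMaxOn hne continuous_symmetricExponent.continuousOn
  exact ⟨q, hq, hmax⟩

lemma triangle_nonempty : triangle.Nonempty := ⟨(0, 0), by simp [triangle]⟩

lemma maximaOn_diagonal (hlam : 0 < lam) :
    maximaOn (Phi1 (k + 1) lam) (triangle ∩ {q | q.1 = q.2}) =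
      {(symmetricDensity k lam, symmetricDensity k lam)} := by
  rw [maximaOn_Phi1 inter_subset_left]
  refine (Set.Nonempty.subset_singleton_iff ?_).1 fun q hq => ?_
  · refine maximaOn_nonempty ?_ ⟨(0, 0), by simp [triangle]⟩
    exact isCompact_triangle.inter_right (isClosed_eq continuous_fst continuous_snd)
  · obtain ⟨h1, h2⟩ := isDensityPair_of_isMaxOn_diagonal hlam hq.1 hq.2
    rw [mem_singleton_iff, h2, h1.eq_symmetricDensity]

lemma maximaOn_triangle_of_le {m : ℕ} (hlam : 0 < lam) (hc : lam ≤ criticalActivity (m + 3)) :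
    maximaOn (Phi1 (m + 3) lam) triangle =
        {(symmetricDensity (m + 2) lam, symmetricDensity (m + 2) lam)} ∧
      localMaximaOn (Phi1 (m + 3) lam) triangle =
        {(symmetricDensity (m + 2) lam, symmetricDensity (m + 2) lam)} := by
  rw [maximaOn_Phi1 (k := m + 2) subset_rfl, localMaximaOn_Phi1 (k := m + 2)]
  have hne := maximaOn_nonempty (k := m + 2) (lam := lam) isCompact_triangle triangle_nonempty
  have hsub : localMaximaOn (symmetricExponent (m + 2) lam) triangle ⊆
      {(symmetricDensity (m + 2) lam, symmetricDensity (m + 2) lam)} := by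
    intro q hq
    obtain ⟨h1, h2⟩ := (isDensityPair_of_isLocalMaxOn hlam hq.1 hq.2).eq_of_le hc
    exact Prod.ext h1 h2
  have hmax := maximaOn_subset_localMaximaOn (symmetricExponent (m + 2) lam) triangle
  exact ⟨hne.subset_singleton_iff.1 (hmax.trans hsub), (hne.mono hmax).subset_singleton_iff.1 hsub⟩

/-- For `p = x / (1 + 2 x)` the convexity condition `1 - p < (m + 2) p` reads `x > 1 / (m + 1)`, and
`1 / (m + 1)` is the symmetric ratio at the critical activity. -/
lemma not_isLocalMax_symmetricDensity {m : ℕ} (hc : criticalActivity (m + 3) < lam) :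
    ¬ IsLocalMax (symmetricExponent (m + 2) lam)
      (symmetricDensity (m + 2) lam, symmetricDensity (m + 2) lam) := by
  have hlam := (criticalActivity_pos m).trans hc
  refine (isDensityPair_symmetricDensity (m + 2) hlam).not_isLocalMax ?_
  have hs := symmetricRatio_pos (m + 2) hlam
  have h := inv_lt_symmetricRatio m hc
  rw [div_lt_iff₀ (by positivity)] at h
  rw [symmetricDensity]
  set x := symmetricRatio (m + 2) lam
  rw [one_sub_div (by positivity), ← mul_div_assoc, div_lt_div_iff_of_pos_right (by positivity)]
  push_cast
  linarith

/-- Once the symmetric point is excluded, only the two orderings of the asymmetric pair can be local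
maxima. Compactness makes one of them a global maximum and exchange of coordinates gives the other.
-/
lemma maximaOn_triangle_of_gt {m : ℕ} (hc : criticalActivity (m + 3) < lam) :
    maximaOn (Phi1 (m + 3) lam) triangle =
        {(smallDensity m lam, largeDensity m lam), (largeDensity m lam, smallDensity m lam)} ∧
      localMaximaOn (Phi1 (m + 3) lam) triangle =
        {(smallDensity m lam, largeDensity m lam), (largeDensity m lam, smallDensity m lam)} := by
  have hlam := (criticalActivity_pos m).trans hc
  rw [maximaOn_Phi1 (k := m + 2) subset_rfl, localMaximaOn_Phi1 (k := m + 2)]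
  have hne := maximaOn_nonempty (k := m + 2) (lam := lam) isCompact_triangle triangle_nonempty
  have hsub : localMaximaOn (symmetricExponent (m + 2) lam) triangle ⊆
      {(smallDensity m lam, largeDensity m lam), (largeDensity m lam, smallDensity m lam)} := by
    rintro ⟨α, β⟩ hq
    have hint := interior_of_isLocalMaxOn hq.1 hq.2
    rcases (isDensityPair_of_isLocalMaxOn hlam hq.1 hq.2).eq_or with ⟨h1, h2⟩ | ⟨h1, h2⟩ | ⟨h1, h2⟩
    · exfalso
      simp only at h1 h2
      subst h1 h2
      exact not_isLocalMax_symmetricDensity hc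
        (hq.2.isLocalMax (triangle_mem_nhds hint.1 hint.2.1 hint.2.2))
    · exact Or.inl (Prod.ext h1 h2)
    · exact Or.inr (Prod.ext h1 h2)
  have hmax := maximaOn_subset_localMaximaOn (symmetricExponent (m + 2) lam) triangle
  have hswap : ∀ q ∈ maximaOn (symmetricExponent (m + 2) lam) triangle,
      q.swap ∈ maximaOn (symmetricExponent (m + 2) lam) triangle := by
    intro q hq
    refine ⟨swap_mem_triangle hq.1, isMaxOn_iff.2 fun z hz => ?_⟩
    rw [symmetricExponent_swap]
    exact isMaxOn_iff.1 hq.2 z hz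
  have hsup : {(smallDensity m lam, largeDensity m lam), (largeDensity m lam, smallDensity m lam)} ⊆
      maximaOn (symmetricExponent (m + 2) lam) triangle := by
    obtain ⟨q, hq⟩ := hne
    have hq' := hswap q hq
    rcases hsub (hmax hq) with rfl | rfl
    · exact insert_subset hq (singleton_subset_iff.2 hq')
    · exact insert_subset hq' (singleton_subset_iff.2 hq)
  exact ⟨(hmax.trans hsub).antisymm hsup, hsub.antisymm (hsup.trans hmax)⟩

/-- It is no local minimum because it is the unique maximum on the diagonal: nearby diagonal points
with at least the same value would be further maxima there. -/
lemma isSaddle_symmetricDensity {m : ℕ} (hc : criticalActivity (m + 3) < lam) :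
    IsSaddle (Phi1 (m + 3) lam) (symmetricDensity (m + 2) lam, symmetricDensity (m + 2) lam) := by
  have hlam := (criticalActivity_pos m).trans hc
  have hpair := isDensityPair_symmetricDensity (m + 2) hlam
  have hdiag := maximaOn_diagonal (k := m + 2) hlam
  have hnot := not_isLocalMax_symmetricDensity hc
  set p := symmetricDensity (m + 2) lam
  have hnhds : triangle ∈ 𝓝 (p, p) :=
    triangle_mem_nhds hpair.pos_left hpair.pos_right hpair.add_lt_one
  have heq : Phi1 (m + 3) lam =ᶠ[𝓝 (p, p)] symmetricExponent (m + 2) lam := by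
    filter_upwards [hnhds] with q hq using Phi1_eq_of_mem hq
  refine ⟨(hpair.hasFDerivAt hlam).congr_of_eventuallyEq heq, ?_, fun hmin => ?_⟩
  · rwa [heq.isLocalMax_iff]
  · have hmax : (p, p) ∈ maximaOn (Phi1 (m + 3) lam) (triangle ∩ {q | q.1 = q.2}) :=
      hdiag ▸ mem_singleton _
    have hc : Tendsto (fun s : ℝ => (s, s)) (𝓝 p) (𝓝 (p, p)) :=
      (continuous_id.prodMk continuous_id).tendsto p
    have hev := (hc.eventually hmin).and (hc.eventually hnhds)
    obtain ⟨s, ⟨hs1, hs2⟩, hs3⟩ :=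
      ((hev.filter_mono nhdsWithin_le_nhds).and (self_mem_nhdsWithin (s := {p}ᶜ))).exists
    have hs : (s, s) ∈ maximaOn (Phi1 (m + 3) lam) (triangle ∩ {q | q.1 = q.2}) :=
      ⟨⟨hs2, rfl⟩, isMaxOn_iff.2 fun z hz => (isMaxOn_iff.1 hmax.2 z hz).trans hs1⟩
    rw [hdiag] at hs
    exact hs3 (congrArg Prod.fst hs)

end Maxima

/-! ### Simple Gibbs measures and solutions of the density equations -/

section GibbsMeasures

variable {V : Type*} {G : SimpleGraph V} [G.LocallyFinite] {k : ℕ} {lam α β : ℝ}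

/-- `μ` is a simple Gibbs measure with density `α` at even and density `β` at odd vertices. -/
structure IsSimpleGibbsWithDensities (G : SimpleGraph V) (lam : ℝ) (o : V) (α β : ℝ)
    (μ : Measure (Set V)) : Prop where
  isGibbs : IsGibbs G lam μ
  isSimple : IsSimpleMeasure G μ
  even : ∀ v, IsEvenVertex G o v → μ.real {I | v ∈ I} = α
  odd : ∀ v, ¬ IsEvenVertex G o v → μ.real {I | v ∈ I} = β

/-- The coin at `v` has bias `A v / (1 - B v)`, the density of `v` divided by the probability that a
neighbour is vacant. The density equations are then the local Gibbs condition of the chain. -/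
lemma exists_isSimpleGibbsWithDensities (hG : G.IsTree) (hreg : G.IsRegularOfDegree (k + 1))
    (o : V) (h : IsDensityPair k lam α β) : ∃ μ, IsSimpleGibbsWithDensities G lam o α β μ := by
  classical
  have := hG.connected.countable_of_locallyFinite
  let A : V → ℝ := fun v => if IsEvenVertex G o v then α else β
  let B : V → ℝ := fun v => if IsEvenVertex G o v then β else α
  have hpair : ∀ v, IsDensityPair k lam (A v) (B v) := by
    intro v
    by_cases hv : IsEvenVertex G o v
    · simpa [A, B, hv] using h
    · simpa [A, B, hv] using h.symm
  have hadj : ∀ v w, G.Adj v w → B w = A v ∧ A w = B v := by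
    intro v w hvw
    have := isEvenVertex_iff_not_of_adj hG o hvw
    by_cases hv : IsEvenVertex G o v <;> simp_all [A, B]
  have hlt : ∀ v, A v < 1 := fun v => by linarith [(hpair v).add_lt_one, (hpair v).pos_right]
  have hB : ∀ v, 0 < 1 - B v := fun v => by linarith [(hpair v).add_lt_one, (hpair v).pos_left]
  have hq1 : ∀ v, A v / (1 - B v) < 1 := fun v => by
    rw [div_lt_one (hB v)]
    linarith [(hpair v).add_lt_one]
  let a : V → unitInterval := fun v => ⟨A v, (hpair v).pos_left.le, (hlt v).le⟩
  let q : V → unitInterval := fun v =>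
    ⟨A v / (1 - B v), div_nonneg (hpair v).pos_left.le (hB v).le, (hq1 v).le⟩
  have hq : ∀ v w, G.Adj v w → (q w : ℝ) * (1 - a v) = a w := by
    intro v w hvw
    have := hB w
    simp only [q, a, ← (hadj v w hvw).1]
    field_simp
  have hapos : ∀ v, 0 < a v := fun v => (hpair v).pos_left
  have hgibbs : ∀ v, (a v : ℝ) = lam * (1 - a v) * ∏ u ∈ G.neighborFinset v, (1 - (q u : ℝ)) := by
    intro v
    have h1 : ∀ u ∈ G.neighborFinset v, (1 - (q u : ℝ)) = (1 - A v - B v) / (1 - A v) := by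
      intro u hu
      obtain ⟨h2, h3⟩ := hadj v u (by simpa using hu)
      have := hlt v
      have h4 : 1 - A v ≠ 0 := by linarith
      simp only [q, h2, h3]
      field_simp
    have h5 : 0 < 1 - A v := by linarith [hlt v]
    rw [Finset.prod_congr rfl h1, Finset.prod_const, SimpleGraph.card_neighborFinset_eq_degree,
      hreg.degree_eq, div_pow]
    have h6 := (hpair v).eq_left
    simp only [a]
    rw [← mul_div_assoc, eq_div_iff (by positivity), pow_succ]
    linear_combination (1 - A v) * h6
  have hdens := treeMeasure_real_mem hG hq o
  refine ⟨treeMeasure G a q o, isGibbs_treeMeasure hG hq hlt hq1 hgibbs o,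
    isSimpleMeasure_treeMeasure hG hq hapos hlt o, fun v hv => ?_, fun v hv => ?_⟩
  · rw [hdens]; simp [a, A, hv]
  · rw [hdens]; simp [a, A, hv]

/-- The density equation at an even vertex and at an odd one gives the two equations; one of the `k
+ 1` factors in the denominator cancels against the vacancy probability of the vertex. -/
lemma IsSimpleGibbsWithDensities.isDensityPair (hG : G.IsTree)
    (hreg : G.IsRegularOfDegree (k + 1)) {o : V} (hlam : 0 < lam) {μ : Measure (Set V)}
    (h : IsSimpleGibbsWithDensities G lam o α β μ) : IsDensityPair k lam α β := by
  have := hG.connected.countable_of_locallyFinite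
  have key : ∀ (v : V) (a b : ℝ), μ.real {I | v ∈ I} = a →
      (∀ u, G.Adj v u → μ.real {I | u ∈ I} = b) →
      0 < a ∧ a + b < 1 ∧ a * (1 - a) ^ k = lam * (1 - a - b) ^ (k + 1) := by
    rintro v a b rfl hb
    obtain ⟨h1, h2, h3, h4⟩ := h.isGibbs.density_eq hlam h.isSimple v
    obtain ⟨u, hu⟩ : ∃ u, G.Adj v u := by
      rw [← G.degree_pos_iff_exists_adj, hreg.degree_eq]
      omega
    have h5 := h3 u hu
    rw [hb u hu] at h5
    refine ⟨h1, by linarith, ?_⟩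
    rw [Finset.prod_congr rfl fun u hu => by rw [hb u (by simpa using hu)], Finset.prod_const,
      SimpleGraph.card_neighborFinset_eq_degree, hreg.degree_eq] at h4
    set a := μ.real {I | v ∈ I}
    have h6 : 0 < 1 - a := by linarith
    rw [one_sub_div h6.ne', div_pow, ← mul_div_assoc, eq_div_iff (by positivity), pow_succ] at h4
    refine mul_right_cancel₀ h6.ne' ?_
    linear_combination h4
  have hodd : ∀ u, G.Adj o u → ¬ IsEvenVertex G o u := fun u hu =>
    (isEvenVertex_iff_not_of_adj hG o hu).1 (isEvenVertex_self G o)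
  obtain ⟨w, hw⟩ : ∃ w, G.Adj o w := by
    rw [← G.degree_pos_iff_exists_adj, hreg.degree_eq]
    omega
  obtain ⟨h1, h2, h3⟩ := key o α β (h.even o (isEvenVertex_self G o))
    fun u hu => h.odd u (hodd u hu)
  obtain ⟨h4, -, h5⟩ := key w β α (h.odd w (hodd w hw)) fun u hu => h.even u (by
    by_contra he
    exact hodd w hw ((isEvenVertex_iff_not_of_adj hG o hu).2 he))
  exact ⟨h1, h4, h2, h3, by rw [h5]; ring⟩

lemma IsSimpleGibbsWithDensities.densities_lt_one (hG : G.IsTree)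
    (hreg : G.IsRegularOfDegree (k + 1)) {o : V} (hlam : 0 < lam) {μ : Measure (Set V)}
    (h : IsSimpleGibbsWithDensities G lam o α β μ) (v : V) : μ.real {I | v ∈ I} < 1 := by
  have hp := h.isDensityPair hG hreg hlam
  by_cases hv : IsEvenVertex G o v
  · rw [h.even v hv]; linarith [hp.add_lt_one, hp.pos_right]
  · rw [h.odd v hv]; linarith [hp.add_lt_one, hp.pos_left]

lemma IsSimpleGibbsWithDensities.eq (hG : G.IsTree) (hreg : G.IsRegularOfDegree (k + 1)) {o : V}
    (hlam : 0 < lam) {μ ν : Measure (Set V)} (hμ : IsSimpleGibbsWithDensities G lam o α β μ)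
    (hν : IsSimpleGibbsWithDensities G lam o α β ν) : μ = ν := by
  have := hμ.isGibbs.isProbabilityMeasure
  have := hν.isGibbs.isProbabilityMeasure
  refine IsSimpleMeasure.ext hG hμ.isGibbs.ae_isIndepSet hν.isGibbs.ae_isIndepSet hμ.isSimple
    hν.isSimple (fun v => ?_) (hμ.densities_lt_one hG hreg hlam)
  by_cases hv : IsEvenVertex G o v
  · rw [hμ.even v hv, hν.even v hv]
  · rw [hμ.odd v hv, hν.odd v hv]

lemma IsSimpleGibbsWithDensities.isSemiTranslationInvariant (hG : G.IsTree)
    (hreg : G.IsRegularOfDegree (k + 1)) {o : V} (hlam : 0 < lam) {μ : Measure (Set V)}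
    (h : IsSimpleGibbsWithDensities G lam o α β μ) : IsSemiTranslationInvariant G o μ := by
  intro φ hφ
  have := h.isGibbs.isProbabilityMeasure
  refine h.isSimple.map_iso_eq hG h.isGibbs.ae_isIndepSet (h.densities_lt_one hG hreg hlam) φ
    fun v => ?_
  by_cases hv : IsEvenVertex G o v
  · rw [h.even v hv, h.even _ ((hφ v).2 hv)]
  · rw [h.odd v hv, h.odd _ (mt (hφ v).1 hv)]

lemma IsSimpleGibbsWithDensities.isTranslationInvariant_iff (hG : G.IsTree)
    (hreg : G.IsRegularOfDegree (k + 1)) {o : V} (hlam : 0 < lam) {μ : Measure (Set V)}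
    (h : IsSimpleGibbsWithDensities G lam o α β μ) : IsTranslationInvariant G μ ↔ α = β := by
  constructor
  · intro hμ
    obtain ⟨w, hw⟩ : ∃ w, G.Adj o w := by
      rw [← G.degree_pos_iff_exists_adj, hreg.degree_eq]
      omega
    have ho := isEvenVertex_self G o
    rw [← h.even o ho, ← h.odd w ((isEvenVertex_iff_not_of_adj hG o hw).1 ho)]
    exact hμ.measureReal_eq hG hreg o w
  · rintro rfl φ
    have := h.isGibbs.isProbabilityMeasure
    have hall : ∀ v, μ.real {I | v ∈ I} = α := fun v => by
      by_cases hv : IsEvenVertex G o v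
      · exact h.even v hv
      · exact h.odd v hv
    refine h.isSimple.map_iso_eq hG h.isGibbs.ae_isIndepSet (h.densities_lt_one hG hreg hlam) φ
      fun v => ?_
    rw [hall, hall]

lemma IsSemiTranslationInvariant.exists_densities (hG : G.IsTree)
    (hreg : G.IsRegularOfDegree (k + 1)) {o : V} {μ : Measure (Set V)} (hμ : IsGibbs G lam μ)
    (hs : IsSimpleMeasure G μ) (h : IsSemiTranslationInvariant G o μ) :
    ∃ α β, IsSimpleGibbsWithDensities G lam o α β μ := by
  obtain ⟨w, hw⟩ : ∃ w, G.Adj o w := by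
    rw [← G.degree_pos_iff_exists_adj, hreg.degree_eq]
    omega
  have ho := isEvenVertex_self G o
  have hw' := (isEvenVertex_iff_not_of_adj hG o hw).1 ho
  exact ⟨μ.real {I | o ∈ I}, μ.real {I | w ∈ I}, hμ, hs,
    fun v hv => h.measureReal_eq hG hreg (iff_of_true hv ho),
    fun v hv => h.measureReal_eq hG hreg (iff_of_false hv hw')⟩

end GibbsMeasures

theorem mainTheorem6 {V : Type*} (d : ℕ) (hd : 3 ≤ d)
    (G : SimpleGraph V) [G.LocallyFinite] (hG : G.IsTree) (hreg : G.IsRegularOfDegree d) (o : V) :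
    ∃ pstar p₁ p₂ : ℝ → ℝ,
      -- `pstar` is the density of the unique simple translation-invariant Gibbs measure,
      -- and it gives the maximum on the diagonal
      (∀ lam : ℝ, 0 < lam →
        (∃ μ : Measure (Set V),
          {ν | IsGibbs G lam ν ∧ IsSimpleMeasure G ν ∧ IsTranslationInvariant G ν} = {μ} ∧
          ∀ v : V, μ.real {I | v ∈ I} = pstar lam) ∧
        maximaOn (Phi1 d lam) (triangle ∩ {q | q.1 = q.2}) = {(pstar lam, pstar lam)}) ∧
      -- the regime `lam ≤ λ_c`
      (∀ lam : ℝ, 0 < lam → lam ≤ criticalActivity d →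
        maximaOn (Phi1 d lam) triangle = {(pstar lam, pstar lam)} ∧
        localMaximaOn (Phi1 d lam) triangle = {(pstar lam, pstar lam)}) ∧
      -- the regime `lam > λ_c`
      (∀ lam : ℝ, criticalActivity d < lam →
        IsSaddle (Phi1 d lam) (pstar lam, pstar lam) ∧
        p₁ lam < pstar lam ∧ pstar lam < p₂ lam ∧
        maximaOn (Phi1 d lam) triangle = {(p₁ lam, p₂ lam), (p₂ lam, p₁ lam)} ∧
        localMaximaOn (Phi1 d lam) triangle = {(p₁ lam, p₂ lam), (p₂ lam, p₁ lam)} ∧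
        ∃ μ₁ μ₂ : Measure (Set V),
          {ν | IsGibbs G lam ν ∧ IsSimpleMeasure G ν ∧ IsSemiTranslationInvariant G o ν ∧
            ¬ IsTranslationInvariant G ν} = {μ₁, μ₂} ∧
          (∀ v : V, IsEvenVertex G o v →
            μ₁.real {I | v ∈ I} = p₁ lam ∧ μ₂.real {I | v ∈ I} = p₂ lam) ∧
          (∀ v : V, ¬ IsEvenVertex G o v →
            μ₁.real {I | v ∈ I} = p₂ lam ∧ μ₂.real {I | v ∈ I} = p₁ lam)) ∧
      -- continuity in the activity
      ContinuousOn pstar (Ioi 0) ∧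
      ContinuousOn p₁ (Ioi (criticalActivity d)) ∧
      ContinuousOn p₂ (Ioi (criticalActivity d)) ∧
      Tendsto (fun lam => p₁ lam - pstar lam) (𝓝[>] criticalActivity d) (𝓝 0) ∧
      Tendsto (fun lam => p₂ lam - pstar lam) (𝓝[>] criticalActivity d) (𝓝 0) := by
  -- With `d = m + 3` the exponent in the density equations is `m + 2`, and `geomSum m` has `d - 2`
  -- terms, at least one.
  obtain ⟨m, rfl⟩ := Nat.exists_eq_add_of_le' hd
  have hreg' : G.IsRegularOfDegree (m + 2 + 1) := hreg
  refine ⟨symmetricDensity (m + 2), smallDensity m, largeDensity m, fun lam hlam => ⟨?_, ?_⟩,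
    fun lam hlam hc => maximaOn_triangle_of_le hlam hc, fun lam hc => ?_,
    (continuousOn_symmetricDensity _).mono Ioi_subset_Ici_self,
    (continuousOn_smallDensity m).mono Ioi_subset_Ici_self,
    (continuousOn_largeDensity m).mono Ioi_subset_Ici_self,
    tendsto_smallDensity_sub m, tendsto_largeDensity_sub m⟩
  · obtain ⟨μ, hμ⟩ := exists_isSimpleGibbsWithDensities hG hreg' o
      (isDensityPair_symmetricDensity (m + 2) hlam)
    refine ⟨μ, ?_, fun v => ?_⟩
    · ext ν
      simp only [mem_ofPred_eq, mem_singleton_iff]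
      constructor
      · rintro ⟨h1, h2, h3⟩
        obtain ⟨α, β, hν⟩ := IsSemiTranslationInvariant.exists_densities hG hreg' (o := o) h1 h2
          fun φ _ => h3 φ
        -- Full invariance equates the even and odd densities, so only the symmetric solution
        -- remains at any activity, even beyond `λ_c`.
        obtain rfl := (hν.isTranslationInvariant_iff hG hreg' hlam).1 h3
        obtain rfl := (hν.isDensityPair hG hreg' hlam).eq_symmetricDensity
        exact hν.eq hG hreg' hlam hμ
      · rintro rfl
        exact ⟨hμ.isGibbs, hμ.isSimple, (hμ.isTranslationInvariant_iff hG hreg' hlam).2 rfl⟩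
    · by_cases hv : IsEvenVertex G o v
      · exact hμ.even v hv
      · exact hμ.odd v hv
  · exact maximaOn_diagonal (k := m + 2) hlam
  · have hlam := (criticalActivity_pos m).trans hc
    obtain ⟨hlt₁, hlt₂⟩ := smallDensity_lt_and_lt_largeDensity m hc
    obtain ⟨hmax, hlocal⟩ := maximaOn_triangle_of_gt hc
    refine ⟨isSaddle_symmetricDensity hc, hlt₁, hlt₂, hmax, hlocal, ?_⟩
    have hpair := isDensityPair_small_large m hc
    obtain ⟨μ₁, h₁⟩ := exists_isSimpleGibbsWithDensities hG hreg' o hpair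
    obtain ⟨μ₂, h₂⟩ := exists_isSimpleGibbsWithDensities hG hreg' o hpair.symm
    refine ⟨μ₁, μ₂, ?_, fun v hv => ⟨h₁.even v hv, h₂.even v hv⟩,
      fun v hv => ⟨h₁.odd v hv, h₂.odd v hv⟩⟩
    ext ν
    simp only [mem_ofPred_eq, mem_insert_iff, mem_singleton_iff]
    constructor
    · rintro ⟨hν₁, hν₂, hν₃, hν₄⟩
      obtain ⟨α, β, hν⟩ := hν₃.exists_densities hG hreg' hν₁ hν₂
      rw [hν.isTranslationInvariant_iff hG hreg' hlam] at hν₄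
      rcases (hν.isDensityPair hG hreg' hlam).eq_or with ⟨h, -⟩ | ⟨rfl, rfl⟩ | ⟨rfl, rfl⟩
      · exact absurd h hν₄
      · exact Or.inl (hν.eq hG hreg' hlam h₁)
      · exact Or.inr (hν.eq hG hreg' hlam h₂)
    · rintro (rfl | rfl)
      · refine ⟨h₁.isGibbs, h₁.isSimple, h₁.isSemiTranslationInvariant hG hreg' hlam, ?_⟩
        rw [h₁.isTranslationInvariant_iff hG hreg' hlam]
        exact (hlt₁.trans hlt₂).ne
      · refine ⟨h₂.isGibbs, h₂.isSimple, h₂.isSemiTranslationInvariant hG hreg' hlam, ?_⟩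
        rw [h₂.isTranslationInvariant_iff hG hreg' hlam]
        exact (hlt₁.trans hlt₂).ne'
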